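/- Let $\mathbb D$ be the open unit disc, $\mathbb T=\partial\mathbb D$, $m$ the normalized Lebesgue measure on $\mathbb T$ and $m_n=m\otimes\dots\otimes m$ on $\mathbb T^n$. Put $C(z,\zeta)=\prod_{j=1}^n (1-z_j\overline{\zeta_j})^{-1}$ and $P(z,\zeta)=C(z,\zeta)C(\zeta,z)/C(z,z)$. An inner function is a holomorphic $I:\mathbb D^n\to\mathbb D$ whose radial limits exist and are unimodular $m_n$-a.e. For $\alpha\in\mathbb T$, the Clark measure $\sigma_\alpha=\sigma_\alpha[I]$ is the unique finite positive Borel measure on $\mathbb T^n$ with $$\int_{\mathbb T^n}P(z,\zeta)\,d\sigma_\alpha(\zeta)=\operatorname{Re}\frac{\alpha+I(z)}{\alpha-I(z)},\qquad z\in\mathbb D^n.$$ Let $H^2=H^2(\mathbb D^n)$ be the Hardy space, identified with the space of its boundary functions in $L^2(m_n)$. The model space $H^2\ominus IH^2$ has reproducing kernel $K_w(z)=(1-I(z)\overline{I(w)})C(z,w)$. Let $T_\alpha:H^2\ominus IH^2\to L^2(\sigma_\alpha)$ be the unique linear isometry with $(T_\alpha K_w)(\xi)=(1-\alpha\overline{I(w)})C(\xi,w)$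 for all $w\in\mathbb D^n$. It is called unitary if it is onto. In each of the following examples $I$ is inner, $\sigma_\alpha$ and $T_\alpha$ exist and are unique for every $\alpha\in\mathbb T$, and the following holds. 1. Let $n\ge2$ and $I(z)=z_1$ on $\mathbb D^n$. Then, for every $\alpha\in\mathbb T$, $\sigma_\alpha=\delta_\alpha(\zeta_1)\otimes m(\zeta_2)\otimes\dots\otimes m(\zeta_n)$ and $T_\alpha$ is not unitary. 2. Let $I(z)=z_1z_2$ on $\mathbb D^2$. Then, for every $\alpha\in\mathbb T$, $\sigma_\alpha$ is the image of $m$ under $\xi\mapsto(\xi,\alpha\overline\xi)$ and $T_\alpha$ is unitary. 3. Let $I(z)=\dfrac{z_1+z_2+2z_1z_2}{z_1+z_2+2}$ on $\mathbb D^2$. If $\alpha\in\mathbb T$, $\alpha\ne-1$, put $b_\alpha(\xi)=\dfrac{1+2\xi-\alpha}{(\alpha-1)\xi+2\alpha}$. Then $b_\alpha$ maps $\mathbb T$ continuously into $\mathbb T$, there is a continuous $h_\alpha:\mathbb T\to[0,\infty)$ with $h_\alpha(-1)=0$ such that $\sigma_\alpha$ is the image of $h_\alpha\,m$ under $\xi\mapsto(\xi,\overline{b_\alpha(\xi)})$,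 and $T_\alpha$ is unitary. For $\alpha=-1$, $\sigma_{-1}=\tfrac12\left(\delta_{-1}\otimes m+m\otimes\delta_{-1}\right)$ and $T_{-1}$ is not unitary. -/

import Mathlib

open MeasureTheory Filter Topology
open scoped ENNReal ComplexConjugate

noncomputable section

namespace ClarkTorus

/-- The open unit polydisc of `ℂⁿ`. -/
def polydisc (n : ℕ) : Set (Fin n → ℂ) := {z | ∀ j, ‖z j‖ < 1}

/-- The torus, a product of `n` unit circles. -/
abbrev Torus (n : ℕ) : Type := Fin n → Circle

/-- The inclusion of the torus in `ℂⁿ`. -/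
def Torus.toComplex {n : ℕ} (ζ : Torus n) : Fin n → ℂ := fun j => (ζ j : ℂ)

instance instMeasurableSpaceCircle : MeasurableSpace Circle := borel Circle

instance instBorelSpaceCircle : BorelSpace Circle := ⟨rfl⟩

instance instFactTwoPi : Fact (0 < 2 * Real.pi) := ⟨Real.two_pi_pos⟩

/-- The normalized Lebesgue measure on the unit circle (total mass one). -/
def circleMeasure : Measure Circle :=
  Measure.map (AddCircle.toCircle (T := 2 * Real.pi)) AddCircle.haarAddCircle

/-- The normalized Lebesgue measure on the torus. -/
def torusMeasure (n : ℕ) : Measure (Torus n) := Measure.pi fun _ => circleMeasure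

/-- The Cauchy kernel `C(z, w) = ∏ⱼ 1 / (1 - zⱼ w̄ⱼ)`. -/
def cauchyKernel {n : ℕ} (z w : Fin n → ℂ) : ℂ := ∏ j, 1 / (1 - z j * conj (w j))

/-- The Poisson kernel `P(z, ζ) = C(z, ζ) C(ζ, z) / C(z, z)`. -/
def poissonKernel {n : ℕ} (z : Fin n → ℂ) (ζ : Torus n) : ℂ :=
  cauchyKernel z ζ.toComplex * cauchyKernel ζ.toComplex z / cauchyKernel z z

/-- `σ` is a Clark measure of `φ` at `α`: a positive finite Borel measure on the torus whose
Poisson integral is `Re ((α + φ) / (α - φ))`. -/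
def IsClarkMeasure {n : ℕ} (φ : (Fin n → ℂ) → ℂ) (α : Circle) (σ : Measure (Torus n)) : Prop :=
  IsFiniteMeasure σ ∧
    ∀ z ∈ polydisc n, ∫ ζ, poissonKernel z ζ ∂σ = (((α + φ z) / (α - φ z)).re : ℂ)

open Classical in
/-- The Clark measure `σ_α[φ]` (the zero measure if there is none). -/
def clarkMeasure {n : ℕ} (φ : (Fin n → ℂ) → ℂ) (α : Circle) : Measure (Torus n) :=
  if h : ∃ σ, IsClarkMeasure φ α σ then h.choose else 0

/-- Inner functions: holomorphic maps from the polydisc to the unit disc whose radial limits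
exist and are unimodular almost everywhere on the torus. -/
def IsInner {n : ℕ} (I : (Fin n → ℂ) → ℂ) : Prop :=
  DifferentiableOn ℂ I (polydisc n) ∧
    (∀ z ∈ polydisc n, ‖I z‖ < 1) ∧
    ∀ᵐ ζ ∂torusMeasure n, ∃ c : ℂ, ‖c‖ = 1 ∧
      Tendsto (fun r : ℝ => I ((r : ℂ) • Torus.toComplex ζ)) (𝓝[<] 1) (𝓝 c)

/-- The square of the norm in the Hardy space `H²` of the polydisc. -/
def hardyNormSq {n : ℕ} (F : (Fin n → ℂ) → ℂ) : ℝ≥0∞ :=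
  ⨆ r ∈ Set.Ioo (0 : ℝ) 1, ∫⁻ ζ, ‖F ((r : ℂ) • Torus.toComplex ζ)‖ₑ ^ 2 ∂torusMeasure n

/-- Membership in the Hardy space `H²` of the polydisc. -/
def MemHardy {n : ℕ} (F : (Fin n → ℂ) → ℂ) : Prop :=
  DifferentiableOn ℂ F (polydisc n) ∧ hardyNormSq F < ∞

/-- `f` is the boundary function of `F`: the dilations `F_r` converge to `f` in `L²` of the
torus as `r` increases to one. -/
def HasBoundaryValue {n : ℕ} (F : (Fin n → ℂ) → ℂ) (f : Lp ℂ 2 (torusMeasure n)) : Prop :=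
  Tendsto
    (fun r : ℝ => eLpNorm (fun ζ : Torus n => F ((r : ℂ) • ζ.toComplex) - f ζ) 2 (torusMeasure n))
    (𝓝[<] 1) (𝓝 0)

lemma dilate_mem {n : ℕ} {r : ℝ} (hr : r ∈ Set.Ioo (0 : ℝ) 1) (ζ : Torus n) :
    (r : ℂ) • ζ.toComplex ∈ polydisc n := by
  intro j
  have h : ‖(ζ j : ℂ)‖ = 1 := Circle.norm_coe (ζ j)
  change ‖(r : ℂ) * (ζ j : ℂ)‖ < 1
  rw [norm_mul, h, mul_one, Complex.norm_real, Real.norm_of_nonneg hr.1.le]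
  exact hr.2

lemma continuous_dilate {n : ℕ} {F : (Fin n → ℂ) → ℂ} (hF : DifferentiableOn ℂ F (polydisc n))
    {r : ℝ} (hr : r ∈ Set.Ioo (0 : ℝ) 1) :
    Continuous fun ζ : Torus n => F ((r : ℂ) • ζ.toComplex) := by
  refine hF.continuousOn.comp_continuous ?_ (dilate_mem hr)
  unfold Torus.toComplex
  fun_prop

lemma MemHardy.zero {n : ℕ} : MemHardy (0 : (Fin n → ℂ) → ℂ) :=
  ⟨differentiableOn_const 0, by simp [hardyNormSq]⟩

lemma MemHardy.add {n : ℕ} {F G : (Fin n → ℂ) → ℂ} (hF : MemHardy F) (hG : MemHardy G) :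
    MemHardy (F + G) := by
  refine ⟨hF.1.add hG.1, ?_⟩
  have key : hardyNormSq (F + G) ≤ 2 * (hardyNormSq F + hardyNormSq G) := by
    refine iSup₂_le fun r hr => ?_
    calc ∫⁻ ζ, ‖(F + G) ((r : ℂ) • Torus.toComplex ζ)‖ₑ ^ 2 ∂torusMeasure n
        ≤ ∫⁻ ζ, 2 * (‖F ((r : ℂ) • Torus.toComplex ζ)‖ₑ ^ 2
            + ‖G ((r : ℂ) • Torus.toComplex ζ)‖ₑ ^ 2) ∂torusMeasure n := by
          refine lintegral_mono fun ζ => ?_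
          refine (pow_le_pow_left' (enorm_add_le _ _) 2).trans ?_
          have := ENNReal.rpow_add_le_mul_rpow_add_rpow
            ‖F ((r : ℂ) • Torus.toComplex ζ)‖ₑ ‖G ((r : ℂ) • Torus.toComplex ζ)‖ₑ
            (p := 2) (by norm_num)
          norm_num at this
          exact this
      _ = 2 * (∫⁻ ζ, ‖F ((r : ℂ) • Torus.toComplex ζ)‖ₑ ^ 2 ∂torusMeasure n
            + ∫⁻ ζ, ‖G ((r : ℂ) • Torus.toComplex ζ)‖ₑ ^ 2 ∂torusMeasure n) := by
          have hm : Measurable fun ζ : Torus n => ‖F ((r : ℂ) • ζ.toComplex)‖ₑ ^ 2 :=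
            ((continuous_dilate hF.1 hr).measurable.enorm).pow_const 2
          rw [lintegral_const_mul' _ _ (by norm_num), lintegral_add_left hm]
      _ ≤ _ := by
          gcongr
          · exact le_iSup₂ (f := fun (r : ℝ) (_ : r ∈ Set.Ioo (0 : ℝ) 1) =>
              ∫⁻ ζ, ‖F ((r : ℂ) • Torus.toComplex ζ)‖ₑ ^ 2 ∂torusMeasure n) r hr
          · exact le_iSup₂ (f := fun (r : ℝ) (_ : r ∈ Set.Ioo (0 : ℝ) 1) =>
              ∫⁻ ζ, ‖G ((r : ℂ) • Torus.toComplex ζ)‖ₑ ^ 2 ∂torusMeasure n) r hr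
  exact key.trans_lt (ENNReal.mul_lt_top (by norm_num) (ENNReal.add_lt_top.2 ⟨hF.2, hG.2⟩))

lemma MemHardy.smul {n : ℕ} {F : (Fin n → ℂ) → ℂ} (c : ℂ) (hF : MemHardy F) :
    MemHardy (c • F) := by
  refine ⟨hF.1.const_smul c, ?_⟩
  have key : hardyNormSq (c • F) ≤ ‖c‖ₑ ^ 2 * hardyNormSq F := by
    refine iSup₂_le fun r hr => ?_
    simp only [Pi.smul_apply, smul_eq_mul, enorm_mul, mul_pow]
    rw [lintegral_const_mul' _ _ (by simp)]
    gcongr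
    exact le_iSup₂ (f := fun (r : ℝ) (_ : r ∈ Set.Ioo (0 : ℝ) 1) =>
      ∫⁻ ζ, ‖F ((r : ℂ) • Torus.toComplex ζ)‖ₑ ^ 2 ∂torusMeasure n) r hr
  exact key.trans_lt (ENNReal.mul_lt_top (by simp) hF.2)

lemma HasBoundaryValue.zero {n : ℕ} :
    HasBoundaryValue (0 : (Fin n → ℂ) → ℂ) (0 : Lp ℂ 2 (torusMeasure n)) := by
  refine tendsto_const_nhds.congr fun r => ?_
  symm
  rw [eLpNorm_congr_ae (g := 0), eLpNorm_zero]
  filter_upwards [Lp.coeFn_zero ℂ 2 (torusMeasure n)] with ζ hζ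
  have h : ((0 : Lp ℂ 2 (torusMeasure n)) : Torus n → ℂ) ζ = 0 := hζ
  change (0 : ℂ) - _ = 0
  rw [h, sub_zero]

lemma eventually_Ioo : ∀ᶠ r in 𝓝[<] (1 : ℝ), r ∈ Set.Ioo (0 : ℝ) 1 :=
  Ioo_mem_nhdsLT one_pos

lemma HasBoundaryValue.add {n : ℕ} {F G : (Fin n → ℂ) → ℂ} {f g : Lp ℂ 2 (torusMeasure n)}
    (hF : DifferentiableOn ℂ F (polydisc n)) (hG : DifferentiableOn ℂ G (polydisc n))
    (hf : HasBoundaryValue F f) (hg : HasBoundaryValue G g) :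
    HasBoundaryValue (F + G) (f + g) := by
  have h := Tendsto.add hf hg
  rw [add_zero] at h
  refine tendsto_of_tendsto_of_tendsto_of_le_of_le' tendsto_const_nhds h
    (Eventually.of_forall fun _ => zero_le) ?_
  filter_upwards [eventually_Ioo] with r hr
  have hFm := (continuous_dilate hF hr).aestronglyMeasurable (μ := torusMeasure n)
  have hGm := (continuous_dilate hG hr).aestronglyMeasurable (μ := torusMeasure n)
  refine le_trans (le_of_eq (eLpNorm_congr_ae ?_))
    (eLpNorm_add_le (hFm.sub (Lp.aestronglyMeasurable f)) (hGm.sub (Lp.aestronglyMeasurable g))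
      one_le_two)
  filter_upwards [Lp.coeFn_add f g] with ζ hζ
  simp only [hζ, Pi.add_apply]
  ring

lemma HasBoundaryValue.smul {n : ℕ} {F : (Fin n → ℂ) → ℂ} {f : Lp ℂ 2 (torusMeasure n)} (c : ℂ)
    (hf : HasBoundaryValue F f) : HasBoundaryValue (c • F) (c • f) := by
  have h := ENNReal.Tendsto.const_mul (a := ‖c‖ₑ) hf (Or.inr (by simp))
  rw [mul_zero] at h
  refine h.congr fun r => ?_
  rw [← eLpNorm_const_smul]
  refine eLpNorm_congr_ae ?_
  filter_upwards [Lp.coeFn_smul c f] with ζ hζ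
  simp only [hζ, Pi.smul_apply, smul_eq_mul]
  ring

/-- The Hardy space `H²`, identified with the space of its boundary functions in `L²` of the
torus. -/
def hardySpace (n : ℕ) : Submodule ℂ (Lp ℂ 2 (torusMeasure n)) where
  carrier := {f | ∃ F, MemHardy F ∧ HasBoundaryValue F f}
  zero_mem' := ⟨0, MemHardy.zero, HasBoundaryValue.zero⟩
  add_mem' := by
    rintro f g ⟨F, hF, hf⟩ ⟨G, hG, hg⟩
    exact ⟨F + G, hF.add hG, HasBoundaryValue.add hF.1 hG.1 hf hg⟩
  smul_mem' := by
    rintro c f ⟨F, hF, hf⟩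
    exact ⟨c • F, hF.smul c, hf.smul c⟩

/-- The boundary functions of the products `I G` with `G` in `H²`. -/
def innerMultiples {n : ℕ} (I : (Fin n → ℂ) → ℂ) : Set (Lp ℂ 2 (torusMeasure n)) :=
  {g | ∃ G, MemHardy G ∧ HasBoundaryValue (I * G) g}

/-- The model space `H² ⊖ I H²`. -/
def modelSpace {n : ℕ} (I : (Fin n → ℂ) → ℂ) : Submodule ℂ (Lp ℂ 2 (torusMeasure n)) :=
  hardySpace n ⊓ (Submodule.span ℂ (innerMultiples I))ᗮ

/-- The reproducing kernel `K_w(z) = (1 - I(z) conj(I(w))) C(z, w)` of the model space. -/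
def modelKernel {n : ℕ} (I : (Fin n → ℂ) → ℂ) (w z : Fin n → ℂ) : ℂ :=
  (1 - I z * conj (I w)) * cauchyKernel z w

/-- `T` is the isometric operator from the model space to `L²(σ_α)` that maps every reproducing
kernel `K_w` to the function `ξ ↦ (1 - α conj(I(w))) C(ξ, w)`. -/
def IsClarkOperator {n : ℕ} (I : (Fin n → ℂ) → ℂ) (α : Circle)
    (T : modelSpace I →L[ℂ] Lp ℂ 2 (clarkMeasure I α)) : Prop :=
  (∀ f, ‖T f‖ = ‖f‖) ∧
    ∀ w ∈ polydisc n, ∃ k : modelSpace I,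
      HasBoundaryValue (modelKernel I w) (k : Lp ℂ 2 (torusMeasure n)) ∧
      T k =ᵐ[clarkMeasure I α]
        fun ξ => (1 - α * conj (I w)) * cauchyKernel (Torus.toComplex ξ) w

open Classical in
/-- The operator `T_α` (zero if there is none with the defining property). -/
def clarkOperator {n : ℕ} (I : (Fin n → ℂ) → ℂ) (α : Circle) :
    modelSpace I →L[ℂ] Lp ℂ 2 (clarkMeasure I α) :=
  if h : ∃ T, IsClarkOperator I α T then h.choose else 0

/-- A bounded operator between inner product spaces is unitary if it is a surjective linear
isometry. -/
def IsUnitaryOperator {E F : Type*} [NormedAddCommGroup E] [InnerProductSpace ℂ E]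
    [NormedAddCommGroup F] [InnerProductSpace ℂ F] (T : E →L[ℂ] F) : Prop :=
  ∃ U : E ≃ₗᵢ[ℂ] F, ∀ x, U x = T x

/-- The function `I` is inner, and each of its Clark measures `σ_α` and operators `T_α` exists
and is unique. -/
def HasClarkTheory {n : ℕ} (I : (Fin n → ℂ) → ℂ) : Prop :=
  IsInner I ∧ ∀ α : Circle, (∃! σ, IsClarkMeasure I α σ) ∧ (∃! T, IsClarkOperator I α T)

/-- `I(z) = z₁`. -/
def coordinateInner (n : ℕ) (hn : 2 ≤ n) (z : Fin n → ℂ) : ℂ := z ⟨0, by omega⟩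

/-- `I(z) = z₁ z₂`. -/
def productInner (z : Fin 2 → ℂ) : ℂ := z 0 * z 1

/-- `I(z) = (z₁ + z₂ + 2 z₁ z₂) / (z₁ + z₂ + 2)`. -/
def rationalInner (z : Fin 2 → ℂ) : ℂ := (z 0 + z 1 + 2 * z 0 * z 1) / (z 0 + z 1 + 2)

/-- `b_α(ξ) = (1 + 2ξ - α) / ((α - 1)ξ + 2α)`. -/
def blaschkeFactor (α ξ : ℂ) : ℂ := (1 + 2 * ξ - α) / ((α - 1) * ξ + 2 * α)

end ClarkTorus

end

noncomputable section

namespace ClarkTorus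

/-! ### The circle and the Cauchy formula -/

/-! All three examples reduce to one polarized identity (`IsPolarizedClarkMeasure`): (1 - α conj
I(w)) (1 - conj α I(z)) ∫ C(z,ξ) C(ξ,w) dσ = K_w(z). On the diagonal z = w, after division by
C(z,z), it is the defining identity of the Clark measure. Off the diagonal it says that the kernels
K_w and their prescribed images in L²(σ) have the same Gram matrix.

A Clark measure is unique because a Poisson integral determines all Fourier coefficients
(`integral_torusMonomial_eq`). For T_α, the kernels lie in the model space and reproduce it
(`exists_modelKernel_mem`, `inner_modelKernel_of_mem`), hence are total there; equality of Gram
matrices then gives a unique isometric extension (`exists_isometry_of_inner_eq`). The model space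
must be complete for this, so H² is shown to be closed in L² (`isClosed_hardySpace`).

The range of an isometry on a complete space is closed, so T_α is onto exactly when the Cauchy
kernels C(·,w) are total in L²(σ_α). For z₁ the function ξ₂, and for the exceptional rational case
the function ξ₁ξ₂, integrates to zero against every C(·,w); its conjugate is a nonzero element
orthogonal to the range. In the remaining cases σ lives on a graph on which the conjugate of each
coordinate is a holomorphic function of the other one. Every trigonometric monomial then agrees
σ-a.e. with a function holomorphic past the closed bidisc, and such functions lie in the closed span
of the Cauchy kernels (`total_of_conj_eq`).

On the bidisc, partial fractions reduce the polarized identity to the Cauchy transform ∫ C(z,ξ) dσ =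
1/(1 - conj α I(z)) and to the vanishing of the moments of mixed sign
(`isPolarizedClarkMeasure_of_bidisc`). Both are one-variable applications of the Cauchy formula. For
the rational function, the equation I = α reads ζ₂ = 1/b_α(ζ₁). With c = (1 - α)/2, b_α is conj α
times a disc automorphism as long as |c| < 1, that is α ≠ -1. At α = -1 the equation becomes (1 +
ζ₁)(1 + ζ₂) = 0, and the graph degenerates into two lines. -/

lemma measurable_toCircle : Measurable (AddCircle.toCircle (T := 2 * Real.pi)) :=
  AddCircle.continuous_toCircle.measurable

instance instIsProbabilityMeasureCircle : IsProbabilityMeasure circleMeasure :=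
  Measure.isProbabilityMeasure_map measurable_toCircle.aemeasurable

instance instIsProbabilityMeasureTorus (n : ℕ) : IsProbabilityMeasure (torusMeasure n) := by
  unfold torusMeasure; infer_instance

/-- This passes from Haar measure to an average over the parametrized circle, which is a contour
integral. -/
lemma integral_circleMeasure (g : ℂ → ℂ) (hg : Continuous fun ζ : Circle => g ζ) :
    ∫ ζ : Circle, g ζ ∂circleMeasure = Real.circleAverage g 0 1 := by
  have hpi : (-Real.pi) + 2 * Real.pi = Real.pi := by ring
  rw [circleMeasure, integral_map measurable_toCircle.aemeasurable
    hg.aestronglyMeasurable, AddCircle.integral_haarAddCircle, Real.circleAverage_def,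
    ← AddCircle.intervalIntegral_preimage (2 * Real.pi) 0, zero_add]
  congr 1
  refine intervalIntegral.integral_congr fun t _ => ?_
  simp [AddCircle.toCircle_apply_mk, circleMap, Circle.coe_exp]

lemma star_eq_inv (ζ : Circle) : conj (ζ : ℂ) = (ζ : ℂ)⁻¹ := by
  rw [← Circle.coe_inv_eq_conj, Circle.coe_inv]

lemma one_sub_ne_zero {z w : ℂ} (hz : ‖z‖ < 1) (hw : ‖w‖ ≤ 1) : 1 - z * w ≠ 0 := by
  intro h
  have h1 : z * w = 1 := (sub_eq_zero.1 h).symm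
  have h2 : ‖z * w‖ < 1 := by
    rw [norm_mul]; nlinarith [norm_nonneg z, norm_nonneg w]
  rw [h1] at h2; simp at h2

lemma one_sub_mul_conj_ne_zero {z w : ℂ} (hz : ‖z‖ < 1) (hw : ‖w‖ ≤ 1) :
    1 - z * conj w ≠ 0 := one_sub_ne_zero hz (by simpa using hw)

lemma one_sub_mul_conj_ne_zero' {z w : ℂ} (hz : ‖z‖ ≤ 1) (hw : ‖w‖ < 1) :
    1 - z * conj w ≠ 0 := by
  rw [mul_comm]; exact one_sub_ne_zero (by simpa using hw) hz

lemma continuous_circle_coe : Continuous fun ζ : Circle => (ζ : ℂ) := by fun_prop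

lemma norm_circle_le (ζ : Circle) : ‖(ζ : ℂ)‖ ≤ 1 := (Circle.norm_coe ζ).le

/-- The Cauchy formula on the unit circle. -/
lemma integral_cauchy_circle {F : ℂ → ℂ} (hF : DiffContOnCl ℂ F (Metric.ball 0 1)) {z : ℂ}
    (hz : ‖z‖ < 1) :
    ∫ ζ : Circle, F ζ * (1 / (1 - z * conj (ζ : ℂ))) ∂circleMeasure = F z := by
  have hFc : Continuous fun ζ : Circle => F ζ := by
    refine hF.continuousOn.comp_continuous continuous_circle_coe fun ζ => ?_
    rw [closure_ball _ one_ne_zero, mem_closedBall_zero_iff]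
    exact norm_circle_le ζ
  rw [integral_circleMeasure (fun ζ => F ζ * (1 / (1 - z * conj ζ)))]
  · rw [Real.circleAverage_eq_circleIntegral one_ne_zero,
      ← hF.two_pi_i_inv_smul_circleIntegral_sub_inv_smul (w := z) (by simpa using hz)]
    congr 1
    refine circleIntegral.integral_congr zero_le_one fun ζ hζ => ?_
    have h1 : ‖ζ‖ = 1 := by simpa using hζ
    have h0 : ζ ≠ 0 := by rintro rfl; simp at h1
    have hc : conj ζ = ζ⁻¹ := by
      rw [Complex.inv_def, Complex.normSq_eq_norm_sq, h1]; simp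
    have h2 : ζ - z ≠ 0 := by
      intro h; rw [sub_eq_zero] at h; rw [h] at h1; exact hz.ne h1
    simp only [smul_eq_mul, sub_zero, hc]
    -- The kernel equals ζ / (ζ - z), and its factor ζ cancels the one in the averaging measure dζ /
    -- (2πiζ).
    have h3 : 1 - z * ζ⁻¹ = (ζ - z) / ζ := by field_simp
    rw [h3]; field_simp
  · refine hFc.mul (continuous_const.div ?_ fun ζ => one_sub_mul_conj_ne_zero hz (norm_circle_le ζ))
    exact continuous_const.sub (continuous_const.mul (Complex.continuous_conj.comp
      continuous_circle_coe))

/-- The mean value formula on the unit circle. -/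
lemma integral_circle_eq {F : ℂ → ℂ} (hF : DiffContOnCl ℂ F (Metric.ball 0 1)) :
    ∫ ζ : Circle, F ζ ∂circleMeasure = F 0 := by
  simpa using integral_cauchy_circle hF (z := 0) (by simp)

/-! ### Kernels -/

/-- The open polydisc of radius `R`. -/
def polydiscOfRadius (n : ℕ) (R : ℝ) : Set (Fin n → ℂ) := {z | ∀ j, ‖z j‖ < R}

lemma isOpen_polydiscOfRadius (n : ℕ) (R : ℝ) : IsOpen (polydiscOfRadius n R) := by
  have : polydiscOfRadius n R = ⋂ j, {z : Fin n → ℂ | ‖z j‖ < R} := by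
    ext z; simp [polydiscOfRadius]
  rw [this]
  exact isOpen_iInter_of_finite fun j => isOpen_lt (by fun_prop) continuous_const

lemma isOpen_polydisc (n : ℕ) : IsOpen (polydisc n) := isOpen_polydiscOfRadius n 1

lemma continuous_toComplex {n : ℕ} : Continuous (Torus.toComplex (n := n)) := by
  unfold Torus.toComplex; fun_prop

lemma norm_toComplex {n : ℕ} (ζ : Torus n) (j : Fin n) : ‖ζ.toComplex j‖ = 1 :=
  Circle.norm_coe (ζ j)

lemma toComplex_mem {n : ℕ} {R : ℝ} (hR : 1 < R) (ζ : Torus n) :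
    ζ.toComplex ∈ polydiscOfRadius n R := fun j => by rw [norm_toComplex]; exact hR

lemma conj_cauchyKernel {n : ℕ} (z w : Fin n → ℂ) :
    conj (cauchyKernel z w) = cauchyKernel w z := by
  simp [cauchyKernel, map_prod, mul_comm]

lemma cauchyKernel_ne_zero {n : ℕ} {z w : Fin n → ℂ} (h : ∀ j, 1 - z j * conj (w j) ≠ 0) :
    cauchyKernel z w ≠ 0 :=
  Finset.prod_ne_zero_iff.2 fun j _ => one_div_ne_zero (h j)

lemma cauchyKernel_smul {n : ℕ} (r : ℝ) (z w : Fin n → ℂ) :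
    cauchyKernel ((r : ℂ) • z) w = cauchyKernel z ((r : ℂ) • w) := by
  simp only [cauchyKernel, Pi.smul_apply, smul_eq_mul, map_mul, Complex.conj_ofReal]
  refine Finset.prod_congr rfl fun j _ => ?_
  ring

lemma differentiableOn_prod {ι E A : Type*} [Fintype ι] [NormedAddCommGroup E] [NormedSpace ℂ E]
    [NormedCommRing A] [NormedAlgebra ℂ A] {f : ι → E → A} {s : Set E}
    (hf : ∀ i, DifferentiableOn ℂ (f i) s) : DifferentiableOn ℂ (fun x => ∏ i, f i x) s := by
  classical
  exact fun x hx => (HasFDerivWithinAt.finsetProd fun i _ =>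
    (hf i x hx).hasFDerivWithinAt).differentiableWithinAt

lemma differentiableOn_cauchyKernel {n : ℕ} {R : ℝ} (w : Fin n → ℂ)
    (hw : ∀ j, ‖w j‖ * R < 1) :
    DifferentiableOn ℂ (fun z => cauchyKernel z w) (polydiscOfRadius n R) := by
  unfold cauchyKernel
  refine differentiableOn_prod (f := fun j (z : Fin n → ℂ) => 1 / (1 - z j * conj (w j)))
    fun j => ?_
  change DifferentiableOn ℂ (fun z : Fin n → ℂ => 1 / (1 - z j * conj (w j))) _
  simp only [one_div]
  refine DifferentiableOn.fun_inv (by fun_prop) fun z hz => ?_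
  intro h
  have h1 : z j * conj (w j) = 1 := (sub_eq_zero.1 h).symm
  have h2 : ‖z j‖ * ‖w j‖ = 1 := by
    have := congrArg norm h1; simpa using this
  have := hz j
  nlinarith [hw j, norm_nonneg (w j), norm_nonneg (z j)]

lemma differentiableOn_cauchyKernel_polydisc {n : ℕ} {w : Fin n → ℂ} (hw : w ∈ polydisc n) :
    DifferentiableOn ℂ (fun z => cauchyKernel z w) (polydisc n) :=
  differentiableOn_cauchyKernel w (R := 1) fun j => by simpa using hw j

lemma continuous_cauchyKernel_left {n : ℕ} {w : Fin n → ℂ} (hw : w ∈ polydisc n) :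
    Continuous fun ζ : Torus n => cauchyKernel ζ.toComplex w := by
  unfold cauchyKernel Torus.toComplex
  refine continuous_finsetProd _ fun j _ => Continuous.div (by fun_prop) (by fun_prop) fun ζ => ?_
  exact one_sub_mul_conj_ne_zero' (norm_circle_le _) (hw j)

lemma continuous_cauchyKernel_right {n : ℕ} {w : Fin n → ℂ} (hw : w ∈ polydisc n) :
    Continuous fun ζ : Torus n => cauchyKernel w ζ.toComplex := by
  simp_rw [← fun ζ : Torus n => conj_cauchyKernel ζ.toComplex w]
  exact Complex.continuous_conj.comp (continuous_cauchyKernel_left hw)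

lemma polydisc_exists_radius {n : ℕ} {w : Fin n → ℂ} (hw : w ∈ polydisc n) :
    ∃ R : ℝ, 1 < R ∧ ∀ j, ‖w j‖ * R < 1 := by
  have : ∀ᶠ R in 𝓝 (1 : ℝ), ∀ j, ‖w j‖ * R < 1 := by
    rw [eventually_all]
    intro j
    have : Tendsto (fun R : ℝ => ‖w j‖ * R) (𝓝 1) (𝓝 (‖w j‖ * 1)) := by
      exact (continuous_const.mul continuous_id).tendsto 1
    exact this.eventually_lt_const (by simpa using hw j)
  obtain ⟨R, h1, h2⟩ := ((this.filter_mono nhdsWithin_le_nhds).and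
    (self_mem_nhdsWithin (s := Set.Ioi (1 : ℝ)))).exists
  exact ⟨R, h2, h1⟩

/-- Continuous functions on the torus are integrable for finite measures. -/
lemma integrable_of_continuous {X E : Type*} [TopologicalSpace X] [CompactSpace X]
    [MeasurableSpace X] [OpensMeasurableSpace X] [NormedAddCommGroup E]
    [SecondCountableTopologyEither X E] {μ : Measure X}
    [IsFiniteMeasure μ] {f : X → E} (hf : Continuous f) : Integrable f μ := by
  obtain ⟨C, hC⟩ := (isCompact_range hf).isBounded.exists_norm_le
  exact Integrable.of_bound hf.aestronglyMeasurable C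
    (Eventually.of_forall fun x => hC _ (Set.mem_range_self x))

/-- The Cauchy formula on the torus. -/
lemma integral_cauchy {n : ℕ} {R : ℝ} (hR : 1 < R) {F : (Fin n → ℂ) → ℂ}
    (hF : DifferentiableOn ℂ F (polydiscOfRadius n R)) {z : Fin n → ℂ} (hz : z ∈ polydisc n) :
    ∫ ζ, F ζ.toComplex * cauchyKernel z ζ.toComplex ∂torusMeasure n = F z := by
  induction n with
  | zero =>
    have : ∀ ζ : Torus 0, F ζ.toComplex * cauchyKernel z ζ.toComplex = F z := by
      intro ζ
      simp only [cauchyKernel, Finset.univ_eq_empty, Finset.prod_empty, mul_one]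
      congr 1; exact Subsingleton.elim _ _
    simp [this]
  | succ n ih =>
    have hcont : Continuous fun ζ : Torus (n + 1) =>
        F ζ.toComplex * cauchyKernel z ζ.toComplex :=
      (hF.continuousOn.comp_continuous continuous_toComplex (toComplex_mem hR)).mul
        (continuous_cauchyKernel_right hz)
    have hcons : Continuous fun p : Circle × Torus n => (Fin.cons p.1 p.2 : Torus (n + 1)) :=
      Continuous.finCons continuous_fst continuous_snd
    have hmp := (measurePreserving_piFinSuccAbove
      (fun _ : Fin (n + 1) => circleMeasure) 0).symm
    have hcoe : ∀ (a : Circle) (v : Torus n),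
        Torus.toComplex (Fin.cons a v : Torus (n + 1)) = Fin.cons (a : ℂ) v.toComplex := by
      intro a v; funext j
      refine Fin.cases ?_ (fun i => ?_) j <;> simp [Torus.toComplex]
    have hker : ∀ (a : ℂ) (v : Fin n → ℂ), cauchyKernel z (Fin.cons a v) =
        1 / (1 - z 0 * conj a) * cauchyKernel (fun j => z j.succ) v := by
      intro a v; simp [cauchyKernel, Fin.prod_univ_succ, mul_comm]
    have hmem : ∀ (a : ℂ) (_ : ‖a‖ < R), ∀ v ∈ polydiscOfRadius n R,
        (Fin.cons a v : Fin (n + 1) → ℂ) ∈ polydiscOfRadius (n + 1) R := by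
      intro a ha v hv j
      refine Fin.cases ?_ (fun i => ?_) j
      · simpa using ha
      · simpa using hv i
    have hz' : (fun j : Fin n => z j.succ) ∈ polydisc n := fun j => hz _
    -- The first coordinate is split off: Fubini leaves the induction hypothesis in the last n
    -- variables and the one-variable formula in the first.
    calc ∫ ζ, F ζ.toComplex * cauchyKernel z ζ.toComplex ∂torusMeasure (n + 1)
        = ∫ p : Circle × Torus n, F (Fin.cons (p.1 : ℂ) p.2.toComplex) *
            cauchyKernel z (Fin.cons (p.1 : ℂ) p.2.toComplex)
            ∂(circleMeasure.prod (torusMeasure n)) := by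
          rw [torusMeasure, ← hmp.integral_comp']
          refine integral_congr_ae (Eventually.of_forall fun p => ?_)
          have : (MeasurableEquiv.piFinSuccAbove (fun _ : Fin (n + 1) => Circle) 0).symm p
              = Fin.cons p.1 p.2 := by
            simp [MeasurableEquiv.piFinSuccAbove_symm_apply, Fin.insertNthEquiv]
          simp only [this, hcoe]
      _ = ∫ a : Circle, F (Fin.cons (a : ℂ) fun j => z j.succ) *
            (1 / (1 - z 0 * conj (a : ℂ))) ∂circleMeasure := by
          rw [integral_prod]
          · refine integral_congr_ae (Eventually.of_forall fun a => ?_)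
            have hd : DifferentiableOn ℂ (fun v => F (Fin.cons (a : ℂ) v))
                (polydiscOfRadius n R) := by
              refine hF.comp (g := F) ?_ fun v hv => hmem a ((norm_circle_le a).trans_lt hR) v hv
              exact (differentiable_pi.2 fun j => by
                refine Fin.cases ?_ (fun i => ?_) j <;> (simp; try fun_prop)).differentiableOn
            have h1 := ih hd hz'
            dsimp only at h1 ⊢
            rw [← h1, ← integral_mul_const]
            refine integral_congr_ae (Eventually.of_forall fun v => ?_)
            simp only [hker]; ring
          · refine integrable_of_continuous ?_
            have := hcont.comp hcons
            simpa only [Function.comp_def, hcoe] using this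
      _ = F z := by
          have hd : DifferentiableOn ℂ (fun a : ℂ => F (Fin.cons a fun j => z j.succ))
              (Metric.ball 0 R) := by
            refine hF.comp (g := F) ?_ fun a ha => hmem a (by simpa using ha) _
              fun j => (hz' j).trans hR
            exact (differentiable_pi.2 fun j => by
              refine Fin.cases ?_ (fun i => ?_) j <;> simp).differentiableOn
          rw [integral_cauchy_circle (F := fun a : ℂ => F (Fin.cons a fun j => z j.succ))
            (hd.diffContOnCl_ball (Metric.closedBall_subset_ball hR)) (hz 0)]
          congr 1
          exact Fin.cons_self_tail z

/-! ### Trigonometric monomials -/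

/-- The trigonometric monomial `ζ ↦ ∏ⱼ ζⱼ ^ kⱼ`. -/
def torusMonomial {n : ℕ} (k : Fin n → ℤ) : C(Torus n, ℂ) where
  toFun ζ := ∏ j, (ζ j : ℂ) ^ k j
  continuous_toFun := by
    have : ∀ (ζ : Torus n) j, (ζ j : ℂ) ^ k j = ((ζ j ^ k j : Circle) : ℂ) := fun ζ j =>
      (Circle.coe_zpow _ _).symm
    simp_rw [this]
    exact continuous_finsetProd _ fun j _ =>
      continuous_circle_coe.comp ((continuous_apply j).zpow _)

lemma torusMonomial_apply {n : ℕ} (k : Fin n → ℤ) (ζ : Torus n) :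
    torusMonomial k ζ = ∏ j, (ζ j : ℂ) ^ k j := rfl

/-- The star subalgebra spanned by the trigonometric monomials. -/
def torusMonomialSubalgebra (n : ℕ) : StarSubalgebra ℂ C(Torus n, ℂ) where
  toSubalgebra := Algebra.adjoin ℂ (Set.range torusMonomial)
  star_mem' := by
    change Algebra.adjoin ℂ (Set.range torusMonomial) ≤
      star (Algebra.adjoin ℂ (Set.range torusMonomial))
    refine Algebra.adjoin_le ?_
    rintro _ ⟨k, rfl⟩
    refine Algebra.subset_adjoin ⟨-k, ?_⟩
    ext ζ
    simp [torusMonomial_apply, star_eq_inv]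

lemma torusMonomialSubalgebra_coe (n : ℕ) :
    Subalgebra.toSubmodule (torusMonomialSubalgebra n).toSubalgebra =
      Submodule.span ℂ (Set.range torusMonomial) := by
  apply Algebra.adjoin_eq_span_of_subset
  refine .trans (fun x => Submonoid.closure_induction (fun _ => id) ⟨0, ?_⟩ ?_)
    Submodule.subset_span
  · ext ζ; simp [torusMonomial_apply]
  · rintro _ _ _ _ ⟨k, rfl⟩ ⟨l, rfl⟩
    refine ⟨k + l, ?_⟩
    ext ζ
    simp [torusMonomial_apply, ← Finset.prod_mul_distrib, zpow_add₀]

lemma torusMonomialSubalgebra_separatesPoints (n : ℕ) :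
    (torusMonomialSubalgebra n).SeparatesPoints := by
  intro x y hxy
  obtain ⟨i, hi⟩ := Function.ne_iff.1 hxy
  refine ⟨_, ⟨torusMonomial (Pi.single i 1), Algebra.subset_adjoin ⟨_, rfl⟩, rfl⟩, ?_⟩
  have h : ∀ ζ : Torus n, torusMonomial (Pi.single i 1) ζ = (ζ i : ℂ) := by
    intro ζ
    rw [torusMonomial_apply, Finset.prod_eq_single i (fun j _ hj => by simp [hj]) (by simp)]
    simp
  simp only [h]
  exact fun h' => hi (Circle.ext h')

/-- A closed subspace of the continuous functions that contains the trigonometric monomials is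
the whole space. -/
lemma mem_of_torusMonomial_mem {n : ℕ} (S : Submodule ℂ C(Torus n, ℂ))
    (hS : IsClosed (S : Set C(Torus n, ℂ))) (h : ∀ k, torusMonomial k ∈ S) (g : C(Torus n, ℂ)) :
    g ∈ S := by
  have h1 := ContinuousMap.starSubalgebra_topologicalClosure_eq_top_of_separatesPoints _
    (torusMonomialSubalgebra_separatesPoints n)
  have h2 : g ∈ (torusMonomialSubalgebra n).topologicalClosure := by rw [h1]; trivial
  have h3 : (torusMonomialSubalgebra n : Set C(Torus n, ℂ)) ⊆ S := by
    intro x hx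
    have : x ∈ Subalgebra.toSubmodule (torusMonomialSubalgebra n).toSubalgebra := hx
    rw [torusMonomialSubalgebra_coe] at this
    exact (Submodule.span_le.2 (by rintro _ ⟨k, rfl⟩; exact h k)) this
  exact closure_minimal h3 hS h2

/-- Integration against an integrable function, as a functional on the continuous functions. -/
def integralMul {X : Type*} [TopologicalSpace X] [CompactSpace X] [SecondCountableTopology X]
    [MeasurableSpace X] [OpensMeasurableSpace X] {μ : Measure X} {φ : X → ℂ}
    (hφ : Integrable φ μ) : C(X, ℂ) →L[ℂ] ℂ :=
  have hi (g : C(X, ℂ)) : Integrable (fun x => g x * φ x) μ :=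
    hφ.bdd_mul g.continuous.aestronglyMeasurable (Eventually.of_forall fun x => g.norm_coe_le_norm x)
  LinearMap.mkContinuous
    { toFun := fun g => ∫ x, g x * φ x ∂μ
      map_add' := fun g h => by
        rw [← integral_add (hi g) (hi h)]
        simp [add_mul]
      map_smul' := fun c g => by
        rw [RingHom.id_apply, smul_eq_mul, ← integral_const_mul]
        simp [mul_assoc] }
    (∫ x, ‖φ x‖ ∂μ) fun g => by
      refine (norm_integral_le_integral_norm _).trans ?_
      rw [mul_comm, ← integral_const_mul]
      refine integral_mono (hi g).norm (hφ.norm.const_mul _) fun x => ?_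
      simp only [norm_mul]
      gcongr
      exact g.norm_coe_le_norm x

lemma integralMul_apply {X : Type*} [TopologicalSpace X] [CompactSpace X]
    [SecondCountableTopology X] [MeasurableSpace X] [OpensMeasurableSpace X] {μ : Measure X}
    {φ : X → ℂ} (hφ : Integrable φ μ) (g : C(X, ℂ)) :
    integralMul hφ g = ∫ x, g x * φ x ∂μ := rfl

/-- Finite measures on the torus with the same Fourier coefficients are equal. -/
lemma measure_eq_of_integral_torusMonomial {n : ℕ} {σ τ : Measure (Torus n)}
    [IsFiniteMeasure σ] [IsFiniteMeasure τ]
    (h : ∀ k, ∫ ζ, torusMonomial k ζ ∂σ = ∫ ζ, torusMonomial k ζ ∂τ) : σ = τ := by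
  have key : ∀ g : C(Torus n, ℂ), ∫ ζ, g ζ ∂σ = ∫ ζ, g ζ ∂τ := by
    intro g
    let A := integralMul (μ := σ) (integrable_const (1 : ℂ))
    let B := integralMul (μ := τ) (integrable_const (1 : ℂ))
    have := mem_of_torusMonomial_mem (LinearMap.ker (A - B).toLinearMap)
      (A - B).isClosed_ker (fun k => by
        simpa [A, B, integralMul_apply, sub_eq_zero] using h k) g
    simpa [A, B, integralMul_apply, sub_eq_zero] using this
  refine ext_of_forall_integral_eq_of_IsFiniteMeasure fun f => ?_
  have := key ⟨fun ζ => (f ζ : ℂ), by fun_prop⟩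
  simp only [ContinuousMap.coe_mk, integral_complex_ofReal] at this
  exact_mod_cast this

/-- A square integrable function whose Fourier coefficients vanish is zero. -/
lemma lp_eq_zero_of_integral_torusMonomial {n : ℕ} {σ : Measure (Torus n)} [IsFiniteMeasure σ]
    (f : Lp ℂ 2 σ) (h : ∀ k, ∫ ζ, torusMonomial k ζ * conj (f ζ) ∂σ = 0) : f = 0 := by
  have hf : Integrable (fun ζ => conj (f ζ)) σ :=
    Complex.conjCLE.toContinuousLinearMap.integrable_comp
      ((Lp.memLp f).integrable one_le_two)
  have key : ∀ g : C(Torus n, ℂ), ∫ ζ, g ζ * conj (f ζ) ∂σ = 0 := fun g =>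
    mem_of_torusMonomial_mem (LinearMap.ker (integralMul hf).toLinearMap)
      (integralMul hf).isClosed_ker (fun k => h k) g
  -- Orthogonality to the monomials extends to all continuous functions, which are dense in L².
  have hd := ContinuousMap.toLp_denseRange ℂ σ ℂ (p := 2) (by norm_num)
  refine hd.eq_zero_of_inner_left ℂ fun g => ?_
  rw [L2.inner_def, ← key g]
  refine integral_congr_ae ?_
  filter_upwards [ContinuousMap.coeFn_toLp (p := 2) (𝕜 := ℂ) σ g] with ζ hζ
  rw [hζ]; simp

/-! ### Poisson kernels and uniqueness of Clark measures -/

lemma poissonKernel_eq_prod {n : ℕ} (z : Fin n → ℂ) (ζ : Torus n) :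
    poissonKernel z ζ = ∏ j, 1 / (1 - z j * conj (ζ j : ℂ)) * (1 / (1 - ζ j * conj (z j))) *
      (1 - z j * conj (z j)) := by
  simp [poissonKernel, cauchyKernel, Torus.toComplex, Finset.prod_mul_distrib]

/-- Each factor depends only on r and on ζⱼ conj ηⱼ, symmetrically under conjugation, because both
points are unimodular. The symmetry is what makes Fubini useful for Poisson integrals. -/
lemma poissonKernel_dilate_comm {n : ℕ} (r : ℝ) (ζ η : Torus n) :
    poissonKernel ((r : ℂ) • ζ.toComplex) η = poissonKernel ((r : ℂ) • η.toComplex) ζ := by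
  have hc (ζ : Circle) : (ζ : ℂ) * conj (ζ : ℂ) = 1 := by
    rw [star_eq_inv, mul_inv_cancel₀ (Circle.coe_ne_zero ζ)]
  simp only [poissonKernel_eq_prod, Pi.smul_apply, smul_eq_mul, Torus.toComplex, map_mul,
    Complex.conj_ofReal]
  refine Finset.prod_congr rfl fun j _ => ?_
  have h1 : (r : ℂ) * ζ j * (r * conj (ζ j : ℂ)) = r * r := by linear_combination r * r * hc (ζ j)
  have h2 : (r : ℂ) * η j * (r * conj (η j : ℂ)) = r * r := by linear_combination r * r * hc (η j)
  rw [h1, h2]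
  have h3 : (r : ℂ) * ζ j * conj (η j : ℂ) = ζ j * (r * conj (η j : ℂ)) := by ring
  have h4 : (r : ℂ) * η j * conj (ζ j : ℂ) = η j * (r * conj (ζ j : ℂ)) := by ring
  rw [h3, h4]; ring

lemma continuous_poissonKernel {n : ℕ} {z : Fin n → ℂ} (hz : z ∈ polydisc n) :
    Continuous fun ζ : Torus n => poissonKernel z ζ :=
  ((continuous_cauchyKernel_right hz).mul (continuous_cauchyKernel_left hz)).div_const _

lemma differentiable_pow_div {z : ℂ} (hz : ‖z‖ < 1) (k : ℕ) :
    DiffContOnCl ℂ (fun η : ℂ => η ^ k * (1 / (1 - η * conj z))) (Metric.ball 0 1) := by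
  have h : ∀ η ∈ closure (Metric.ball (0 : ℂ) 1), 1 - η * conj z ≠ 0 := by
    intro η hη
    rw [closure_ball _ one_ne_zero, mem_closedBall_zero_iff] at hη
    exact one_sub_mul_conj_ne_zero' hη hz
  refine DifferentiableOn.diffContOnCl fun η hη => DifferentiableAt.differentiableWithinAt ?_
  have := h η hη
  fun_prop (disch := assumption)

/-- The Cauchy formula for η ^ k / (1 - η conj z) produces z ^ k / (1 - |z|²), and the remaining
factor of the Poisson kernel cancels the denominator. -/
lemma integral_poisson_circle_pow {z : ℂ} (hz : ‖z‖ < 1) (k : ℕ) :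
    ∫ η : Circle, 1 / (1 - z * conj (η : ℂ)) * (1 / (1 - η * conj z)) * (1 - z * conj z) *
      (η : ℂ) ^ k ∂circleMeasure = z ^ k := by
  have h := integral_cauchy_circle (differentiable_pow_div hz k) hz
  have h0 := one_sub_mul_conj_ne_zero hz hz.le
  calc _ = (∫ η : Circle, (η : ℂ) ^ k * (1 / (1 - η * conj z)) * (1 / (1 - z * conj (η : ℂ)))
        ∂circleMeasure) * (1 - z * conj z) := by
        rw [← integral_mul_const]; congr 1; funext η; ring
    _ = _ := by rw [h]; field_simp

/-- Negative exponents follow from positive ones by conjugation, since the Poisson kernel is real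
and conj η = η⁻¹ on the circle. -/
lemma integral_poisson_circle_zpow {r : ℝ} (hr : r ∈ Set.Ioo (0 : ℝ) 1) (ζ : Circle) (k : ℤ) :
    ∫ η : Circle, 1 / (1 - (r : ℂ) * ζ * conj (η : ℂ)) * (1 / (1 - η * conj ((r : ℂ) * ζ))) *
      (1 - (r : ℂ) * ζ * conj ((r : ℂ) * ζ)) * (η : ℂ) ^ k ∂circleMeasure
      = (r : ℂ) ^ k.natAbs * (ζ : ℂ) ^ k := by
  have hz : ‖(r : ℂ) * ζ‖ < 1 := by
    rw [norm_mul, Circle.norm_coe, mul_one, Complex.norm_real, Real.norm_of_nonneg hr.1.le]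
    exact hr.2
  obtain ⟨k, rfl | rfl⟩ := k.eq_nat_or_neg
  · simpa [mul_pow] using integral_poisson_circle_pow hz k
  · have h := congrArg conj (integral_poisson_circle_pow hz k)
    rw [← integral_conj] at h
    simp only [map_pow, map_mul, map_div₀, map_sub, map_one, Complex.conj_conj,
      Complex.conj_ofReal] at h
    simp only [star_eq_inv, mul_pow, map_mul, Complex.conj_ofReal] at h ⊢
    simp only [zpow_neg, zpow_natCast, Int.natAbs_neg, Int.natAbs_natCast, ← inv_pow]
    rw [← h]
    congr 1; funext η; ring

lemma integral_poissonKernel_torusMonomial {n : ℕ} {r : ℝ} (hr : r ∈ Set.Ioo (0 : ℝ) 1)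
    (ζ : Torus n) (k : Fin n → ℤ) :
    ∫ η, poissonKernel ((r : ℂ) • ζ.toComplex) η * torusMonomial k η ∂torusMeasure n =
      (∏ j, (r : ℂ) ^ (k j).natAbs) * torusMonomial k ζ := by
  simp only [poissonKernel_eq_prod, torusMonomial_apply, ← Finset.prod_mul_distrib, torusMeasure]
  rw [integral_fintype_prod_eq_prod (fun j (η : Circle) =>
    1 / (1 - ((r : ℂ) • ζ.toComplex) j * conj (η : ℂ)) *
      (1 / (1 - η * conj (((r : ℂ) • ζ.toComplex) j))) *
      (1 - ((r : ℂ) • ζ.toComplex) j * conj (((r : ℂ) • ζ.toComplex) j)) * (η : ℂ) ^ k j)]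
  exact Finset.prod_congr rfl fun j _ => integral_poisson_circle_zpow hr (ζ j) (k j)

lemma continuous_poissonKernel_dilate {n : ℕ} {r : ℝ} (hr : r ∈ Set.Ioo (0 : ℝ) 1) :
    Continuous fun p : Torus n × Torus n => poissonKernel ((r : ℂ) • p.1.toComplex) p.2 := by
  have hz : ∀ (ζ : Torus n) j, ‖((r : ℂ) • ζ.toComplex) j‖ < 1 := fun ζ => dilate_mem hr ζ
  simp only [poissonKernel_eq_prod, one_div]
  simp only [Pi.smul_apply, smul_eq_mul, Torus.toComplex] at hz ⊢
  refine continuous_finsetProd _ fun j _ => ?_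
  refine ((Continuous.inv₀ (by fun_prop) fun p => ?_).mul (Continuous.inv₀ (by fun_prop)
    fun p => ?_)).mul (by fun_prop)
  · exact one_sub_mul_conj_ne_zero (hz p.1 j) (norm_circle_le _)
  · exact one_sub_mul_conj_ne_zero' (norm_circle_le _) (hz p.1 j)

/-- The Fourier coefficients of a measure in terms of its Poisson integral. -/
lemma integral_torusMonomial_eq {n : ℕ} {σ : Measure (Torus n)} [IsFiniteMeasure σ] {r : ℝ}
    (hr : r ∈ Set.Ioo (0 : ℝ) 1) (k : Fin n → ℤ) :
    (∏ j, (r : ℂ) ^ (k j).natAbs) * ∫ ζ, torusMonomial k ζ ∂σ =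
      ∫ η, (∫ ζ, poissonKernel ((r : ℂ) • η.toComplex) ζ ∂σ) * torusMonomial k η
        ∂torusMeasure n := by
  -- The monomials are eigenfunctions of the Poisson operator; Fubini and the symmetry of the kernel
  -- move that operator onto σ.
  calc _ = ∫ ζ, ∫ η, poissonKernel ((r : ℂ) • ζ.toComplex) η * torusMonomial k η
        ∂torusMeasure n ∂σ := by
        simp only [integral_poissonKernel_torusMonomial hr, integral_const_mul]
    _ = ∫ η, ∫ ζ, poissonKernel ((r : ℂ) • ζ.toComplex) η * torusMonomial k η ∂σ
        ∂torusMeasure n := by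
        refine integral_integral_swap (integrable_of_continuous ?_)
        exact (continuous_poissonKernel_dilate hr).mul
          ((torusMonomial k).continuous.comp continuous_snd)
    _ = _ := by
        refine integral_congr_ae (Eventually.of_forall fun η => ?_)
        simp only [fun ζ : Torus n => poissonKernel_dilate_comm r ζ η, integral_mul_const]

/-- One radius suffices: at r = 1/2 no multiplier r ^ |k| vanishes, so the Poisson integral on that
torus fixes every Fourier coefficient. -/
lemma IsClarkMeasure.unique {n : ℕ} {I : (Fin n → ℂ) → ℂ} {α : Circle} {σ τ : Measure (Torus n)}
    (hσ : IsClarkMeasure I α σ) (hτ : IsClarkMeasure I α τ) : σ = τ := by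
  have := hσ.1
  have := hτ.1
  have hr : (1 / 2 : ℝ) ∈ Set.Ioo (0 : ℝ) 1 := by norm_num
  refine measure_eq_of_integral_torusMonomial fun k => ?_
  have h0 : (∏ j, (((1 / 2 : ℝ)) : ℂ) ^ (k j).natAbs) ≠ 0 :=
    Finset.prod_ne_zero_iff.2 fun j _ => pow_ne_zero _ (by norm_num)
  refine mul_left_cancel₀ h0 ?_
  rw [integral_torusMonomial_eq hr, integral_torusMonomial_eq hr]
  simp only [hσ.2 _ (dilate_mem hr _), hτ.2 _ (dilate_mem hr _)]

/-! ### The Poisson integral -/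

/-- The Cauchy formula applies to F C(·,z), which is still holomorphic past the closed polydisc, and
yields F(z) C(z,z). -/
lemma integral_poisson {n : ℕ} {R : ℝ} (hR : 1 < R) {F : (Fin n → ℂ) → ℂ}
    (hF : DifferentiableOn ℂ F (polydiscOfRadius n R)) {z : Fin n → ℂ} (hz : z ∈ polydisc n) :
    ∫ ζ, F ζ.toComplex * poissonKernel z ζ ∂torusMeasure n = F z := by
  obtain ⟨S, hS, hzS⟩ := polydisc_exists_radius hz
  have hd : DifferentiableOn ℂ (fun v => F v * cauchyKernel v z) (polydiscOfRadius n (min R S)) :=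
    (hF.mono fun v hv j => (hv j).trans_le (min_le_left _ _)).mul
      ((differentiableOn_cauchyKernel z hzS).mono fun v hv j => (hv j).trans_le (min_le_right _ _))
  have h0 : cauchyKernel z z ≠ 0 :=
    cauchyKernel_ne_zero fun j => one_sub_mul_conj_ne_zero (hz j) (hz j).le
  have h := integral_cauchy (lt_min hR hS) hd hz
  calc _ = (∫ ζ, F ζ.toComplex * cauchyKernel ζ.toComplex z * cauchyKernel z ζ.toComplex
        ∂torusMeasure n) / cauchyKernel z z := by
        rw [← integral_div]
        refine integral_congr_ae (Eventually.of_forall fun ζ => ?_)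
        simp only [poissonKernel]; ring
    _ = F z := by rw [h]; field_simp

lemma cauchyKernel_self {n : ℕ} {z : Fin n → ℂ} (hz : z ∈ polydisc n) :
    cauchyKernel z z = ((‖cauchyKernel z z‖ : ℝ) : ℂ) := by
  have h : cauchyKernel z z = ((∏ j, 1 / (1 - ‖z j‖ ^ 2) : ℝ) : ℂ) := by
    simp [cauchyKernel, Complex.mul_conj, Complex.normSq_eq_norm_sq]
  have h0 : 0 ≤ ∏ j, 1 / (1 - ‖z j‖ ^ 2) := Finset.prod_nonneg fun j _ => by
    have := hz j
    have : ‖z j‖ ^ 2 ≤ 1 := pow_le_one₀ (norm_nonneg _) (hz j).le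
    exact one_div_nonneg.2 (by linarith)
  rw [h, Complex.norm_real, Real.norm_of_nonneg h0]

lemma poissonKernel_eq_norm {n : ℕ} {z : Fin n → ℂ} (hz : z ∈ polydisc n) (ζ : Torus n) :
    poissonKernel z ζ = ((‖poissonKernel z ζ‖ : ℝ) : ℂ) := by
  have h : poissonKernel z ζ = ((‖cauchyKernel z ζ.toComplex‖ ^ 2 / ‖cauchyKernel z z‖ : ℝ) : ℂ) := by
    rw [poissonKernel, ← conj_cauchyKernel z ζ.toComplex, Complex.mul_conj,
      Complex.normSq_eq_norm_sq, cauchyKernel_self hz, Complex.norm_real, norm_norm]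
    push_cast; rfl
  rw [h, Complex.norm_real, Real.norm_of_nonneg (by positivity)]

/-- The kernel is nonnegative, so its L¹ norm is its integral, which is the reproduced constant 1.
-/
lemma lintegral_enorm_poissonKernel {n : ℕ} {z : Fin n → ℂ} (hz : z ∈ polydisc n) :
    ∫⁻ ζ, ‖poissonKernel z ζ‖ₑ ∂torusMeasure n = 1 := by
  have h := integral_poisson (F := fun _ => 1) one_lt_two (differentiableOn_const 1) hz
  simp only [one_mul] at h
  have h1 : ∫ ζ, ‖poissonKernel z ζ‖ ∂torusMeasure n = 1 := by
    rw [integral_congr_ae (Eventually.of_forall fun ζ => poissonKernel_eq_norm hz ζ),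
      integral_complex_ofReal] at h
    exact_mod_cast h
  have h2 := ofReal_integral_eq_lintegral_ofReal
    (integrable_of_continuous (μ := torusMeasure n) (continuous_poissonKernel hz)).norm
    (Eventually.of_forall fun ζ => norm_nonneg _)
  rw [h1] at h2
  simpa [ofReal_norm] using h2.symm

lemma eLpNorm_two_sq {X : Type*} [MeasurableSpace X] {μ : Measure X} (f : X → ℂ) :
    eLpNorm f 2 μ ^ 2 = ∫⁻ x, ‖f x‖ₑ ^ 2 ∂μ := by
  have := eLpNorm_nnreal_pow_eq_lintegral (μ := μ) (f := f) (p := 2) two_ne_zero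
  simpa using this

/-- The Poisson integral of a square integrable function on the torus. -/
def poissonIntegral {n : ℕ} (f : Torus n → ℂ) (z : Fin n → ℂ) : ℂ :=
  ∫ ζ, f ζ * poissonKernel z ζ ∂torusMeasure n

/-- Dilations of the Poisson integral do not increase the `L²` norm. -/
lemma eLpNorm_poissonIntegral_le {n : ℕ} {f : Torus n → ℂ}
    (hf : AEStronglyMeasurable f (torusMeasure n)) {r : ℝ} (hr : r ∈ Set.Ioo (0 : ℝ) 1) :
    eLpNorm (fun ζ : Torus n => poissonIntegral f ((r : ℂ) • ζ.toComplex)) 2 (torusMeasure n) ≤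
      eLpNorm f 2 (torusMeasure n) := by
  have hP := continuous_poissonKernel_dilate (n := n) hr
  have hle : ∀ ζ : Torus n, ‖poissonIntegral f ((r : ℂ) • ζ.toComplex)‖ₑ ^ 2 ≤
      ∫⁻ η, ‖poissonKernel ((r : ℂ) • ζ.toComplex) η‖ₑ * ‖f η‖ₑ ^ 2 ∂torusMeasure n := by
    intro ζ
    have hm : Measurable fun η : Torus n => ‖poissonKernel ((r : ℂ) • ζ.toComplex) η‖ₑ :=
      (continuous_poissonKernel (dilate_mem hr ζ)).measurable.enorm
    -- Cauchy–Schwarz for the splitting P |f| = P^(1/2) (P |f|²)^(1/2), where P has integral one.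
    have h1 := ENNReal.lintegral_mul_norm_pow_le (μ := torusMeasure n) hm.aemeasurable
      (hm.aemeasurable.mul (hf.enorm.pow_const 2)) (p := 1 / 2) (q := 1 / 2)
      (by norm_num) (by norm_num) (by norm_num)
    rw [lintegral_enorm_poissonKernel (dilate_mem hr ζ), ENNReal.one_rpow, one_mul] at h1
    have h2 : ‖poissonIntegral f ((r : ℂ) • ζ.toComplex)‖ₑ ≤
        (∫⁻ η, ‖poissonKernel ((r : ℂ) • ζ.toComplex) η‖ₑ * ‖f η‖ₑ ^ 2
          ∂torusMeasure n) ^ (1 / 2 : ℝ) := by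
      refine (enorm_integral_le_lintegral_enorm _).trans (le_trans (lintegral_mono fun η => ?_) h1)
      simp only [Pi.mul_apply]
      rw [ENNReal.mul_rpow_of_nonneg _ _ (by norm_num), ← mul_assoc,
        ← ENNReal.rpow_add_of_nonneg _ _ (by norm_num) (by norm_num),
        ← ENNReal.rpow_natCast_mul, enorm_mul, mul_comm]
      norm_num
    calc _ ≤ _ := pow_le_pow_left' h2 2
      _ = _ := by rw [← ENNReal.rpow_mul_natCast]; norm_num
  rw [← ENNReal.pow_le_pow_left_iff two_ne_zero, eLpNorm_two_sq, eLpNorm_two_sq]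
  calc ∫⁻ ζ : Torus n, ‖poissonIntegral f ((r : ℂ) • ζ.toComplex)‖ₑ ^ 2 ∂torusMeasure n
      ≤ ∫⁻ ζ : Torus n, ∫⁻ η, ‖poissonKernel ((r : ℂ) • ζ.toComplex) η‖ₑ * ‖f η‖ₑ ^ 2
          ∂torusMeasure n ∂torusMeasure n := lintegral_mono hle
    _ = ∫⁻ η, ∫⁻ ζ : Torus n, ‖poissonKernel ((r : ℂ) • ζ.toComplex) η‖ₑ * ‖f η‖ₑ ^ 2
          ∂torusMeasure n ∂torusMeasure n := by
        refine lintegral_lintegral_swap ?_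
        exact hP.measurable.enorm.aemeasurable.mul ((hf.enorm.pow_const 2).comp_snd)
    _ = ∫⁻ η, ‖f η‖ₑ ^ 2 ∂torusMeasure n := by
        -- By the symmetry of the kernel, the integral in the other variable is again one.
        refine lintegral_congr fun η => ?_
        have hm : Measurable fun ζ : Torus n => ‖poissonKernel ((r : ℂ) • ζ.toComplex) η‖ₑ :=
          (hP.comp (Continuous.prodMk_left η)).measurable.enorm
        rw [lintegral_mul_const _ hm]
        simp only [fun ζ : Torus n => poissonKernel_dilate_comm r ζ η]
        rw [lintegral_enorm_poissonKernel (dilate_mem hr η), one_mul]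

/-! ### Boundary values -/

lemma tendsto_integral_mul_of_tendsto_eLpNorm {X ι : Type*} [MeasurableSpace X] {μ : Measure X}
    [IsFiniteMeasure μ] {l : Filter ι} {F : ι → X → ℂ} {f g : X → ℂ}
    (hF : ∀ᶠ i in l, MemLp (F i) 2 μ) (hf : MemLp f 2 μ) (hg : MemLp g 2 μ)
    (h : Tendsto (fun i => eLpNorm (fun x => F i x - f x) 2 μ) l (𝓝 0)) :
    Tendsto (fun i => ∫ x, F i x * g x ∂μ) l (𝓝 (∫ x, f x * g x ∂μ)) := by
  rw [tendsto_iff_edist_tendsto_0]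
  have h1 : Tendsto (fun i => eLpNorm (fun x => F i x - f x) 2 μ * eLpNorm g 2 μ) l (𝓝 0) := by
    have := ENNReal.Tendsto.mul_const (b := eLpNorm g 2 μ) h (Or.inr hg.eLpNorm_ne_top)
    rwa [zero_mul] at this
  refine tendsto_of_tendsto_of_tendsto_of_le_of_le' tendsto_const_nhds h1
    (Eventually.of_forall fun _ => zero_le) ?_
  filter_upwards [hF] with i hi
  have hs := integral_sub (hi.integrable_mul hg) (hf.integrable_mul hg)
  simp only [Pi.mul_apply] at hs
  rw [edist_eq_enorm_sub, ← hs]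
  refine (enorm_integral_le_lintegral_enorm _).trans ?_
  have := eLpNorm_smul_le_mul_eLpNorm (p := 2) (q := 2) (r := 1) hg.1 (hi.1.sub hf.1)
  rw [eLpNorm_one_eq_lintegral_enorm] at this
  refine le_trans (le_of_eq (lintegral_congr fun x => ?_)) this
  simp [sub_mul]

lemma memLp_of_continuous {X : Type*} [TopologicalSpace X] [CompactSpace X] [MeasurableSpace X]
    [OpensMeasurableSpace X] [SecondCountableTopology X] {μ : Measure X} [IsFiniteMeasure μ]
    {g : X → ℂ} (hg : Continuous g) (p : ℝ≥0∞) : MemLp g p μ := by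
  obtain ⟨C, hC⟩ := (isCompact_range hg).isBounded.exists_norm_le
  exact MemLp.of_bound hg.aestronglyMeasurable C
    (Eventually.of_forall fun x => hC _ (Set.mem_range_self x))

lemma memLp_dilate {n : ℕ} {F : (Fin n → ℂ) → ℂ} (hF : DifferentiableOn ℂ F (polydisc n))
    {r : ℝ} (hr : r ∈ Set.Ioo (0 : ℝ) 1) (p : ℝ≥0∞) :
    MemLp (fun ζ : Torus n => F ((r : ℂ) • ζ.toComplex)) p (torusMeasure n) :=
  memLp_of_continuous (continuous_dilate hF hr) p

lemma HasBoundaryValue.tendsto_integral_mul {n : ℕ} {F : (Fin n → ℂ) → ℂ}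
    {f : Lp ℂ 2 (torusMeasure n)} (hF : DifferentiableOn ℂ F (polydisc n))
    (hf : HasBoundaryValue F f) {g : Torus n → ℂ} (hg : MemLp g 2 (torusMeasure n)) :
    Tendsto (fun r : ℝ => ∫ ζ : Torus n, F ((r : ℂ) • ζ.toComplex) * g ζ ∂torusMeasure n)
      (𝓝[<] 1) (𝓝 (∫ ζ, f ζ * g ζ ∂torusMeasure n)) :=
  tendsto_integral_mul_of_tendsto_eLpNorm
    (eventually_Ioo.mono fun _ hr => memLp_dilate hF hr 2) (Lp.memLp f) hg hf

lemma differentiableOn_dilate {n : ℕ} {F : (Fin n → ℂ) → ℂ}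
    (hF : DifferentiableOn ℂ F (polydisc n)) {r : ℝ} (hr : r ∈ Set.Ioo (0 : ℝ) 1) :
    DifferentiableOn ℂ (fun z => F ((r : ℂ) • z)) (polydiscOfRadius n r⁻¹) := by
  refine hF.comp (g := F) (by fun_prop) fun z hz j => ?_
  have := hz j
  rw [Pi.smul_apply, norm_smul, Complex.norm_real, Real.norm_of_nonneg hr.1.le]
  calc r * ‖z j‖ < r * r⁻¹ := by gcongr; exact hr.1
    _ = 1 := mul_inv_cancel₀ hr.1.ne'

lemma tendsto_dilate {n : ℕ} {F : (Fin n → ℂ) → ℂ}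
    (hF : DifferentiableOn ℂ F (polydisc n)) {z : Fin n → ℂ} (hz : z ∈ polydisc n) :
    Tendsto (fun r : ℝ => F ((r : ℂ) • z)) (𝓝[<] 1) (𝓝 (F z)) := by
  have h1 : ContinuousAt F z := (hF.differentiableAt ((isOpen_polydisc n).mem_nhds hz)).continuousAt
  have h2 : Tendsto (fun r : ℝ => (r : ℂ) • z) (𝓝[<] 1) (𝓝 z) := by
    have : Continuous fun r : ℝ => (r : ℂ) • z := by fun_prop
    have := this.tendsto 1
    simp only [Complex.ofReal_one, one_smul] at this
    exact this.mono_left nhdsWithin_le_nhds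
  exact h1.tendsto.comp h2

/-- The dilate F_r is holomorphic on the polydisc of radius 1/r > 1, where the Cauchy formula
applies; then r tends to one on both sides. -/
lemma HasBoundaryValue.integral_cauchyKernel {n : ℕ} {F : (Fin n → ℂ) → ℂ}
    {f : Lp ℂ 2 (torusMeasure n)} (hF : DifferentiableOn ℂ F (polydisc n))
    (hf : HasBoundaryValue F f) {z : Fin n → ℂ} (hz : z ∈ polydisc n) :
    ∫ ζ, f ζ * cauchyKernel z ζ.toComplex ∂torusMeasure n = F z := by
  refine tendsto_nhds_unique
    (hf.tendsto_integral_mul hF (memLp_of_continuous (continuous_cauchyKernel_right hz) 2))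
    ((tendsto_dilate hF hz).congr' ?_)
  filter_upwards [eventually_Ioo] with r hr
  exact (integral_cauchy (one_lt_inv₀ hr.1 |>.2 hr.2) (differentiableOn_dilate hF hr) hz).symm

lemma HasBoundaryValue.poissonIntegral_eq {n : ℕ} {F : (Fin n → ℂ) → ℂ}
    {f : Lp ℂ 2 (torusMeasure n)} (hF : DifferentiableOn ℂ F (polydisc n))
    (hf : HasBoundaryValue F f) {z : Fin n → ℂ} (hz : z ∈ polydisc n) :
    poissonIntegral f z = F z := by
  refine tendsto_nhds_unique
    (hf.tendsto_integral_mul hF (memLp_of_continuous (continuous_poissonKernel hz) 2))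
    ((tendsto_dilate hF hz).congr' ?_)
  filter_upwards [eventually_Ioo] with r hr
  exact (integral_poisson (one_lt_inv₀ hr.1 |>.2 hr.2) (differentiableOn_dilate hF hr) hz).symm

lemma HasBoundaryValue.unique {n : ℕ} {F : (Fin n → ℂ) → ℂ} {f g : Lp ℂ 2 (torusMeasure n)}
    (hF : DifferentiableOn ℂ F (polydisc n)) (hf : HasBoundaryValue F f)
    (hg : HasBoundaryValue F g) : f = g := by
  have h := HasBoundaryValue.add hF (hF.const_smul (-1 : ℂ)) hf (hg.smul (-1))
  have h1 : (F + (-1 : ℂ) • F) = 0 := by simp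
  rw [h1] at h
  have h2 : eLpNorm (f + (-1 : ℂ) • g : Lp ℂ 2 (torusMeasure n)) 2 (torusMeasure n) = 0 := by
    refine tendsto_nhds_unique (tendsto_const_nhds.congr fun r => ?_) h
    simp only [Pi.zero_apply, zero_sub]
    exact (eLpNorm_neg (f + (-1 : ℂ) • g : Lp ℂ 2 (torusMeasure n)) 2 _).symm
  have h3 : f + (-1 : ℂ) • g = 0 := by
    rw [← norm_eq_zero, Lp.norm_def, h2]; rfl
  rw [neg_one_smul, ← sub_eq_add_neg] at h3
  exact sub_eq_zero.1 h3

/-! ### The Hardy space is closed -/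

lemma continuous_integral_mul {X : Type*} [MeasurableSpace X] {μ : Measure X} [IsFiniteMeasure μ]
    {g : X → ℂ} (hg : MemLp g 2 μ) : Continuous fun f : Lp ℂ 2 μ => ∫ x, f x * g x ∂μ := by
  refine continuous_iff_continuousAt.2 fun f => ?_
  refine tendsto_integral_mul_of_tendsto_eLpNorm (Eventually.of_forall fun f' => Lp.memLp f')
    (Lp.memLp f) hg ?_
  have h := tendsto_iff_edist_tendsto_0.1 (tendsto_id (x := 𝓝 f))
  simp only [id, Lp.edist_def] at h
  exact h

/-- The Cauchy kernel, as a map of z into the Banach algebra C(𝕋ⁿ), is a product of inverses of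
units and hence holomorphic. Composition with the continuous functional given by f replaces
differentiation under the integral. -/
lemma differentiableOn_integral_cauchyKernel {n : ℕ} {f : Torus n → ℂ}
    (hf : Integrable f (torusMeasure n)) :
    DifferentiableOn ℂ (fun z => ∫ ζ, f ζ * cauchyKernel z ζ.toComplex ∂torusMeasure n)
      (polydisc n) := by
  let e (j : Fin n) : C(Torus n, ℂ) := ⟨fun ζ => conj (ζ j : ℂ), by fun_prop⟩
  have he (z : Fin n → ℂ) (hz : z ∈ polydisc n) (j : Fin n) : IsUnit (1 - z j • e j) := by
    rw [ContinuousMap.isUnit_iff_forall_ne_zero]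
    exact fun ζ => one_sub_mul_conj_ne_zero (hz j) (norm_circle_le _)
  have hd : DifferentiableOn ℂ (fun z => ∏ j, Ring.inverse (1 - z j • e j)) (polydisc n) := by
    refine differentiableOn_prod (f := fun j (z : Fin n → ℂ) => Ring.inverse (1 - z j • e j))
      fun j => ?_
    refine DifferentiableOn.inverse ?_ fun z hz => he z hz j
    exact (differentiableOn_const _).sub (DifferentiableOn.smul_const (by fun_prop) _)
  refine ((integralMul hf).differentiable.comp_differentiableOn hd).congr fun z hz => ?_
  rw [Function.comp_apply, integralMul_apply]
  refine integral_congr_ae (Eventually.of_forall fun ζ => ?_)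
  have h : ∀ j, Ring.inverse (1 - z j • e j) ζ = 1 / (1 - z j * conj (ζ j : ℂ)) := by
    intro j
    have h1 : (Ring.inverse (1 - z j • e j) * (1 - z j • e j)) ζ = 1 := by
      rw [Ring.inverse_mul_cancel _ (he z hz j)]; rfl
    exact eq_one_div_of_mul_eq_one_left h1
  simp only [ContinuousMap.prod_apply, h, cauchyKernel, Torus.toComplex]
  ring

/-- A limit f of Hardy functions is represented by its Cauchy integral F. The Cauchy and Poisson
integrals agree on H², hence on its closure. The Cauchy form shows that F is holomorphic, and the
Poisson form is an L² contraction, which bounds F_r and compares it with the dilates of an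
approximant. -/
lemma isClosed_hardySpace (n : ℕ) : IsClosed (hardySpace n : Set (Lp ℂ 2 (torusMeasure n))) := by
  refine isClosed_of_closure_subset fun f hf => ?_
  have hfm := Lp.memLp f
  set F : (Fin n → ℂ) → ℂ := fun z => ∫ ζ, f ζ * cauchyKernel z ζ.toComplex ∂torusMeasure n
  have hFd : DifferentiableOn ℂ F (polydisc n) :=
    differentiableOn_integral_cauchyKernel (hfm.integrable one_le_two)
  have hFP : ∀ z ∈ polydisc n, F z = poissonIntegral f z := by
    intro z hz
    have hc : IsClosed {g : Lp ℂ 2 (torusMeasure n) |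
        ∫ ζ, g ζ * cauchyKernel z ζ.toComplex ∂torusMeasure n =
          ∫ ζ, g ζ * poissonKernel z ζ ∂torusMeasure n} :=
      isClosed_eq
        (continuous_integral_mul (memLp_of_continuous (continuous_cauchyKernel_right hz) 2))
        (continuous_integral_mul (memLp_of_continuous (continuous_poissonKernel hz) 2))
    refine closure_minimal (fun g hg => ?_) hc hf
    obtain ⟨G, hG, hGg⟩ := hg
    exact (hGg.integral_cauchyKernel hG.1 hz).trans (hGg.poissonIntegral_eq hG.1 hz).symm
  refine ⟨F, ⟨hFd, lt_of_le_of_lt (iSup₂_le fun r hr => ?_)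
    (ENNReal.pow_lt_top (n := 2) hfm.eLpNorm_lt_top)⟩, ?_⟩
  · rw [← eLpNorm_two_sq (fun ζ : Torus n => F ((r : ℂ) • ζ.toComplex))]
    simp only [fun ζ : Torus n => hFP _ (dilate_mem hr ζ)]
    exact pow_le_pow_left' (eLpNorm_poissonIntegral_le hfm.1 hr) 2
  · refine ENNReal.tendsto_nhds_zero.2 fun ε hε => ?_
    have hε3 : 0 < ε / 3 := ENNReal.div_pos hε.ne' (by norm_num)
    obtain ⟨g, ⟨G, hG, hGg⟩, hfg⟩ := EMetric.mem_closure_iff.1 hf (ε / 3) hε3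
    rw [Lp.edist_def] at hfg
    filter_upwards [ENNReal.tendsto_nhds_zero.1 hGg (ε / 3) hε3, eventually_Ioo] with r h1 hr
    have hgm := Lp.memLp g
    have hFm := memLp_dilate hFd hr 2
    have hGm := memLp_dilate hG.1 hr 2
    have h2 : eLpNorm (fun ζ : Torus n => F ((r : ℂ) • ζ.toComplex) - G ((r : ℂ) • ζ.toComplex)) 2
        (torusMeasure n) ≤ ε / 3 := by
      refine le_trans (le_of_eq ?_)
        ((eLpNorm_poissonIntegral_le (hfm.1.sub hgm.1) hr).trans hfg.le)
      congr 1; funext ζ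
      rw [hFP _ (dilate_mem hr ζ), ← hGg.poissonIntegral_eq hG.1 (dilate_mem hr ζ)]
      have hP := memLp_of_continuous (μ := torusMeasure n)
        (continuous_poissonKernel (dilate_mem hr ζ)) 2
      have hs := integral_sub (hfm.integrable_mul hP) (hgm.integrable_mul hP)
      simp only [Pi.mul_apply] at hs
      rw [poissonIntegral, poissonIntegral, poissonIntegral, ← hs]
      simp [sub_mul]
    -- Three-term estimate F_r - f = (F_r - G_r) + (G_r - g) - (f - g).
    calc eLpNorm (fun ζ : Torus n => F ((r : ℂ) • ζ.toComplex) - f ζ) 2 (torusMeasure n)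
        = eLpNorm ((fun ζ : Torus n => F ((r : ℂ) • ζ.toComplex) - G ((r : ℂ) • ζ.toComplex)) +
            ((fun ζ : Torus n => G ((r : ℂ) • ζ.toComplex) - g ζ) + -(⇑f - ⇑g))) 2
            (torusMeasure n) := by
          congr 1; funext ζ; simp
      _ ≤ ε / 3 + (ε / 3 + ε / 3) := by
          refine (eLpNorm_add_le (hFm.1.sub hGm.1) ((hGm.1.sub hgm.1).add (hfm.1.sub hgm.1).neg)
            one_le_two).trans (add_le_add h2 ?_)
          refine (eLpNorm_add_le (hGm.1.sub hgm.1) (hfm.1.sub hgm.1).neg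
            one_le_two).trans (add_le_add h1 ?_)
          rw [eLpNorm_neg]; exact hfg.le
      _ = ε := by rw [← add_assoc]; exact ENNReal.add_thirds ε

/-! ### Bounded holomorphic functions -/

lemma memHardy_of_bounded {n : ℕ} {F : (Fin n → ℂ) → ℂ} (hF : DifferentiableOn ℂ F (polydisc n))
    {M : ℝ} (hM : ∀ z ∈ polydisc n, ‖F z‖ ≤ M) : MemHardy F := by
  refine ⟨hF, lt_of_le_of_lt (iSup₂_le fun r hr => ?_)
    (ENNReal.pow_lt_top (n := 2) (ENNReal.ofReal_lt_top (r := M)))⟩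
  calc _ ≤ ∫⁻ _ : Torus n, ENNReal.ofReal M ^ 2 ∂torusMeasure n := by
        refine lintegral_mono fun ζ => pow_le_pow_left' ?_ 2
        rw [← ofReal_norm]
        exact ENNReal.ofReal_le_ofReal (hM _ (dilate_mem hr ζ))
    _ = _ := by simp

/-- A sequence of radii is needed because measurability of a limit is available only along countable
families. -/
lemma tendsto_one_sub_inv : Tendsto (fun k : ℕ => 1 - ((k : ℝ) + 2)⁻¹) atTop (𝓝[<] 1) := by
  refine tendsto_nhdsWithin_iff.2 ⟨?_, Eventually.of_forall fun k => ?_⟩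
  · have : Tendsto (fun k : ℕ => ((k : ℝ) + 2)⁻¹) atTop (𝓝 0) :=
      tendsto_inv_atTop_zero.comp (tendsto_atTop_add_const_right _ _ tendsto_natCast_atTop_atTop)
    simpa using this.const_sub 1
  · have : 0 < ((k : ℝ) + 2)⁻¹ := by positivity
    simpa using this

/-- A bounded holomorphic function with radial limits has these limits as boundary values. -/
lemma exists_hasBoundaryValue {n : ℕ} {F : (Fin n → ℂ) → ℂ}
    (hF : DifferentiableOn ℂ F (polydisc n)) {M : ℝ} (hM : ∀ z ∈ polydisc n, ‖F z‖ ≤ M)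
    {l : Torus n → ℂ} (hl : ∀ᵐ ζ : Torus n ∂torusMeasure n,
      Tendsto (fun r : ℝ => F ((r : ℂ) • ζ.toComplex)) (𝓝[<] 1) (𝓝 (l ζ))) :
    ∃ f : Lp ℂ 2 (torusMeasure n), HasBoundaryValue F f ∧ f =ᵐ[torusMeasure n] l := by
  have hk (k : ℕ) : 1 - ((k : ℝ) + 2)⁻¹ ∈ Set.Ioo (0 : ℝ) 1 := by
    have h1 : 0 < ((k : ℝ) + 2)⁻¹ := by positivity
    have h2 : ((k : ℝ) + 2)⁻¹ < 1 := inv_lt_one_of_one_lt₀ (by linarith [k.cast_nonneg (α := ℝ)])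
    constructor <;> linarith
  have hlm : AEStronglyMeasurable l (torusMeasure n) :=
    aestronglyMeasurable_of_tendsto_ae atTop
      (fun k => (continuous_dilate hF (hk k)).aestronglyMeasurable)
      (hl.mono fun ζ h => h.comp tendsto_one_sub_inv)
  have hlb : ∀ᵐ ζ : Torus n ∂torusMeasure n, ‖l ζ‖ ≤ M := hl.mono fun ζ h =>
    le_of_tendsto h.norm (eventually_Ioo.mono fun r hr => hM _ (dilate_mem hr ζ))
  have hlp : MemLp l 2 (torusMeasure n) := MemLp.of_bound hlm M hlb
  refine ⟨hlp.toLp l, ?_, hlp.coeFn_toLp⟩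
  have hae := hlm.ae_eq_mk
  have h1 : Tendsto (fun r : ℝ => ∫⁻ ζ : Torus n, ‖F ((r : ℂ) • ζ.toComplex) - hlm.mk l ζ‖ₑ ^ 2
      ∂torusMeasure n) (𝓝[<] 1) (𝓝 (∫⁻ _ : Torus n, 0 ∂torusMeasure n)) := by
    refine tendsto_lintegral_filter_of_dominated_convergence
      (fun _ => ENNReal.ofReal (2 * M) ^ 2) ?_ ?_ ?_ ?_
    · filter_upwards [eventually_Ioo] with r hr
      exact (((continuous_dilate hF hr).measurable.sub
        hlm.stronglyMeasurable_mk.measurable).enorm).pow_const 2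
    · filter_upwards [eventually_Ioo] with r hr
      filter_upwards [hlb, hae] with ζ hζ hζ'
      refine pow_le_pow_left' ?_ 2
      rw [← ofReal_norm, ← hζ']
      refine ENNReal.ofReal_le_ofReal ((norm_sub_le _ _).trans ?_)
      linarith [hM _ (dilate_mem hr ζ)]
    · rw [lintegral_const, measure_univ, mul_one]
      exact (ENNReal.pow_lt_top ENNReal.ofReal_lt_top).ne
    · filter_upwards [hl, hae] with ζ h hζ'
      have h2 := ENNReal.Tendsto.pow (n := 2) (h.sub_const (l ζ)).enorm
      rw [← hζ']
      simpa using h2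
  have h2 : ∀ r : ℝ, eLpNorm (fun ζ : Torus n => F ((r : ℂ) • ζ.toComplex) - hlp.toLp l ζ) 2
      (torusMeasure n) = (∫⁻ ζ : Torus n, ‖F ((r : ℂ) • ζ.toComplex) - hlm.mk l ζ‖ₑ ^ 2
      ∂torusMeasure n) ^ (1 / 2 : ℝ) := by
    intro r
    rw [← eLpNorm_two_sq, ← ENNReal.rpow_natCast_mul]
    norm_num
    refine eLpNorm_congr_ae ?_
    filter_upwards [hlp.coeFn_toLp, hae] with ζ hζ hζ'
    rw [hζ, hζ']
  unfold HasBoundaryValue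
  simp only [h2]
  have h3 := h1.ennrpow_const (1 / 2 : ℝ)
  simpa using h3

/-! ### The model space -/

/-- The function `b` consists of radial limits of `I` of modulus one. -/
def IsRadialLimit {n : ℕ} (I : (Fin n → ℂ) → ℂ) (b : Torus n → ℂ) : Prop :=
  ∀ᵐ ζ : Torus n ∂torusMeasure n, ‖b ζ‖ = 1 ∧
    Tendsto (fun r : ℝ => I ((r : ℂ) • ζ.toComplex)) (𝓝[<] 1) (𝓝 (b ζ))

lemma IsInner.exists_isRadialLimit {n : ℕ} {I : (Fin n → ℂ) → ℂ} (hI : IsInner I) :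
    ∃ b, IsRadialLimit I b := hI.2.2.choice

lemma tendsto_smul_toComplex {n : ℕ} (ζ : Torus n) :
    Tendsto (fun r : ℝ => (r : ℂ) • ζ.toComplex) (𝓝[<] 1) (𝓝 ζ.toComplex) := by
  have h : Continuous fun r : ℝ => (r : ℂ) • ζ.toComplex := by fun_prop
  have h1 := h.tendsto 1
  simp only [Complex.ofReal_one, one_smul] at h1
  exact h1.mono_left nhdsWithin_le_nhds

lemma tendsto_cauchyKernel_dilate {n : ℕ} {w : Fin n → ℂ} (hw : w ∈ polydisc n) (ζ : Torus n) :
    Tendsto (fun r : ℝ => cauchyKernel ((r : ℂ) • ζ.toComplex) w) (𝓝[<] 1)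
      (𝓝 (cauchyKernel ζ.toComplex w)) := by
  obtain ⟨S, hS, hwS⟩ := polydisc_exists_radius hw
  have h1 := ((differentiableOn_cauchyKernel w hwS).differentiableAt
    ((isOpen_polydiscOfRadius n S).mem_nhds (toComplex_mem hS ζ))).continuousAt
  exact h1.tendsto.comp (tendsto_smul_toComplex ζ)

lemma exists_norm_cauchyKernel_le {n : ℕ} {w : Fin n → ℂ} (hw : w ∈ polydisc n) :
    ∃ M : ℝ, 0 ≤ M ∧ ∀ z : Fin n → ℂ, (∀ j, ‖z j‖ ≤ 1) → ‖cauchyKernel z w‖ ≤ M := by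
  have h0 : ∀ j, 0 < 1 - ‖w j‖ := fun j => sub_pos.2 (hw j)
  refine ⟨∏ j, 1 / (1 - ‖w j‖), Finset.prod_nonneg fun j _ => (one_div_pos.2 (h0 j)).le,
    fun z hz => ?_⟩
  rw [cauchyKernel, norm_prod]
  refine Finset.prod_le_prod (fun _ _ => norm_nonneg _) fun j _ => ?_
  rw [norm_div, norm_one]
  refine one_div_le_one_div_of_le (h0 j) ?_
  have h1 := norm_sub_norm_le (1 : ℂ) (z j * conj (w j))
  rw [norm_one, norm_mul, RCLike.norm_conj] at h1
  nlinarith [hz j, norm_nonneg (w j)]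

lemma memHardy_cauchyKernel {n : ℕ} {w : Fin n → ℂ} (hw : w ∈ polydisc n) :
    MemHardy fun z => cauchyKernel z w := by
  obtain ⟨M, -, hM⟩ := exists_norm_cauchyKernel_le hw
  exact memHardy_of_bounded (differentiableOn_cauchyKernel_polydisc hw)
    fun z hz => hM z fun j => (hz j).le

lemma differentiableOn_modelKernel {n : ℕ} {I : (Fin n → ℂ) → ℂ} (hI : IsInner I)
    {w : Fin n → ℂ} (hw : w ∈ polydisc n) :
    DifferentiableOn ℂ (modelKernel I w) (polydisc n) :=
  ((differentiableOn_const 1).sub (hI.1.mul_const _)).mul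
    (differentiableOn_cauchyKernel_polydisc hw)

lemma exists_norm_modelKernel_le {n : ℕ} {I : (Fin n → ℂ) → ℂ} (hI : IsInner I)
    {w : Fin n → ℂ} (hw : w ∈ polydisc n) :
    ∃ M : ℝ, ∀ z ∈ polydisc n, ‖modelKernel I w z‖ ≤ M := by
  obtain ⟨M, h0, hM⟩ := exists_norm_cauchyKernel_le hw
  refine ⟨2 * M, fun z hz => ?_⟩
  rw [modelKernel, norm_mul]
  refine mul_le_mul ?_ (hM z fun j => (hz j).le) (norm_nonneg _) zero_le_two
  refine (norm_sub_le _ _).trans ?_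
  rw [norm_one, norm_mul, RCLike.norm_conj]
  nlinarith [hI.2.1 z hz, hI.2.1 w hw, norm_nonneg (I z), norm_nonneg (I w)]

lemma exists_boundary_modelKernel {n : ℕ} {I : (Fin n → ℂ) → ℂ} (hI : IsInner I)
    {b : Torus n → ℂ} (hb : IsRadialLimit I b) {w : Fin n → ℂ} (hw : w ∈ polydisc n) :
    ∃ k : Lp ℂ 2 (torusMeasure n), HasBoundaryValue (modelKernel I w) k ∧
      k =ᵐ[torusMeasure n] fun ζ => (1 - b ζ * conj (I w)) * cauchyKernel ζ.toComplex w := by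
  obtain ⟨M, hM⟩ := exists_norm_modelKernel_le hI hw
  refine exists_hasBoundaryValue (differentiableOn_modelKernel hI hw) hM ?_
  filter_upwards [hb] with ζ hζ
  exact (tendsto_const_nhds.sub (hζ.2.mul_const _)).mul (tendsto_cauchyKernel_dilate hw ζ)

/-- These particular multiples of I are the test elements used for orthogonality to IH². -/
lemma exists_boundary_mul_cauchyKernel {n : ℕ} {I : (Fin n → ℂ) → ℂ} (hI : IsInner I)
    {b : Torus n → ℂ} (hb : IsRadialLimit I b) {w : Fin n → ℂ} (hw : w ∈ polydisc n) :
    ∃ u : Lp ℂ 2 (torusMeasure n), u ∈ innerMultiples I ∧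
      u =ᵐ[torusMeasure n] fun ζ => b ζ * cauchyKernel ζ.toComplex w := by
  obtain ⟨M, h0, hM⟩ := exists_norm_cauchyKernel_le hw
  obtain ⟨u, hu, hu'⟩ := exists_hasBoundaryValue (F := I * fun z => cauchyKernel z w)
    (hI.1.mul (differentiableOn_cauchyKernel_polydisc hw)) (M := M) (fun z hz => by
      rw [Pi.mul_apply, norm_mul]
      have := hM z fun j => (hz j).le
      nlinarith [hI.2.1 z hz, norm_nonneg (I z), norm_nonneg (cauchyKernel z w)])
    (l := fun ζ => b ζ * cauchyKernel ζ.toComplex w) (by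
      filter_upwards [hb] with ζ hζ
      exact hζ.2.mul (tendsto_cauchyKernel_dilate hw ζ))
  exact ⟨u, ⟨_, memHardy_cauchyKernel hw, hu⟩, hu'⟩

lemma eLpNorm_dilate_le {n : ℕ} (G : (Fin n → ℂ) → ℂ) {r : ℝ} (hr : r ∈ Set.Ioo (0 : ℝ) 1) :
    eLpNorm (fun ζ : Torus n => G ((r : ℂ) • ζ.toComplex)) 2 (torusMeasure n) ≤
      hardyNormSq G ^ (1 / 2 : ℝ) := by
  have h : eLpNorm (fun ζ : Torus n => G ((r : ℂ) • ζ.toComplex)) 2 (torusMeasure n) ^ 2 ≤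
      hardyNormSq G := by
    rw [eLpNorm_two_sq]
    exact le_iSup₂ (f := fun (r : ℝ) (_ : r ∈ Set.Ioo (0 : ℝ) 1) =>
      ∫⁻ ζ, ‖G ((r : ℂ) • Torus.toComplex ζ)‖ₑ ^ 2 ∂torusMeasure n) r hr
  calc _ = (eLpNorm (fun ζ : Torus n => G ((r : ℂ) • ζ.toComplex)) 2 (torusMeasure n) ^ 2)
        ^ (1 / 2 : ℝ) := by rw [← ENNReal.rpow_natCast_mul]; norm_num
    _ ≤ _ := ENNReal.rpow_le_rpow h (by norm_num)

/-- Division by `I` on the boundary recovers the second factor of a multiple of `I`. -/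
lemma integral_innerMultiple {n : ℕ} {I : (Fin n → ℂ) → ℂ} (hI : IsInner I)
    {b : Torus n → ℂ} (hb : IsRadialLimit I b) {G : (Fin n → ℂ) → ℂ} (hG : MemHardy G)
    {g : Lp ℂ 2 (torusMeasure n)} (hg : HasBoundaryValue (I * G) g)
    {w : Fin n → ℂ} (hw : w ∈ polydisc n) :
    ∫ ζ, g ζ * (conj (b ζ) * cauchyKernel w ζ.toComplex) ∂torusMeasure n = G w := by
  obtain ⟨f, hf, hfb⟩ := exists_hasBoundaryValue hI.1 (fun z hz => (hI.2.1 z hz).le)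
    (hb.mono fun ζ h => h.2)
  obtain ⟨M, h0, hM⟩ := exists_norm_cauchyKernel_le hw
  have hM' : ∀ ζ : Torus n, ‖cauchyKernel w ζ.toComplex‖ ≤ M := fun ζ => by
    rw [← conj_cauchyKernel, RCLike.norm_conj]
    exact hM _ fun j => (norm_toComplex ζ j).le
  have hbm : AEStronglyMeasurable b (torusMeasure n) := (Lp.aestronglyMeasurable f).congr hfb
  have hcm := (continuous_cauchyKernel_right hw).aestronglyMeasurable (μ := torusMeasure n)
  have hbc : MemLp (fun ζ : Torus n => conj (b ζ) * cauchyKernel w ζ.toComplex) 2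
      (torusMeasure n) := by
    refine MemLp.of_bound ((Complex.continuous_conj.comp_aestronglyMeasurable hbm).mul hcm) M ?_
    filter_upwards [hb] with ζ hζ
    rw [norm_mul, RCLike.norm_conj, hζ.1, one_mul]
    exact hM' ζ
  have h1 := hg.tendsto_integral_mul (hI.1.mul hG.1) hbc
  have h2 := tendsto_dilate hG.1 hw
  refine tendsto_nhds_unique h1 ?_
  rw [tendsto_iff_edist_tendsto_0]
  -- The error has two sources: I_r approaches its boundary function in L² while G_r stays bounded
  -- in L², and G(rw) approaches G(w).
  have h3 : Tendsto (fun r : ℝ => eLpNorm (fun ζ : Torus n => I ((r : ℂ) • ζ.toComplex) - f ζ) 2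
      (torusMeasure n) * (ENNReal.ofReal M * hardyNormSq G ^ (1 / 2 : ℝ)) +
      edist (G ((r : ℂ) • w)) (G w)) (𝓝[<] 1) (𝓝 0) := by
    have hA := ENNReal.Tendsto.mul_const (b := ENNReal.ofReal M * hardyNormSq G ^ (1 / 2 : ℝ)) hf
      (Or.inr (ENNReal.mul_ne_top ENNReal.ofReal_ne_top
        (ENNReal.rpow_ne_top_of_nonneg (by norm_num) hG.2.ne)))
    have hB := tendsto_iff_edist_tendsto_0.1 h2
    simpa using hA.add hB
  refine tendsto_of_tendsto_of_tendsto_of_le_of_le' tendsto_const_nhds h3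
    (Eventually.of_forall fun _ => zero_le) ?_
  filter_upwards [eventually_Ioo] with r hr
  refine (edist_triangle _ (G ((r : ℂ) • w)) _).trans (add_le_add_left ?_ _)
  have hIr := memLp_dilate hI.1 hr 2
  have hGr := memLp_dilate hG.1 hr 2
  have hIGr := memLp_dilate (hI.1.mul hG.1) hr 2
  have hGw := integral_cauchy (one_lt_inv₀ hr.1 |>.2 hr.2) (differentiableOn_dilate hG.1 hr) hw
  have hs := integral_sub (hIGr.integrable_mul hbc)
    (hGr.integrable_mul (memLp_of_continuous (continuous_cauchyKernel_right hw) 2))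
  simp only [Pi.mul_apply] at hs hGw ⊢
  rw [edist_eq_enorm_sub, ← hGw, ← hs]
  refine (enorm_integral_le_lintegral_enorm _).trans ?_
  -- As b conj b = 1, the difference of the integrands is conj b C(w,·) (I_r - b) G_r; Hölder's
  -- inequality then separates the last two factors.
  calc _ ≤ ∫⁻ ζ : Torus n, ENNReal.ofReal M * ‖(I ((r : ℂ) • ζ.toComplex) - f ζ) •
        G ((r : ℂ) • ζ.toComplex)‖ₑ ∂torusMeasure n := by
        refine lintegral_mono_ae ?_
        filter_upwards [hb, hfb] with ζ hζ hfζ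
        have hbb : b ζ * conj (b ζ) = 1 := by
          rw [Complex.mul_conj, Complex.normSq_eq_norm_sq, hζ.1]; simp
        have : I ((r : ℂ) • ζ.toComplex) * G ((r : ℂ) • ζ.toComplex) *
            (conj (b ζ) * cauchyKernel w ζ.toComplex) - G ((r : ℂ) • ζ.toComplex) *
            cauchyKernel w ζ.toComplex = (conj (b ζ) * cauchyKernel w ζ.toComplex) *
            ((I ((r : ℂ) • ζ.toComplex) - f ζ) • G ((r : ℂ) • ζ.toComplex)) := by
          rw [hfζ, smul_eq_mul]
          linear_combination (G ((r : ℂ) • ζ.toComplex) * cauchyKernel w ζ.toComplex) * hbb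
        rw [this, enorm_mul]
        refine mul_le_mul' ?_ le_rfl
        rw [← ofReal_norm, norm_mul, RCLike.norm_conj, hζ.1, one_mul]
        exact ENNReal.ofReal_le_ofReal (hM' ζ)
    _ = ENNReal.ofReal M * eLpNorm ((fun ζ : Torus n => I ((r : ℂ) • ζ.toComplex) - f ζ) •
        fun ζ : Torus n => G ((r : ℂ) • ζ.toComplex)) 1 (torusMeasure n) := by
        rw [lintegral_const_mul' _ _ ENNReal.ofReal_ne_top, eLpNorm_one_eq_lintegral_enorm]
        rfl
    _ ≤ ENNReal.ofReal M * (eLpNorm (fun ζ : Torus n => I ((r : ℂ) • ζ.toComplex) - f ζ) 2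
          (torusMeasure n) * hardyNormSq G ^ (1 / 2 : ℝ)) := by
        refine mul_le_mul' le_rfl ?_
        refine (eLpNorm_smul_le_mul_eLpNorm (p := 2) (q := 2) (r := 1) hGr.1
          (hIr.1.sub (Lp.aestronglyMeasurable f))).trans ?_
        exact mul_le_mul' le_rfl (eLpNorm_dilate_le G hr)
    _ = _ := mul_left_comm _ _ _

/-- The inner product with a kernel of the model space. -/
lemma inner_modelKernel {n : ℕ} {I : (Fin n → ℂ) → ℂ} (hI : IsInner I)
    {b : Torus n → ℂ} (hb : IsRadialLimit I b) {w : Fin n → ℂ} (hw : w ∈ polydisc n)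
    {k : Lp ℂ 2 (torusMeasure n)} (hk : HasBoundaryValue (modelKernel I w) k)
    {f : Lp ℂ 2 (torusMeasure n)} {F : (Fin n → ℂ) → ℂ} (hF : DifferentiableOn ℂ F (polydisc n))
    (hf : HasBoundaryValue F f) :
    inner ℂ k f = F w -
      I w * ∫ ζ, f ζ * (conj (b ζ) * cauchyKernel w ζ.toComplex) ∂torusMeasure n := by
  obtain ⟨k', hk', hkb⟩ := exists_boundary_modelKernel hI hb hw
  obtain ⟨u, -, hub⟩ := exists_boundary_mul_cauchyKernel hI hb hw
  obtain rfl := hk.unique (differentiableOn_modelKernel hI hw) hk'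
  have hu : MemLp (fun ζ => conj (b ζ) * cauchyKernel w ζ.toComplex) 2 (torusMeasure n) := by
    refine ((Lp.memLp u).star).ae_eq ?_
    filter_upwards [hub] with ζ hζ
    rw [Pi.star_apply, hζ, ← conj_cauchyKernel ζ.toComplex w]
    simp
  have hs := integral_sub ((Lp.memLp f).integrable_mul
    (memLp_of_continuous (continuous_cauchyKernel_right hw) 2))
    (((Lp.memLp f).integrable_mul hu).const_mul (I w))
  rw [integral_const_mul] at hs
  simp only [Pi.mul_apply] at hs
  rw [← hf.integral_cauchyKernel hF hw, ← hs, L2.inner_def]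
  refine integral_congr_ae ?_
  filter_upwards [hkb] with ζ hζ
  rw [hζ, RCLike.inner_apply]
  simp only [map_mul, map_sub, map_one, Complex.conj_conj, conj_cauchyKernel]
  ring

/-- In `inner_modelKernel` the correction integral is the inner product of f with the boundary
function of I C(·,w), which vanishes on the orthogonal complement of IH². -/
lemma inner_modelKernel_of_mem {n : ℕ} {I : (Fin n → ℂ) → ℂ} (hI : IsInner I)
    {w : Fin n → ℂ} (hw : w ∈ polydisc n)
    {k : Lp ℂ 2 (torusMeasure n)} (hk : HasBoundaryValue (modelKernel I w) k)
    {f : Lp ℂ 2 (torusMeasure n)} (hfm : f ∈ modelSpace I) {F : (Fin n → ℂ) → ℂ}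
    (hF : DifferentiableOn ℂ F (polydisc n)) (hf : HasBoundaryValue F f) :
    inner ℂ k f = F w := by
  obtain ⟨b, hb⟩ := hI.exists_isRadialLimit
  obtain ⟨u, hu, hub⟩ := exists_boundary_mul_cauchyKernel hI hb hw
  have h0 : inner ℂ u f = 0 := hfm.2 u (Submodule.subset_span hu)
  rw [inner_modelKernel hI hb hw hk hF hf]
  rw [L2.inner_def] at h0
  rw [← integral_congr_ae, h0] <;> [simp; skip]
  filter_upwards [hub] with ζ hζ
  rw [hζ, RCLike.inner_apply]
  simp only [map_mul, conj_cauchyKernel]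

/-- Boundedness puts K_w in H². Its inner product with a multiple IG is I(w)G(w) - I(w)G(w) = 0, as
division by I on the boundary recovers G. -/
lemma exists_modelKernel_mem {n : ℕ} {I : (Fin n → ℂ) → ℂ} (hI : IsInner I)
    {w : Fin n → ℂ} (hw : w ∈ polydisc n) :
    ∃ k : modelSpace I, HasBoundaryValue (modelKernel I w) (k : Lp ℂ 2 (torusMeasure n)) := by
  obtain ⟨b, hb⟩ := hI.exists_isRadialLimit
  obtain ⟨k, hk, -⟩ := exists_boundary_modelKernel hI hb hw
  obtain ⟨M, hM⟩ := exists_norm_modelKernel_le hI hw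
  have hd := differentiableOn_modelKernel hI hw
  refine ⟨⟨k, ⟨_, memHardy_of_bounded hd hM, hk⟩, ?_⟩, hk⟩
  have h : Submodule.span ℂ (innerMultiples I) ≤ LinearMap.ker (innerSL ℂ k).toLinearMap := by
    refine Submodule.span_le.2 ?_
    rintro g ⟨G, hG, hg⟩
    have h1 := inner_modelKernel hI hb hw hk (hI.1.mul hG.1) hg
    rw [integral_innerMultiple hI hb hG hg hw, Pi.mul_apply, sub_self] at h1
    simpa using h1
  intro u hu
  have := h hu
  have h1 : inner ℂ k u = 0 := by simpa using this
  rw [← inner_conj_symm, h1, map_zero]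

/-- By the reproducing property the holomorphic representative of f vanishes at every point. -/
lemma modelSpace_eq_zero {n : ℕ} {I : (Fin n → ℂ) → ℂ} (hI : IsInner I) (f : modelSpace I)
    (hf : ∀ w ∈ polydisc n, ∀ k : modelSpace I,
      HasBoundaryValue (modelKernel I w) (k : Lp ℂ 2 (torusMeasure n)) →
        inner ℂ (k : Lp ℂ 2 (torusMeasure n)) f = 0) :
    f = 0 := by
  obtain ⟨⟨F, hF, hFf⟩, -⟩ := f.2
  have h0 : ∀ w ∈ polydisc n, F w = 0 := by
    intro w hw
    obtain ⟨k, hk⟩ := exists_modelKernel_mem hI hw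
    rw [← inner_modelKernel_of_mem hI hw hk f.2 hF.1 hFf]
    exact hf w hw k hk
  have h1 : HasBoundaryValue 0 (f : Lp ℂ 2 (torusMeasure n)) := by
    refine Tendsto.congr' ?_ hFf
    filter_upwards [eventually_Ioo] with r hr
    simp only [h0 _ (dilate_mem hr _), Pi.zero_apply]
  exact Subtype.ext (h1.unique (differentiableOn_const 0) HasBoundaryValue.zero)

instance instCompleteSpaceModelSpace {n : ℕ} (I : (Fin n → ℂ) → ℂ) :
    CompleteSpace (modelSpace I) := by
  have h : IsClosed (modelSpace I : Set (Lp ℂ 2 (torusMeasure n))) :=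
    (isClosed_hardySpace n).inter (Submodule.isClosed_orthogonal _)
  exact h.completeSpace_coe

/-! ### Clark measures and Clark operators -/

/-- The polarized form of the defining identity of a Clark measure. -/
def IsPolarizedClarkMeasure {n : ℕ} (I : (Fin n → ℂ) → ℂ) (α : Circle) (σ : Measure (Torus n)) :
    Prop :=
  IsFiniteMeasure σ ∧ ∀ z ∈ polydisc n, ∀ w ∈ polydisc n,
    (1 - α * conj (I w)) * (1 - conj (α : ℂ) * I z) *
      ∫ ξ, cauchyKernel z ξ.toComplex * cauchyKernel ξ.toComplex w ∂σ =
    (1 - I z * conj (I w)) * cauchyKernel z w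

lemma circle_mul_conj (α : Circle) : (α : ℂ) * conj (α : ℂ) = 1 := by
  rw [star_eq_inv, mul_inv_cancel₀ (Circle.coe_ne_zero α)]

/-- At z = w the Poisson integral becomes (1 - |I|²) / |1 - conj α I|², which is the real part of (α
+ I) / (α - I) because |α| = 1. -/
lemma IsPolarizedClarkMeasure.isClarkMeasure {n : ℕ} {I : (Fin n → ℂ) → ℂ} {α : Circle}
    {σ : Measure (Torus n)} (hI : ∀ z ∈ polydisc n, ‖I z‖ < 1)
    (h : IsPolarizedClarkMeasure I α σ) : IsClarkMeasure I α σ := by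
  refine ⟨h.1, fun z hz => ?_⟩
  have h0 : cauchyKernel z z ≠ 0 :=
    cauchyKernel_ne_zero fun j => one_sub_mul_conj_ne_zero (hz j) (hz j).le
  have h1 : 1 - (α : ℂ) * conj (I z) ≠ 0 := one_sub_mul_conj_ne_zero' (norm_circle_le α) (hI z hz)
  have h2 : 1 - conj (α : ℂ) * I z ≠ 0 := by
    rw [mul_comm]; exact one_sub_mul_conj_ne_zero (hI z hz) (norm_circle_le α)
  have hα := circle_mul_conj α
  have hα0 := Circle.coe_ne_zero α
  have h3 : (α : ℂ) - I z ≠ 0 := by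
    have : (α : ℂ) - I z = α * (1 - conj (α : ℂ) * I z) := by linear_combination I z * hα
    rw [this]; exact mul_ne_zero hα0 h2
  have h4 : conj (α : ℂ) - conj (I z) ≠ 0 := by
    rw [← map_sub]; exact (map_ne_zero _).2 h3
  have hP : ∫ ζ, poissonKernel z ζ ∂σ =
      (∫ ζ, cauchyKernel z ζ.toComplex * cauchyKernel ζ.toComplex z ∂σ) / cauchyKernel z z := by
    rw [← integral_div]; rfl
  have h5 : ∫ ζ, cauchyKernel z ζ.toComplex * cauchyKernel ζ.toComplex z ∂σ =
      (1 - I z * conj (I z)) * cauchyKernel z z /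
        ((1 - α * conj (I z)) * (1 - conj (α : ℂ) * I z)) := by
    rw [eq_div_iff (mul_ne_zero h1 h2), ← h.2 z hz z hz]; ring
  rw [hP, h5, Complex.re_eq_add_conj, map_div₀, map_add, map_sub]
  rw [mul_div_right_comm, mul_div_assoc, div_self h0, mul_one, div_add_div _ _ h3 h4, div_div,
    div_eq_div_iff (mul_ne_zero h1 h2) (mul_ne_zero (mul_ne_zero h3 h4) two_ne_zero)]
  have e1 : (1 - (α : ℂ) * conj (I z)) * (1 - conj (α : ℂ) * I z) =
      (α - I z) * (conj (α : ℂ) - conj (I z)) := by linear_combination (I z * conj (I z) - 1) * hα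
  rw [e1]
  linear_combination (-2 * (α - I z) * (conj (α : ℂ) - conj (I z))) * hα

lemma clarkMeasure_eq {n : ℕ} {I : (Fin n → ℂ) → ℂ} {α : Circle} {σ : Measure (Torus n)}
    (hI : IsInner I) (h : IsPolarizedClarkMeasure I α σ) : clarkMeasure I α = σ := by
  have h1 : ∃ σ, IsClarkMeasure I α σ := ⟨σ, h.isClarkMeasure hI.2.1⟩
  rw [clarkMeasure, dif_pos h1]
  exact h1.choose_spec.unique (h.isClarkMeasure hI.2.1)

/-- At z = w = 0 the right-hand side is 1 - |I(0)|², which is nonzero. -/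
lemma IsPolarizedClarkMeasure.ne_zero {n : ℕ} {I : (Fin n → ℂ) → ℂ} {α : Circle}
    {σ : Measure (Torus n)} (hI : IsInner I) (h : IsPolarizedClarkMeasure I α σ) : σ ≠ 0 := by
  rintro rfl
  have h0 : (0 : Fin n → ℂ) ∈ polydisc n := fun j => by simp
  have := h.2 0 h0 0 h0
  rw [integral_zero_measure, mul_zero, eq_comm] at this
  refine mul_ne_zero ?_ ?_ this
  · exact one_sub_mul_conj_ne_zero (hI.2.1 0 h0) (hI.2.1 0 h0).le
  · exact cauchyKernel_ne_zero fun j => by simp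

/-! ### Operators prescribed on a total family in a Hilbert space -/

section Hilbert

variable {ι V H : Type*} [NormedAddCommGroup V] [InnerProductSpace ℂ V] [CompleteSpace V]
  [NormedAddCommGroup H] [InnerProductSpace ℂ H]

lemma denseRange_linearCombination {k : ι → V} (hk : ∀ f : V, (∀ i, inner ℂ (k i) f = 0) → f = 0) :
    DenseRange (Finsupp.linearCombination ℂ k) := by
  have h : (LinearMap.range (Finsupp.linearCombination ℂ k)).topologicalClosure = ⊤ := by
    rw [Submodule.topologicalClosure_eq_top_iff, Submodule.eq_bot_iff]
    intro f hf
    refine hk f fun i => hf (k i) ⟨Finsupp.single i 1, by simp⟩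
  exact (Submodule.dense_iff_topologicalClosure_eq_top).2 h

/-- Equal Gram matrices give equal norms to corresponding finite linear combinations, so the
assignment is well defined and isometric on a dense subspace and extends by continuity. -/
lemma exists_isometry_of_inner_eq [CompleteSpace H] {k : ι → V} {g : ι → H}
    (hk : ∀ f : V, (∀ i, inner ℂ (k i) f = 0) → f = 0)
    (hkg : ∀ i j, inner ℂ (k i) (k j) = inner ℂ (g i) (g j)) :
    ∃ T : V →L[ℂ] H, (∀ f, ‖T f‖ = ‖f‖) ∧ ∀ i, T (k i) = g i := by
  have hd := denseRange_linearCombination hk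
  have hn : ∀ c, ‖Finsupp.linearCombination ℂ g c‖ = ‖Finsupp.linearCombination ℂ k c‖ := by
    intro c
    have h1 : inner ℂ (Finsupp.linearCombination ℂ g c) (Finsupp.linearCombination ℂ g c) =
        inner ℂ (Finsupp.linearCombination ℂ k c) (Finsupp.linearCombination ℂ k c) := by
      simp only [Finsupp.linearCombination_apply, Finsupp.sum, sum_inner, inner_sum,
        inner_smul_left, inner_smul_right, hkg]
    rw [inner_self_eq_norm_sq_to_K, inner_self_eq_norm_sq_to_K] at h1
    have h2 : ‖Finsupp.linearCombination ℂ g c‖ ^ 2 = ‖Finsupp.linearCombination ℂ k c‖ ^ 2 := by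
      exact_mod_cast h1
    exact (sq_eq_sq₀ (norm_nonneg _) (norm_nonneg _)).1 h2
  have hb : ∃ C : ℝ, ∀ c, ‖Finsupp.linearCombination ℂ g c‖ ≤
      C * ‖Finsupp.linearCombination ℂ k c‖ := ⟨1, fun c => by rw [hn, one_mul]⟩
  set T := (Finsupp.linearCombination ℂ g).extendOfNorm (Finsupp.linearCombination ℂ k) with hT
  have hTe : ∀ c, T (Finsupp.linearCombination ℂ k c) = Finsupp.linearCombination ℂ g c :=
    LinearMap.extendOfNorm_eq hd hb
  refine ⟨T, fun f => ?_, fun i => by simpa using hTe (Finsupp.single i 1)⟩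
  refine hd.induction_on (p := fun f => ‖T f‖ = ‖f‖) f
    (isClosed_eq (by fun_prop) (by fun_prop)) fun c => ?_
  rw [hTe, hn]

lemma continuousLinearMap_eq_of_total {k : ι → V}
    (hk : ∀ f : V, (∀ i, inner ℂ (k i) f = 0) → f = 0) {S T : V →L[ℂ] H}
    (h : ∀ i, S (k i) = T (k i)) : S = T := by
  have hd := denseRange_linearCombination hk
  ext f
  refine hd.induction_on (p := fun f => S f = T f) f
    (isClosed_eq (by fun_prop) (by fun_prop)) fun c => ?_
  simp [Finsupp.linearCombination_apply, Finsupp.sum, h]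

/-- The range of an isometry on a complete space is closed, and a trivial orthogonal complement
makes it dense. -/
lemma isUnitaryOperator_of_total [CompleteSpace H] {T : V →L[ℂ] H} (hT : ∀ f, ‖T f‖ = ‖f‖)
    (h : ∀ g : H, (∀ f, inner ℂ (T f) g = 0) → g = 0) : IsUnitaryOperator T := by
  let L : V →ₗᵢ[ℂ] H := ⟨T.toLinearMap, hT⟩
  have hcl : IsClosed (LinearMap.range L.toLinearMap : Set H) :=
    L.isometry.isClosedEmbedding.isClosed_range
  have hs : Function.Surjective L := by
    have h1 : (LinearMap.range L.toLinearMap).topologicalClosure = ⊤ := by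
      rw [Submodule.topologicalClosure_eq_top_iff, Submodule.eq_bot_iff]
      exact fun g hg => h g fun f => hg (T f) ⟨f, rfl⟩
    rw [hcl.submodule_topologicalClosure_eq] at h1
    exact LinearMap.range_eq_top.1 h1
  exact ⟨LinearIsometryEquiv.ofSurjective L hs, fun x => rfl⟩

end Hilbert

/-- The functions `ξ ↦ (1 - α conj(I(w))) C(ξ, w)` as elements of `L²(σ)`. -/
lemma memLp_clarkKernel {n : ℕ} (I : (Fin n → ℂ) → ℂ) (α : Circle) (σ : Measure (Torus n))
    [IsFiniteMeasure σ] {w : Fin n → ℂ} (hw : w ∈ polydisc n) :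
    MemLp (fun ξ : Torus n => (1 - α * conj (I w)) * cauchyKernel ξ.toComplex w) 2 σ :=
  memLp_of_continuous (continuous_const.mul (continuous_cauchyKernel_left hw)) 2

lemma modelKernel_total {n : ℕ} {I : (Fin n → ℂ) → ℂ} (hI : IsInner I)
    {k : polydisc n → modelSpace I}
    (hk : ∀ w : polydisc n, HasBoundaryValue (modelKernel I w) (k w : Lp ℂ 2 (torusMeasure n)))
    (f : modelSpace I) (hf : ∀ w, inner ℂ (k w : Lp ℂ 2 (torusMeasure n)) f = 0) : f = 0 := by
  refine modelSpace_eq_zero hI f fun w hw k' hk' => ?_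
  have : k' = k ⟨w, hw⟩ :=
    Subtype.ext (hk'.unique (differentiableOn_modelKernel hI hw) (hk ⟨w, hw⟩))
  rw [this]; exact hf ⟨w, hw⟩

/-- The reproducing property gives ⟨k_z, k_w⟩ = K_w(z), and the polarized identity equates this with
the inner product of the prescribed images. -/
lemma existsUnique_isClarkOperator {n : ℕ} {I : (Fin n → ℂ) → ℂ} {α : Circle} (hI : IsInner I)
    (h : IsPolarizedClarkMeasure I α (clarkMeasure I α)) : ∃! T, IsClarkOperator I α T := by
  have := h.1
  choose k hk using fun w : polydisc n => exists_modelKernel_mem hI w.2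
  let g (w : polydisc n) : Lp ℂ 2 (clarkMeasure I α) :=
    (memLp_clarkKernel I α (clarkMeasure I α) w.2).toLp _
  have hkg : ∀ z w, inner ℂ (k z) (k w) = inner ℂ (g z) (g w) := by
    intro z w
    rw [Submodule.coe_inner, inner_modelKernel_of_mem hI z.2 (hk z) (k w).2
      (differentiableOn_modelKernel hI w.2) (hk w), modelKernel, ← h.2 z z.2 w w.2,
      ← integral_const_mul, L2.inner_def]
    refine integral_congr_ae ?_
    filter_upwards [(memLp_clarkKernel I α (clarkMeasure I α) z.2).coeFn_toLp,
      (memLp_clarkKernel I α (clarkMeasure I α) w.2).coeFn_toLp] with ξ hz hw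
    rw [hz, hw, RCLike.inner_apply]
    simp only [map_mul, map_sub, map_one, Complex.conj_conj, conj_cauchyKernel]
    ring
  obtain ⟨T, hT, hTk⟩ := exists_isometry_of_inner_eq (modelKernel_total hI hk) hkg
  refine ⟨T, ⟨hT, fun w hw => ⟨k ⟨w, hw⟩, hk ⟨w, hw⟩, ?_⟩⟩, fun S hS => ?_⟩
  · rw [hTk]
    exact (memLp_clarkKernel I α (clarkMeasure I α) hw).coeFn_toLp
  · refine continuousLinearMap_eq_of_total (modelKernel_total hI hk) fun w => ?_
    obtain ⟨k', hk', hSk⟩ := hS.2 w w.2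
    have : k' = k w :=
      Subtype.ext (hk'.unique (differentiableOn_modelKernel hI w.2) (hk w))
    rw [hTk, ← this]
    exact Lp.ext (hSk.trans (memLp_clarkKernel I α (clarkMeasure I α) w.2).coeFn_toLp.symm)

lemma hasClarkTheory {n : ℕ} {I : (Fin n → ℂ) → ℂ} (hI : IsInner I)
    (h : ∀ α, ∃ σ, IsPolarizedClarkMeasure I α σ) : HasClarkTheory I := by
  refine ⟨hI, fun α => ?_⟩
  obtain ⟨σ, hσ⟩ := h α
  refine ⟨⟨σ, hσ.isClarkMeasure hI.2.1, fun τ hτ => hτ.unique (hσ.isClarkMeasure hI.2.1)⟩, ?_⟩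
  refine existsUnique_isClarkOperator hI ?_
  rwa [clarkMeasure_eq hI hσ]

lemma isClarkOperator_clarkOperator {n : ℕ} {I : (Fin n → ℂ) → ℂ} {α : Circle} (hI : IsInner I)
    (h : IsPolarizedClarkMeasure I α (clarkMeasure I α)) :
    IsClarkOperator I α (clarkOperator I α) := by
  have h1 := (existsUnique_isClarkOperator hI h).exists
  rw [clarkOperator, dif_pos h1]
  exact h1.choose_spec

/-- The Clark operator is unitary if the Cauchy kernels are total in `L²` of the Clark measure. -/
lemma isUnitaryOperator_clarkOperator {n : ℕ} {I : (Fin n → ℂ) → ℂ} {α : Circle}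
    {σ : Measure (Torus n)} (hI : IsInner I) (h : IsPolarizedClarkMeasure I α σ)
    (htot : ∀ f : Lp ℂ 2 σ, (∀ w ∈ polydisc n,
      ∫ ξ, cauchyKernel ξ.toComplex w * conj (f ξ) ∂σ = 0) → f = 0) :
    IsUnitaryOperator (clarkOperator I α) := by
  obtain rfl := clarkMeasure_eq hI h
  have hT := isClarkOperator_clarkOperator hI h
  refine isUnitaryOperator_of_total hT.1 fun g hg => htot g fun w hw => ?_
  obtain ⟨k, -, hk⟩ := hT.2 w hw
  have h1 : 1 - (α : ℂ) * conj (I w) ≠ 0 :=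
    one_sub_mul_conj_ne_zero' (norm_circle_le α) (hI.2.1 w hw)
  refine (mul_eq_zero.1 ?_).resolve_left h1
  have h2 : inner ℂ g (clarkOperator I α k) = 0 := by
    rw [← inner_conj_symm, hg k, map_zero]
  rw [← integral_const_mul, ← h2, L2.inner_def]
  refine integral_congr_ae ?_
  filter_upwards [hk] with ξ hξ
  rw [hξ, RCLike.inner_apply]; ring

/-- If the operator were unitary, a preimage of conj g would be orthogonal to every kernel and hence
zero. Then g = 0 almost everywhere, which for a nowhere vanishing g forces the Clark measure to be
zero. -/
lemma not_isUnitaryOperator_clarkOperator {n : ℕ} {I : (Fin n → ℂ) → ℂ} {α : Circle}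
    {σ : Measure (Torus n)} (hI : IsInner I) (h : IsPolarizedClarkMeasure I α σ)
    {g : Torus n → ℂ} (hg : Continuous g) (hg1 : ∀ ξ, g ξ ≠ 0)
    (hgw : ∀ w ∈ polydisc n, ∫ ξ, cauchyKernel ξ.toComplex w * g ξ ∂σ = 0) :
    ¬ IsUnitaryOperator (clarkOperator I α) := by
  rintro ⟨U, hU⟩
  obtain rfl := clarkMeasure_eq hI h
  have := h.1
  have hT := isClarkOperator_clarkOperator hI h
  have hgm : MemLp (fun ξ => conj (g ξ)) 2 (clarkMeasure I α) :=
    memLp_of_continuous (Complex.continuous_conj.comp hg) 2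
  obtain ⟨x, hx⟩ := U.surjective (hgm.toLp _)
  have hx0 : x = 0 := by
    refine modelSpace_eq_zero hI x fun w hw k hk => ?_
    obtain ⟨k', hk', hTk⟩ := hT.2 w hw
    have hkk : k = k' := Subtype.ext (hk.unique (differentiableOn_modelKernel hI hw) hk')
    have hin : inner ℂ x k = inner ℂ (U x) (U k) := (U.inner_map_map x k).symm
    refine inner_eq_zero_symm.1 ?_
    rw [← Submodule.coe_inner, hin, hU k, hx, hkk, L2.inner_def]
    have h1 := hgw w hw
    rw [← mul_zero (1 - (α : ℂ) * conj (I w)), ← h1, ← integral_const_mul]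
    refine integral_congr_ae ?_
    filter_upwards [hTk, hgm.coeFn_toLp] with ξ h2 h3
    rw [h2, h3, RCLike.inner_apply, Complex.conj_conj]; ring
  have h0 : hgm.toLp _ = 0 := by rw [← hx, hx0, map_zero]
  have h1 : ∀ᵐ ξ ∂clarkMeasure I α, False := by
    filter_upwards [hgm.coeFn_toLp, Lp.coeFn_zero ℂ 2 (clarkMeasure I α)] with ξ h2 h3
    rw [h0] at h2
    exact hg1 ξ (by simpa using h2.symm.trans h3)
  rw [eventually_false_iff_eq_bot, ae_eq_bot] at h1
  exact h.ne_zero hI h1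

/-! ### Functions holomorphic past the closed polydisc as superpositions of Cauchy kernels -/

lemma continuous_cauchyKernel_dilate {n : ℕ} {r : ℝ} (hr : r ∈ Set.Ioo (0 : ℝ) 1) :
    Continuous fun p : Torus n × Torus n => cauchyKernel ((r : ℂ) • p.1.toComplex) p.2.toComplex := by
  have hz : ∀ (ζ : Torus n) j, ‖((r : ℂ) • ζ.toComplex) j‖ < 1 := fun ζ => dilate_mem hr ζ
  simp only [cauchyKernel, Pi.smul_apply, smul_eq_mul, Torus.toComplex] at hz ⊢
  refine continuous_finsetProd _ fun j _ => Continuous.div (by fun_prop) (by fun_prop) fun p => ?_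
  exact one_sub_mul_conj_ne_zero (hz p.1 j) (norm_circle_le _)

/-- A function orthogonal to the Cauchy kernels is orthogonal to the functions holomorphic on a
neighbourhood of the closed polydisc. -/
lemma integral_mul_conj_eq_zero {n : ℕ} {σ : Measure (Torus n)} [IsFiniteMeasure σ]
    {f : Torus n → ℂ} (hf : Integrable f σ)
    (h : ∀ w ∈ polydisc n, ∫ ξ, cauchyKernel ξ.toComplex w * f ξ ∂σ = 0)
    {R : ℝ} (hR : 1 < R) {F : (Fin n → ℂ) → ℂ}
    (hF : DifferentiableOn ℂ F (polydiscOfRadius n R)) :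
    ∫ ξ, F ξ.toComplex * f ξ ∂σ = 0 := by
  obtain ⟨t, ht, ht1⟩ := exists_between (inv_lt_one_of_one_lt₀ hR)
  have hR0 : 0 < R := zero_lt_one.trans hR
  have ht0 : 0 < t := (inv_pos.2 hR0).trans ht
  have htR : 1 < t * R := by
    calc 1 = R⁻¹ * R := (inv_mul_cancel₀ hR0.ne').symm
      _ < t * R := by gcongr
  have htI : t ∈ Set.Ioo (0 : ℝ) 1 := ⟨ht0, ht1⟩
  have hd : DifferentiableOn ℂ (fun z => F ((t⁻¹ : ℂ) • z)) (polydiscOfRadius n (t * R)) := by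
    refine hF.comp (g := F) (by fun_prop) fun z hz j => ?_
    rw [Pi.smul_apply, norm_smul, norm_inv, Complex.norm_real, Real.norm_of_nonneg ht0.le]
    calc t⁻¹ * ‖z j‖ < t⁻¹ * (t * R) := by gcongr; exact hz j
      _ = R := by field_simp
  -- With R⁻¹ < t < 1, the function F(t⁻¹ ·) is still holomorphic past the closed polydisc. The
  -- Cauchy formula at tξ, with C(tξ,η) = C(ξ,tη), writes F as a superposition of kernels with poles
  -- indexed by interior points.
  have hrep : ∀ ξ : Torus n, F ξ.toComplex = ∫ η : Torus n, F ((t⁻¹ : ℂ) • η.toComplex) *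
      cauchyKernel ((t : ℂ) • ξ.toComplex) η.toComplex ∂torusMeasure n := by
    intro ξ
    rw [integral_cauchy htR hd (dilate_mem htI ξ), smul_smul,
      inv_mul_cancel₀ (Complex.ofReal_ne_zero.2 ht0.ne'), one_smul]
  have hc : Continuous fun p : Torus n × Torus n => F ((t⁻¹ : ℂ) • p.2.toComplex) *
      cauchyKernel ((t : ℂ) • p.1.toComplex) p.2.toComplex :=
    ((hd.continuousOn.comp_continuous continuous_toComplex (toComplex_mem htR)).comp
      continuous_snd).mul (continuous_cauchyKernel_dilate htI)
  obtain ⟨C, hC⟩ := (isCompact_range hc).isBounded.exists_norm_le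
  calc ∫ ξ, F ξ.toComplex * f ξ ∂σ
      = ∫ ξ, ∫ η : Torus n, F ((t⁻¹ : ℂ) • η.toComplex) *
          cauchyKernel ((t : ℂ) • ξ.toComplex) η.toComplex * f ξ ∂torusMeasure n ∂σ := by
        simp only [integral_mul_const, ← hrep]
    _ = ∫ η : Torus n, ∫ ξ, F ((t⁻¹ : ℂ) • η.toComplex) *
          cauchyKernel ((t : ℂ) • ξ.toComplex) η.toComplex * f ξ ∂σ ∂torusMeasure n := by
        refine integral_integral_swap ?_
        exact (hf.comp_fst (torusMeasure n)).bdd_mul (c := C) hc.aestronglyMeasurable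
          (Eventually.of_forall fun p => hC _ (Set.mem_range_self p))
    _ = 0 := by
        simp only [mul_assoc, integral_const_mul, cauchyKernel_smul]
        simp only [h _ (dilate_mem htI _), mul_zero, integral_zero]

/-! ### Functions of one variable -/

lemma diffContOnCl_of_differentiableAt {F : ℂ → ℂ} (h : ∀ ξ : ℂ, ‖ξ‖ ≤ 1 → DifferentiableAt ℂ F ξ) :
    DiffContOnCl ℂ F (Metric.ball 0 1) := by
  refine DifferentiableOn.diffContOnCl fun ξ hξ => (h ξ ?_).differentiableWithinAt
  rwa [closure_ball _ one_ne_zero, mem_closedBall_zero_iff] at hξ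

lemma continuous_one_div_left {w : ℂ} (hw : ‖w‖ < 1) :
    Continuous fun ξ : Circle => 1 / (1 - (ξ : ℂ) * conj w) :=
  continuous_const.div (by fun_prop) fun ξ => one_sub_mul_conj_ne_zero' (norm_circle_le ξ) hw

lemma continuous_one_div_right {z : ℂ} (hz : ‖z‖ < 1) :
    Continuous fun ξ : Circle => 1 / (1 - z * conj (ξ : ℂ)) :=
  continuous_const.div (by fun_prop) fun ξ => one_sub_mul_conj_ne_zero hz (norm_circle_le ξ)

/-- Partial fractions for the product of two Cauchy kernels on the circle. -/
lemma one_div_mul_one_div_circle {z w : ℂ} (hz : ‖z‖ < 1) (hw : ‖w‖ < 1) (ξ : Circle) :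
    1 / (1 - z * conj (ξ : ℂ)) * (1 / (1 - ξ * conj w)) = 1 / (1 - z * conj w) *
      (1 / (1 - z * conj (ξ : ℂ)) + 1 / (1 - ξ * conj w) - 1) := by
  have h1 := one_sub_mul_conj_ne_zero hz (norm_circle_le ξ)
  have h2 := one_sub_mul_conj_ne_zero' (norm_circle_le ξ) hw
  have h3 := one_sub_mul_conj_ne_zero hz hw.le
  have hξ := circle_mul_conj ξ
  field_simp
  linear_combination (z * conj w) * hξ

lemma integral_one_div_mul_one_div_circle {z w : ℂ} (hz : ‖z‖ < 1) (hw : ‖w‖ < 1) :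
    ∫ ξ : Circle, 1 / (1 - z * conj (ξ : ℂ)) * (1 / (1 - ξ * conj w)) ∂circleMeasure =
      1 / (1 - z * conj w) := by
  have h := integral_cauchy_circle (differentiable_pow_div hw 0) hz
  simp only [pow_zero, one_mul] at h
  rw [← h]
  congr 1; funext ξ; ring

lemma integral_one_div_circle {z : ℂ} (hz : ‖z‖ < 1) :
    ∫ ξ : Circle, 1 / (1 - z * conj (ξ : ℂ)) ∂circleMeasure = 1 := by
  simpa using integral_one_div_mul_one_div_circle hz (w := 0) (by simp)

/-- The integrand is holomorphic past the closed disc and vanishes at the origin. This is the source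
of both counterexamples to surjectivity. -/
lemma integral_id_div_circle {w : ℂ} (hw : ‖w‖ < 1) :
    ∫ ξ : Circle, 1 / (1 - (ξ : ℂ) * conj w) * ξ ∂circleMeasure = 0 := by
  have h := integral_circle_eq (differentiable_pow_div hw 1)
  simp only [pow_one, zero_mul] at h
  rw [← h]
  congr 1; funext ξ; ring

/-! ### The coordinate function -/

lemma isInner_coordinateInner (n : ℕ) (hn : 2 ≤ n) : IsInner (coordinateInner n hn) := by
  unfold coordinateInner
  refine ⟨by fun_prop, fun z hz => hz _, Eventually.of_forall fun ζ => ?_⟩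
  exact ⟨_, norm_toComplex ζ ⟨0, by omega⟩,
    ((continuous_apply _).tendsto _).comp (tendsto_smul_toComplex ζ)⟩

/-- The product of a point mass in the first variable and Lebesgue measures. -/
def coordinateClark (n : ℕ) (hn : 2 ≤ n) (α : Circle) : Measure (Torus n) :=
  Measure.pi (Function.update (fun _ : Fin n => circleMeasure) ⟨0, by omega⟩ (Measure.dirac α))

instance instIsProbabilityMeasureUpdate {n : ℕ} (i j : Fin n) (α : Circle) :
    IsProbabilityMeasure
      (Function.update (fun _ : Fin n => circleMeasure) i (Measure.dirac α) j) := by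
  by_cases h : j = i
  · subst h; rw [Function.update_self]; infer_instance
  · rw [Function.update_of_ne h]; infer_instance

/-- The integral factorizes over the coordinates: each Lebesgue factor gives 1 / (1 - zⱼ conj wⱼ),
and the point mass gives exactly the reciprocal of the two prefactors. -/
lemma isPolarizedClarkMeasure_coordinateInner (n : ℕ) (hn : 2 ≤ n) (α : Circle) :
    IsPolarizedClarkMeasure (coordinateInner n hn) α (coordinateClark n hn α) := by
  refine ⟨by unfold coordinateClark; infer_instance, fun z hz w hw => ?_⟩
  set i : Fin n := ⟨0, by omega⟩
  have hprod : ∀ ξ : Torus n, cauchyKernel z ξ.toComplex * cauchyKernel ξ.toComplex w =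
      ∏ j, 1 / (1 - z j * conj (ξ j : ℂ)) * (1 / (1 - ξ j * conj (w j))) := fun ξ => by
    rw [cauchyKernel, cauchyKernel, ← Finset.prod_mul_distrib]; rfl
  simp only [hprod, coordinateClark]
  rw [integral_fintype_prod_eq_prod (fun j (ξ : Circle) =>
      1 / (1 - z j * conj (ξ : ℂ)) * (1 / (1 - ξ * conj (w j)))), cauchyKernel,
    ← Finset.mul_prod_erase _ _ (Finset.mem_univ i), ← Finset.mul_prod_erase _ _ (Finset.mem_univ i)]
  have h1 : ∀ j ∈ Finset.univ.erase i, ∫ ξ : Circle, 1 / (1 - z j * conj (ξ : ℂ)) *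
      (1 / (1 - ξ * conj (w j))) ∂(Function.update (fun _ : Fin n => circleMeasure) i
        (Measure.dirac α) j) = 1 / (1 - z j * conj (w j)) := by
    intro j hj
    rw [Function.update_of_ne (Finset.ne_of_mem_erase hj)]
    exact integral_one_div_mul_one_div_circle (hz j) (hw j)
  rw [Finset.prod_congr rfl h1, Function.update_self, integral_dirac]
  have e1 := one_sub_mul_conj_ne_zero (hz i) (norm_circle_le α)
  have e2 := one_sub_mul_conj_ne_zero' (norm_circle_le α) (hw i)
  have e3 := one_sub_mul_conj_ne_zero (hz i) (hw i).le
  change (1 - α * conj (w i)) * (1 - conj (α : ℂ) * z i) * _ = (1 - z i * conj (w i)) * _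
  have e : (1 - α * conj (w i)) * (1 - conj (α : ℂ) * z i) *
      (1 / (1 - z i * conj (α : ℂ)) * (1 / (1 - α * conj (w i)))) =
      (1 - z i * conj (w i)) * (1 / (1 - z i * conj (w i))) := by
    rw [mul_one_div_cancel e3, mul_comm (conj (α : ℂ))]
    field_simp
  linear_combination (∏ j ∈ Finset.univ.erase i, 1 / (1 - z j * conj (w j))) * e

/-- The second variable carries Lebesgue measure, and its factor has mean value zero. -/
lemma integral_coordinateClark (n : ℕ) (hn : 2 ≤ n) (α : Circle) {w : Fin n → ℂ}
    (hw : w ∈ polydisc n) :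
    ∫ ξ : Torus n, cauchyKernel ξ.toComplex w * (ξ ⟨1, by omega⟩ : ℂ)
      ∂coordinateClark n hn α = 0 := by
  set i : Fin n := ⟨1, by omega⟩ with hi
  have hprod : ∀ ξ : Torus n, cauchyKernel ξ.toComplex w * (ξ i : ℂ) =
      ∏ j, 1 / (1 - ξ j * conj (w j)) * (if j = i then (ξ j : ℂ) else 1) := fun ξ => by
    rw [Finset.prod_mul_distrib, Finset.prod_ite_eq' Finset.univ i, if_pos (Finset.mem_univ i)]
    rfl
  simp only [hprod, coordinateClark]
  rw [integral_fintype_prod_eq_prod (fun j (ξ : Circle) =>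
      1 / (1 - (ξ : ℂ) * conj (w j)) * (if j = i then (ξ : ℂ) else 1))]
  refine Finset.prod_eq_zero (Finset.mem_univ i) ?_
  have h : i ≠ ⟨0, by omega⟩ := by simp [hi]
  simp only [if_true, Function.update_of_ne h]
  exact integral_id_div_circle (hw i)

/-! ### Two variables -/

lemma continuous_mixed {u v : ℂ} (hu : ‖u‖ < 1) (hv : ‖v‖ < 1) :
    Continuous fun ξ : Torus 2 => (1 / (1 - (ξ 0 : ℂ) * conj u) - 1) *
      (1 / (1 - v * conj (ξ 1 : ℂ)) - 1) :=
  (((continuous_one_div_left hu).comp (continuous_apply 0)).sub continuous_const).mul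
    (((continuous_one_div_right hv).comp (continuous_apply 1)).sub continuous_const)

/-- A criterion for the polarized identity on the bidisc, in terms of the Cauchy transform of the
measure and of its coefficients of mixed sign. -/
lemma isPolarizedClarkMeasure_of_bidisc {I : (Fin 2 → ℂ) → ℂ} (hI0 : I 0 = 0) {α : Circle}
    {σ : Measure (Torus 2)} [IsFiniteMeasure σ]
    (hmain : ∀ z ∈ polydisc 2,
      (1 - conj (α : ℂ) * I z) * ∫ ξ, cauchyKernel z ξ.toComplex ∂σ = 1)
    (hmix : ∀ u v : ℂ, ‖u‖ < 1 → ‖v‖ < 1 → ∫ ξ, (1 / (1 - (ξ 0 : ℂ) * conj u) - 1) *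
      (1 / (1 - v * conj (ξ 1 : ℂ)) - 1) ∂σ = 0) :
    IsPolarizedClarkMeasure I α σ := by
  refine ⟨inferInstance, fun z hz w hw => ?_⟩
  -- The opposite mixed sign comes from conjugation, since σ is a positive measure.
  have hmix' : ∫ ξ, (1 / (1 - z 0 * conj (ξ 0 : ℂ)) - 1) *
      (1 / (1 - (ξ 1 : ℂ) * conj (w 1)) - 1) ∂σ = 0 := by
    have h := congrArg conj (hmix (z 0) (w 1) (hz 0) (hw 1))
    rw [← integral_conj, map_zero] at h
    simp only [map_mul, map_sub, map_div₀, map_one, Complex.conj_conj] at h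
    simpa only [mul_comm] using h
  have hw1 : (1 - α * conj (I w)) * ∫ ξ, cauchyKernel ξ.toComplex w ∂σ = 1 := by
    have h := congrArg conj (hmain w hw)
    rw [map_mul, ← integral_conj] at h
    simpa only [map_mul, map_sub, map_one, Complex.conj_conj, conj_cauchyKernel] using h
  -- The Cauchy transform at the origin, with I(0) = 0, shows that σ has mass one.
  have h1 : ∫ _ : Torus 2, (1 : ℂ) ∂σ = 1 := by
    have h := hmain 0 fun j => by simp
    simpa [hI0, cauchyKernel] using h
  -- With aⱼ = 1/(1 - zⱼ conj ξⱼ) and bⱼ = 1/(1 - ξⱼ conj wⱼ), partial fractions give C(z,w) (a₀ +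
  -- b₀ - 1)(a₁ + b₁ - 1). This is regrouped into the two full Cauchy kernels a₀a₁ and b₀b₁, the
  -- mixed products, and the constant -1.
  have hpt : ∀ ξ : Torus 2, cauchyKernel z ξ.toComplex * cauchyKernel ξ.toComplex w =
      cauchyKernel z w * (cauchyKernel z ξ.toComplex + cauchyKernel ξ.toComplex w +
        (1 / (1 - z 0 * conj (ξ 0 : ℂ)) - 1) * (1 / (1 - (ξ 1 : ℂ) * conj (w 1)) - 1) +
        (1 / (1 - (ξ 0 : ℂ) * conj (w 0)) - 1) * (1 / (1 - z 1 * conj (ξ 1 : ℂ)) - 1) - 1) := by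
    intro ξ
    have e0 := one_div_mul_one_div_circle (hz 0) (hw 0) (ξ 0)
    have e1 := one_div_mul_one_div_circle (hz 1) (hw 1) (ξ 1)
    simp only [cauchyKernel, Fin.prod_univ_two, Torus.toComplex]
    generalize 1 / (1 - z 0 * conj (ξ 0 : ℂ)) = a0 at *
    generalize 1 / (1 - z 1 * conj (ξ 1 : ℂ)) = a1 at *
    generalize 1 / (1 - (ξ 0 : ℂ) * conj (w 0)) = b0 at *
    generalize 1 / (1 - (ξ 1 : ℂ) * conj (w 1)) = b1 at *
    generalize 1 / (1 - z 0 * conj (w 0)) = c0 at *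
    generalize 1 / (1 - z 1 * conj (w 1)) = c1 at *
    calc a0 * a1 * (b0 * b1) = (a0 * b0) * (a1 * b1) := by ring
      _ = _ := by rw [e0, e1]; ring
  have i1 : Integrable (fun ξ : Torus 2 => cauchyKernel z ξ.toComplex) σ :=
    integrable_of_continuous (continuous_cauchyKernel_right hz)
  have i2 : Integrable (fun ξ : Torus 2 => cauchyKernel ξ.toComplex w) σ :=
    integrable_of_continuous (continuous_cauchyKernel_left hw)
  have i12 : Integrable (fun ξ : Torus 2 => cauchyKernel z ξ.toComplex +
      cauchyKernel ξ.toComplex w) σ := i1.add i2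
  have i3 : Integrable (fun ξ : Torus 2 => (1 / (1 - z 0 * conj (ξ 0 : ℂ)) - 1) *
      (1 / (1 - (ξ 1 : ℂ) * conj (w 1)) - 1)) σ :=
    integrable_of_continuous
      ((((continuous_one_div_right (hz 0)).comp (continuous_apply 0)).sub continuous_const).mul
      (((continuous_one_div_left (hw 1)).comp (continuous_apply 1)).sub continuous_const))
  have i4 : Integrable (fun ξ : Torus 2 => (1 / (1 - (ξ 0 : ℂ) * conj (w 0)) - 1) *
      (1 / (1 - z 1 * conj (ξ 1 : ℂ)) - 1)) σ :=
    integrable_of_continuous (continuous_mixed (hw 0) (hz 1))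
  have i123 : Integrable (fun ξ : Torus 2 => cauchyKernel z ξ.toComplex +
      cauchyKernel ξ.toComplex w + (1 / (1 - z 0 * conj (ξ 0 : ℂ)) - 1) *
      (1 / (1 - (ξ 1 : ℂ) * conj (w 1)) - 1)) σ := i12.add i3
  have i1234 : Integrable (fun ξ : Torus 2 => cauchyKernel z ξ.toComplex +
      cauchyKernel ξ.toComplex w + (1 / (1 - z 0 * conj (ξ 0 : ℂ)) - 1) *
      (1 / (1 - (ξ 1 : ℂ) * conj (w 1)) - 1) + (1 / (1 - (ξ 0 : ℂ) * conj (w 0)) - 1) *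
      (1 / (1 - z 1 * conj (ξ 1 : ℂ)) - 1)) σ := i123.add i4
  have hint : ∫ ξ, cauchyKernel z ξ.toComplex * cauchyKernel ξ.toComplex w ∂σ =
      cauchyKernel z w * (∫ ξ, cauchyKernel z ξ.toComplex ∂σ +
        ∫ ξ, cauchyKernel ξ.toComplex w ∂σ - 1) := by
    simp only [hpt]
    rw [integral_const_mul, integral_sub i1234 (integrable_const _), h1,
      integral_add i123 i4, integral_add i12 i3, integral_add i1 i2,
      hmix', hmix _ _ (hw 0) (hz 1), add_zero, add_zero]
  rw [hint]
  have hz1 := hmain z hz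
  have hα := circle_mul_conj α
  generalize ∫ ξ, cauchyKernel z ξ.toComplex ∂σ = X at *
  generalize ∫ ξ, cauchyKernel ξ.toComplex w ∂σ = Y at *
  -- Both factors times X + Y - 1 give 1 - |α|² I(z) conj I(w), and |α| = 1.
  linear_combination (cauchyKernel z w * (1 - α * conj (I w))) * hz1 +
    (cauchyKernel z w * (1 - conj (α : ℂ) * I z)) * hw1 - (cauchyKernel z w * I z * conj (I w)) * hα

/-- The Cauchy kernels are total for a measure on the torus on which the conjugate of each
coordinate is a holomorphic function of the other one. -/
lemma total_of_conj_eq {σ : Measure (Torus 2)} [IsFiniteMeasure σ] {R : ℝ} (hR : 1 < R)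
    {p q : ℂ → ℂ} (hp : DifferentiableOn ℂ p (Metric.ball 0 R))
    (hq : DifferentiableOn ℂ q (Metric.ball 0 R))
    (hpσ : ∀ᵐ ξ : Torus 2 ∂σ, conj (ξ 0 : ℂ) = p (ξ 1))
    (hqσ : ∀ᵐ ξ : Torus 2 ∂σ, conj (ξ 1 : ℂ) = q (ξ 0)) (f : Lp ℂ 2 σ)
    (hf : ∀ w ∈ polydisc 2, ∫ ξ, cauchyKernel ξ.toComplex w * conj (f ξ) ∂σ = 0) : f = 0 := by
  have hfi : Integrable (fun ζ => conj (f ζ)) σ :=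
    Complex.conjCLE.toContinuousLinearMap.integrable_comp
      ((Lp.memLp f).integrable one_le_two)
  have hd : ∀ {g : ℂ → ℂ} (_ : DifferentiableOn ℂ g (Metric.ball 0 R)) (j : Fin 2),
      DifferentiableOn ℂ (fun z : Fin 2 → ℂ => g (z j)) (polydiscOfRadius 2 R) := fun hg j =>
    hg.comp (by fun_prop) fun z hz => by simpa using hz j
  -- A negative power of one coordinate is a positive power of its conjugate, which σ-a.e. is a
  -- holomorphic function of the other coordinate.
  have key : ∀ (k : ℤ) (i j : Fin 2) {g : ℂ → ℂ} (_ : DifferentiableOn ℂ g (Metric.ball 0 R))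
      (_ : ∀ᵐ ξ : Torus 2 ∂σ, conj (ξ i : ℂ) = g (ξ j)),
      ∃ F : (Fin 2 → ℂ) → ℂ, DifferentiableOn ℂ F (polydiscOfRadius 2 R) ∧
        ∀ᵐ ξ : Torus 2 ∂σ, (ξ i : ℂ) ^ k = F ξ.toComplex := by
    intro k i j g hg hgσ
    obtain ⟨k, rfl | rfl⟩ := k.eq_nat_or_neg
    · exact ⟨fun z => z i ^ k, by fun_prop, Eventually.of_forall fun ξ => zpow_natCast _ _⟩
    · refine ⟨fun z => g (z j) ^ k, (hd hg j).pow k, hgσ.mono fun ξ hξ => ?_⟩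
      change _ = g (ξ j : ℂ) ^ k
      rw [← hξ, star_eq_inv, zpow_neg, zpow_natCast, inv_pow]
  refine lp_eq_zero_of_integral_torusMonomial f fun k => ?_
  obtain ⟨F, hF, hFσ⟩ := key (k 0) 0 1 hp hpσ
  obtain ⟨G, hG, hGσ⟩ := key (k 1) 1 0 hq hqσ
  rw [← integral_mul_conj_eq_zero hfi hf hR (hF.mul hG)]
  refine integral_congr_ae ?_
  filter_upwards [hFσ, hGσ] with ξ h1 h2
  rw [torusMonomial_apply, Fin.prod_univ_two, h1, h2, Pi.mul_apply]

/-! ### The product of the coordinates -/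

lemma isInner_productInner : IsInner productInner := by
  unfold productInner
  refine ⟨by fun_prop, fun z hz => ?_, Eventually.of_forall fun ζ => ?_⟩
  · rw [norm_mul]
    nlinarith [hz 0, hz 1, norm_nonneg (z 0), norm_nonneg (z 1)]
  · refine ⟨ζ.toComplex 0 * ζ.toComplex 1, by simp [norm_toComplex], ?_⟩
    have h : Continuous fun z : Fin 2 → ℂ => z 0 * z 1 := by fun_prop
    exact (h.tendsto _).comp (tendsto_smul_toComplex ζ)

/-- The image of the Lebesgue measure under `ξ ↦ (ξ, α / ξ)`. -/
def productClark (α : Circle) : Measure (Torus 2) :=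
  Measure.map (fun ξ : Circle => ![ξ, α * ξ⁻¹]) circleMeasure

lemma continuous_vec2 {f g : Circle → Circle} (hf : Continuous f) (hg : Continuous g) :
    Continuous fun ξ => (![f ξ, g ξ] : Torus 2) :=
  continuous_pi fun j => by fin_cases j <;> simpa

lemma continuous_productClark_map (α : Circle) :
    Continuous fun ξ : Circle => (![ξ, α * ξ⁻¹] : Torus 2) :=
  continuous_vec2 continuous_id (by fun_prop)

instance instIsFiniteMeasureProductClark (α : Circle) : IsFiniteMeasure (productClark α) := by
  unfold productClark; infer_instance

lemma integral_productClark (α : Circle) {g : Torus 2 → ℂ} (hg : Continuous g) :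
    ∫ ξ, g ξ ∂productClark α = ∫ ξ : Circle, g ![ξ, α * ξ⁻¹] ∂circleMeasure :=
  integral_map (continuous_productClark_map α).aemeasurable hg.aestronglyMeasurable

lemma conj_mul_inv_circle (α ξ : Circle) :
    conj ((α * ξ⁻¹ : Circle) : ℂ) = conj (α : ℂ) * ξ := by
  simp [star_eq_inv, mul_comm]

/-- On the support conj ξ₂ = conj α ξ₁, so the antiholomorphic dependence on ξ₂ becomes holomorphic
in ξ₁. The Cauchy formula at z₁ gives the transform, and the mixed integrand is holomorphic and
vanishes at the origin. -/
lemma isPolarizedClarkMeasure_productInner (α : Circle) :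
    IsPolarizedClarkMeasure productInner α (productClark α) := by
  have hα : ‖conj (α : ℂ)‖ ≤ 1 := by rw [RCLike.norm_conj]; exact norm_circle_le α
  have hne : ∀ {v ξ : ℂ}, ‖v‖ < 1 → ‖ξ‖ ≤ 1 → 1 - v * (conj (α : ℂ) * ξ) ≠ 0 := by
    intro v ξ hv hξ
    refine one_sub_ne_zero hv ?_
    rw [norm_mul]
    exact mul_le_one₀ hα (norm_nonneg _) hξ
  refine isPolarizedClarkMeasure_of_bidisc (by simp [productInner]) (fun z hz => ?_)
    fun u v hu hv => ?_
  · rw [integral_productClark α (continuous_cauchyKernel_right hz)]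
    have hd : DiffContOnCl ℂ (fun ξ : ℂ => 1 / (1 - z 1 * (conj (α : ℂ) * ξ)))
        (Metric.ball 0 1) := by
      refine diffContOnCl_of_differentiableAt fun ξ hξ => ?_
      have := hne (hz 1) hξ
      fun_prop (disch := assumption)
    have h := integral_cauchy_circle hd (hz 0)
    have h2 : ∀ ξ : Circle, cauchyKernel z (Torus.toComplex ![ξ, α * ξ⁻¹]) =
        1 / (1 - z 1 * (conj (α : ℂ) * ξ)) * (1 / (1 - z 0 * conj (ξ : ℂ))) := by
      intro ξ
      simp only [cauchyKernel, Fin.prod_univ_two, Torus.toComplex, Matrix.cons_val_zero,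
        Matrix.cons_val_one, conj_mul_inv_circle]
      ring
    have h3 := hne (hz 1) (hz 0).le
    have h4 : 1 - conj (α : ℂ) * productInner z = 1 - z 1 * (conj (α : ℂ) * z 0) := by
      rw [productInner]; ring
    simp only [h2]
    rw [h, h4, mul_one_div, div_self h3]
  · rw [integral_productClark α (continuous_mixed hu hv)]
    have hd : DiffContOnCl ℂ (fun ξ : ℂ => (1 / (1 - ξ * conj u) - 1) *
        (1 / (1 - v * (conj (α : ℂ) * ξ)) - 1)) (Metric.ball 0 1) := by
      refine diffContOnCl_of_differentiableAt fun ξ hξ => ?_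
      have h1 := hne hv hξ
      have h2 := one_sub_mul_conj_ne_zero' hξ hu
      fun_prop (disch := assumption)
    have h := integral_circle_eq hd
    simp only [Matrix.cons_val_zero, Matrix.cons_val_one, conj_mul_inv_circle]
    rw [h]; simp

lemma total_productClark (α : Circle) (f : Lp ℂ 2 (productClark α))
    (hf : ∀ w ∈ polydisc 2,
      ∫ ξ, cauchyKernel ξ.toComplex w * conj (f ξ) ∂productClark α = 0) : f = 0 := by
  have hα := circle_mul_conj α
  have hm : ∀ {p : Torus 2 → Prop}, IsClosed {ξ | p ξ} → (∀ ξ : Circle, p ![ξ, α * ξ⁻¹]) →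
      ∀ᵐ ξ ∂productClark α, p ξ := fun hp h =>
    (ae_map_iff (continuous_productClark_map α).aemeasurable hp.measurableSet).2
      (Eventually.of_forall h)
  refine total_of_conj_eq one_lt_two (p := fun z => conj (α : ℂ) * z)
    (q := fun z => conj (α : ℂ) * z) (by fun_prop) (by fun_prop) (hm ?_ ?_) (hm ?_ ?_) f hf
  · exact isClosed_eq (by fun_prop) (by fun_prop)
  · intro ξ
    simp only [Matrix.cons_val_zero, Matrix.cons_val_one, Circle.coe_mul, Circle.coe_inv]
    rw [← mul_assoc, mul_comm (conj (α : ℂ)), hα, one_mul, star_eq_inv]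
  · exact isClosed_eq (by fun_prop) (by fun_prop)
  · intro ξ
    simp only [Matrix.cons_val_zero, Matrix.cons_val_one]
    exact conj_mul_inv_circle α ξ

/-! ### The rational inner function -/

lemma circleMeasure_singleton (x : Circle) : circleMeasure {x} = 0 := by
  have hvol : ∀ y : AddCircle (2 * Real.pi), volume {y} = 0 := by
    intro y
    refine le_antisymm (le_of_forall_gt fun ε hε => ?_) zero_le
    -- The measure of a ball tends to zero with its radius, so points are null.
    have h : Tendsto (fun r : ℝ => ENNReal.ofReal (min (2 * Real.pi) (2 * r))) (𝓝[>] 0) (𝓝 0) := by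
      have h1 : Continuous fun r : ℝ => ENNReal.ofReal (min (2 * Real.pi) (2 * r)) :=
        ENNReal.continuous_ofReal.comp (by fun_prop)
      have h2 := h1.tendsto 0
      simp only [mul_zero, min_eq_right Real.two_pi_pos.le, ENNReal.ofReal_zero] at h2
      exact h2.mono_left nhdsWithin_le_nhds
    obtain ⟨r, hr, hr0⟩ := ((h.eventually_lt_const hε).and self_mem_nhdsWithin).exists
    calc volume {y} ≤ volume (Metric.closedBall y r) :=
          measure_mono (Set.singleton_subset_iff.2 (Metric.mem_closedBall_self (le_of_lt hr0)))
      _ = ENNReal.ofReal (min (2 * Real.pi) (2 * r)) := AddCircle.volume_closedBall _ _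
      _ < ε := hr
  rw [circleMeasure, Measure.map_apply measurable_toCircle (measurableSet_singleton x)]
  have hs : (AddCircle.toCircle (T := 2 * Real.pi) ⁻¹' {x}).Subsingleton :=
    Set.subsingleton_singleton.preimage (AddCircle.injective_toCircle Real.two_pi_pos.ne')
  obtain h | ⟨y, h⟩ := hs.eq_empty_or_singleton
  · rw [h, measure_empty]
  · have h1 := hvol y
    rw [AddCircle.volume_eq_smul_haarAddCircle, Measure.smul_apply, smul_eq_mul, mul_eq_zero] at h1
    rw [h]
    exact h1.resolve_left (ENNReal.ofReal_pos.2 Real.two_pi_pos).ne'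

lemma ae_ne_circleMeasure {n : ℕ} (j : Fin n) (x : Circle) :
    ∀ᵐ ζ : Torus n ∂torusMeasure n, ζ j ≠ x := by
  have h := (measurePreserving_eval (fun _ : Fin n => circleMeasure) j).quasiMeasurePreserving
  exact h.ae (p := fun y => y ≠ x) (measure_eq_zero_iff_ae_notMem.1 (circleMeasure_singleton x))

/-- On the open bidisc the right-hand side is positive, which is the bound |I| < 1. -/
lemma normSq_sub_normSq_rational (x y : ℂ) :
    Complex.normSq (x + y + 2) - Complex.normSq (x + y + 2 * x * y) =
      2 * (1 - Complex.normSq x) * Complex.normSq (1 + y) +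
        2 * (1 - Complex.normSq y) * Complex.normSq (1 + x) := by
  simp [Complex.normSq_apply]; ring

lemma one_add_ne_zero {x : ℂ} (hx : ‖x‖ < 1) : 1 + x ≠ 0 := by
  intro h
  rw [eq_neg_of_add_eq_zero_right h, norm_neg, norm_one] at hx
  exact lt_irrefl _ hx

lemma add_add_two_ne_zero {x y : ℂ} (hx : ‖x‖ < 1) (hy : ‖y‖ < 1) : x + y + 2 ≠ 0 := by
  intro h
  have h1 : x + y = -2 := eq_neg_of_add_eq_zero_left h
  have h2 := norm_add_le x y
  rw [h1, norm_neg, Complex.norm_ofNat] at h2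
  linarith

lemma norm_rationalInner_lt {z : Fin 2 → ℂ} (hz : z ∈ polydisc 2) : ‖rationalInner z‖ < 1 := by
  have hD := add_add_two_ne_zero (hz 0) (hz 1)
  rw [rationalInner, norm_div, div_lt_one (norm_pos_iff.2 hD)]
  refine (sq_lt_sq₀ (norm_nonneg _) (norm_nonneg _)).1 ?_
  rw [← Complex.normSq_eq_norm_sq, ← Complex.normSq_eq_norm_sq]
  have h1 : ∀ j, 0 < 1 - Complex.normSq (z j) := fun j => by
    have := hz j
    rw [Complex.normSq_eq_norm_sq]
    nlinarith [norm_nonneg (z j)]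
  have h2 : ∀ j, 0 < Complex.normSq (1 + z j) := fun j =>
    Complex.normSq_pos.2 (one_add_ne_zero (hz j))
  have h3 := normSq_sub_normSq_rational (z 0) (z 1)
  have h4 := mul_pos (h1 0) (h2 1)
  have h5 := mul_pos (h1 1) (h2 0)
  nlinarith

/-- Two unimodular numbers have sum -2 only if both are -1, so the sole boundary zero of the
denominator is (-1, -1). -/
lemma circle_add_add_two_ne_zero {x y : Circle} (hx : (x : ℂ) ≠ -1) : (x : ℂ) + y + 2 ≠ 0 := by
  intro h
  have h1 : (y : ℂ) = -2 - x := by linear_combination h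
  have hy : Complex.normSq (y : ℂ) = 1 := Circle.normSq_coe y
  have hx' : Complex.normSq (x : ℂ) = 1 := Circle.normSq_coe x
  rw [h1, Complex.normSq_apply] at hy
  rw [Complex.normSq_apply] at hx'
  simp only [Complex.sub_re, Complex.neg_re, Complex.re_ofNat, Complex.sub_im, Complex.neg_im,
    Complex.im_ofNat] at hy
  have hre : (x : ℂ).re = -1 := by linarith
  have him : (x : ℂ).im = 0 := by rw [hre] at hx'; nlinarith
  exact hx (Complex.ext (by simpa using hre) (by simpa using him))

lemma isInner_rationalInner : IsInner rationalInner := by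
  refine ⟨?_, fun z hz => norm_rationalInner_lt hz, ?_⟩
  · intro z hz
    have := add_add_two_ne_zero (hz 0) (hz 1)
    unfold rationalInner
    refine DifferentiableAt.differentiableWithinAt ?_
    simp only [div_eq_mul_inv]
    exact DifferentiableAt.mul (by fun_prop) (DifferentiableAt.fun_inv (by fun_prop) this)
  · filter_upwards [ae_ne_circleMeasure (0 : Fin 2) (-1)] with ζ hζ
    have hD : (ζ 0 : ℂ) + ζ 1 + 2 ≠ 0 := circle_add_add_two_ne_zero fun h =>
      hζ (Circle.ext (by simpa using h))
    refine ⟨rationalInner ζ.toComplex, ?_, ?_⟩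
    · have h0 := circle_mul_conj (ζ 0)
      have h1 := circle_mul_conj (ζ 1)
      -- On the torus the numerator is ζ₁ζ₂ times the conjugate of the denominator, whence the
      -- quotient is unimodular.
      have e : (ζ 0 : ℂ) + ζ 1 + 2 * ζ 0 * ζ 1 = ζ 0 * ζ 1 * conj ((ζ 0 : ℂ) + ζ 1 + 2) := by
        simp only [map_add, map_ofNat]
        linear_combination (-(ζ 1 : ℂ)) * h0 - ζ 0 * h1
      change ‖((ζ 0 : ℂ) + ζ 1 + 2 * ζ 0 * ζ 1) / ((ζ 0 : ℂ) + ζ 1 + 2)‖ = 1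
      rw [e, norm_div, norm_mul, norm_mul, RCLike.norm_conj, Circle.norm_coe, Circle.norm_coe,
        one_mul, one_mul, div_self (norm_ne_zero_iff.2 hD)]
    · have hc : ContinuousAt rationalInner ζ.toComplex := by
        unfold rationalInner
        exact ContinuousAt.div (by fun_prop) (by fun_prop) hD
      exact hc.tendsto.comp (tendsto_smul_toComplex ζ)

/-! #### The exceptional Clark measure -/

/-- Half the sum of Lebesgue measures on the lines `ζ₁ = α` and `ζ₂ = α`. -/
def crossClark (α : Circle) : Measure (Torus 2) :=
  (2⁻¹ : ℝ≥0∞) • (Measure.pi ![Measure.dirac α, circleMeasure] +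
    Measure.pi ![circleMeasure, Measure.dirac α])

lemma isProbabilityMeasure_vec2 (μ ν : Measure Circle) [IsProbabilityMeasure μ]
    [IsProbabilityMeasure ν] (j : Fin 2) : IsProbabilityMeasure ((![μ, ν] : Fin 2 → _) j) := by
  fin_cases j
  · exact ‹IsProbabilityMeasure μ›
  · exact ‹IsProbabilityMeasure ν›

lemma integral_pi_vec2 (μ ν : Measure Circle) [IsProbabilityMeasure μ] [IsProbabilityMeasure ν]
    (f g : Circle → ℂ) :
    ∫ ξ : Torus 2, f (ξ 0) * g (ξ 1) ∂Measure.pi ![μ, ν] = (∫ x, f x ∂μ) * ∫ x, g x ∂ν := by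
  have := isProbabilityMeasure_vec2 μ ν
  have h := integral_fintype_prod_eq_prod (μ := (![μ, ν] : Fin 2 → Measure Circle))
    (![f, g] : Fin 2 → Circle → ℂ)
  simpa [Fin.prod_univ_two] using h

instance instIsFiniteMeasureCrossClark (α : Circle) : IsFiniteMeasure (crossClark α) := by
  have := isProbabilityMeasure_vec2 (Measure.dirac α) circleMeasure
  have := isProbabilityMeasure_vec2 circleMeasure (Measure.dirac α)
  unfold crossClark
  exact Measure.smul_finite _ (by simp)

lemma integral_crossClark (α : Circle) {f g : Circle → ℂ} (hf : Continuous f)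
    (hg : Continuous g) :
    ∫ ξ : Torus 2, f (ξ 0) * g (ξ 1) ∂crossClark α =
      2⁻¹ * (f α * ∫ x, g x ∂circleMeasure + (∫ x, f x ∂circleMeasure) * g α) := by
  have := isProbabilityMeasure_vec2 (Measure.dirac α) circleMeasure
  have := isProbabilityMeasure_vec2 circleMeasure (Measure.dirac α)
  have hc : Continuous fun ξ : Torus 2 => f (ξ 0) * g (ξ 1) := by fun_prop
  rw [crossClark, integral_smul_measure, integral_add_measure (integrable_of_continuous hc)
    (integrable_of_continuous hc), integral_pi_vec2, integral_pi_vec2, integral_dirac,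
    integral_dirac]
  simp [mul_add]

/-- Here 1 / (1 + I) = (1/(1 + z₁) + 1/(1 + z₂)) / 2, one summand for each line. In the mixed
moments each line contributes a Lebesgue factor of mean zero. -/
lemma isPolarizedClarkMeasure_crossClark {α : Circle} (hα : (α : ℂ) = -1) :
    IsPolarizedClarkMeasure rationalInner α (crossClark α) := by
  refine isPolarizedClarkMeasure_of_bidisc (by simp [rationalInner]) (fun z hz => ?_)
    fun u v hu hv => ?_
  · have h : ∀ ξ : Torus 2, cauchyKernel z ξ.toComplex =
        1 / (1 - z 0 * conj (ξ 0 : ℂ)) * (1 / (1 - z 1 * conj (ξ 1 : ℂ))) := fun ξ => by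
      simp only [cauchyKernel, Fin.prod_univ_two, Torus.toComplex]
    simp only [h]
    rw [integral_crossClark α (continuous_one_div_right (hz 0)) (continuous_one_div_right (hz 1)),
      integral_one_div_circle (hz 0), integral_one_div_circle (hz 1), hα, rationalInner]
    have h0 := one_add_ne_zero (hz 0)
    have h1 := one_add_ne_zero (hz 1)
    have hD := add_add_two_ne_zero (hz 0) (hz 1)
    simp only [map_neg, map_one, mul_neg, mul_one, sub_neg_eq_add, neg_mul, one_mul]
    field_simp
    ring
  · have hl : ∫ ξ : Circle, (1 / (1 - (ξ : ℂ) * conj u) - 1) ∂circleMeasure = 0 := by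
      have h := integral_circle_eq ((differentiable_pow_div hu 0).sub_const 1)
      simpa using h
    have hr : ∫ ξ : Circle, (1 / (1 - v * conj (ξ : ℂ)) - 1) ∂circleMeasure = 0 := by
      rw [integral_sub (integrable_of_continuous (continuous_one_div_right hv))
        (integrable_const _), integral_one_div_circle hv]
      simp
    rw [integral_crossClark α (f := fun ξ => 1 / (1 - (ξ : ℂ) * conj u) - 1)
      (g := fun ξ => 1 / (1 - v * conj (ξ : ℂ)) - 1)
      ((continuous_one_div_left hu).sub continuous_const)
      ((continuous_one_div_right hv).sub continuous_const), hl, hr]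
    simp

lemma integral_mul_crossClark (α : Circle) {w : Fin 2 → ℂ} (hw : w ∈ polydisc 2) :
    ∫ ξ : Torus 2, cauchyKernel ξ.toComplex w * ((ξ 0 : ℂ) * ξ 1) ∂crossClark α = 0 := by
  have h : ∀ ξ : Torus 2, cauchyKernel ξ.toComplex w * ((ξ 0 : ℂ) * ξ 1) =
      (1 / (1 - (ξ 0 : ℂ) * conj (w 0)) * ξ 0) * (1 / (1 - (ξ 1 : ℂ) * conj (w 1)) * ξ 1) :=
    fun ξ => by simp only [cauchyKernel, Fin.prod_univ_two, Torus.toComplex]; ring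
  simp only [h]
  rw [integral_crossClark α (f := fun ξ => 1 / (1 - (ξ : ℂ) * conj (w 0)) * ξ)
    (g := fun ξ => 1 / (1 - (ξ : ℂ) * conj (w 1)) * ξ)
    ((continuous_one_div_left (hw 0)).mul continuous_circle_coe)
    ((continuous_one_div_left (hw 1)).mul continuous_circle_coe),
    integral_id_div_circle (hw 0), integral_id_div_circle (hw 1)]
  simp

/-! #### The generic Clark measures of the rational inner function -/

/-- The parameter of the Möbius transformation `b_α`. -/
def mobiusParam (α : Circle) : ℂ := (1 - α) / 2

lemma coe_eq_mobiusParam (α : Circle) : (α : ℂ) = 1 - 2 * mobiusParam α := by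
  rw [mobiusParam]; ring

lemma conj_eq_mobiusParam (α : Circle) : conj (α : ℂ) = 1 - 2 * conj (mobiusParam α) := by
  rw [mobiusParam, map_div₀, map_sub, map_one, map_ofNat]; ring

/-- This is |α| = 1 rewritten for c = (1 - α)/2. It is the only relation between c and its conjugate
that the later algebra needs. -/
lemma mobiusParam_add_conj (α : Circle) :
    mobiusParam α + conj (mobiusParam α) = 2 * mobiusParam α * conj (mobiusParam α) := by
  have h := circle_mul_conj α
  rw [conj_eq_mobiusParam] at h
  nth_rw 1 [coe_eq_mobiusParam α] at h
  linear_combination (-1 / 2) * h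

/-- The point of the unit circle farthest from 1 is -1, so |1 - α| < 2 for every other α. -/
lemma norm_mobiusParam_lt {α : Circle} (hα : (α : ℂ) ≠ -1) : ‖mobiusParam α‖ < 1 := by
  have hn : (α : ℂ).re * (α : ℂ).re + (α : ℂ).im * (α : ℂ).im = 1 := by
    rw [← Complex.normSq_apply]; exact Circle.normSq_coe α
  have hre : -1 < (α : ℂ).re := by
    refine lt_of_le_of_ne (by nlinarith [mul_self_nonneg (α : ℂ).im]) fun h => hα ?_
    have him : (α : ℂ).im = 0 := by rw [← h] at hn; nlinarith
    exact Complex.ext (by simpa using h.symm) (by simpa using him)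
  have h1 : ‖1 - (α : ℂ)‖ < 2 := by
    refine (sq_lt_sq₀ (norm_nonneg _) zero_le_two).1 ?_
    rw [← Complex.normSq_eq_norm_sq, Complex.normSq_apply]
    simp only [Complex.sub_re, Complex.one_re, Complex.sub_im, Complex.one_im]
    nlinarith
  rw [mobiusParam, norm_div, Complex.norm_ofNat]
  linarith

lemma one_add_conj_mul_ne_zero {c ξ : ℂ} (hc : ‖c‖ < 1) (hξ : ‖ξ‖ ≤ 1) : 1 + conj c * ξ ≠ 0 := by
  have h := one_sub_ne_zero (z := -conj c) (w := ξ) (by simpa using hc) hξ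
  simpa using h

lemma circle_add_ne_zero {c : ℂ} (hc : ‖c‖ < 1) (ξ : Circle) : (ξ : ℂ) + c ≠ 0 := by
  intro h
  have h1 := congrArg norm (eq_neg_of_add_eq_zero_left h)
  rw [norm_neg, Circle.norm_coe] at h1
  exact hc.ne h1.symm

lemma norm_mobius_le {c ξ : ℂ} (hc : ‖c‖ < 1) (hξ : ‖ξ‖ ≤ 1) : ‖(ξ + c) / (1 + conj c * ξ)‖ ≤ 1 := by
  rw [norm_div, div_le_one (norm_pos_iff.2 (one_add_conj_mul_ne_zero hc hξ))]
  refine (sq_le_sq₀ (norm_nonneg _) (norm_nonneg _)).1 ?_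
  have h : ‖1 + conj c * ξ‖ ^ 2 - ‖ξ + c‖ ^ 2 = (1 - ‖c‖ ^ 2) * (1 - ‖ξ‖ ^ 2) := by
    simp only [← Complex.normSq_eq_norm_sq, Complex.normSq_apply, Complex.add_re, Complex.add_im,
      Complex.mul_re, Complex.mul_im, Complex.conj_re, Complex.conj_im, Complex.one_re,
      Complex.one_im]
    ring
  have h1 : 0 ≤ 1 - ‖c‖ ^ 2 := by nlinarith [norm_nonneg c]
  have h2 : 0 ≤ 1 - ‖ξ‖ ^ 2 := by nlinarith [norm_nonneg ξ]
  nlinarith [mul_nonneg h1 h2]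

lemma norm_mobius_circle {c : ℂ} (hc : ‖c‖ < 1) (ξ : Circle) :
    ‖((ξ : ℂ) + c) / (1 + conj c * ξ)‖ = 1 := by
  have h : (ξ : ℂ) + c = ξ * conj (1 + conj c * ξ) := by
    simp only [map_add, map_one, map_mul, Complex.conj_conj]
    linear_combination (-c) * circle_mul_conj ξ
  rw [h, norm_div, norm_mul, RCLike.norm_conj, Circle.norm_coe, one_mul,
    div_self (norm_ne_zero_iff.2 (one_add_conj_mul_ne_zero hc (norm_circle_le ξ)))]

lemma blaschkeFactor_eq {α : Circle} (hα : (α : ℂ) ≠ -1) {ξ : ℂ} (hξ : ‖ξ‖ ≤ 1) :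
    blaschkeFactor α ξ =
      conj (α : ℂ) * ((ξ + mobiusParam α) / (1 + conj (mobiusParam α) * ξ)) := by
  have h1 := one_add_conj_mul_ne_zero (norm_mobiusParam_lt hα) hξ
  have hα0 := Circle.coe_ne_zero α
  have h := circle_mul_conj α
  have e1 : ((α : ℂ) - 1) * ξ + 2 * α = 2 * α * (1 + conj (mobiusParam α) * ξ) := by
    have : (α : ℂ) * (2 * conj (mobiusParam α)) = α - 1 := by
      have h2 := conj_eq_mobiusParam α
      linear_combination α * h2 - h
    linear_combination (-ξ) * this
  have e2 : 1 + 2 * ξ - (α : ℂ) = 2 * (ξ + mobiusParam α) := by rw [mobiusParam]; ring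
  rw [blaschkeFactor, e1, e2, star_eq_inv]
  field_simp

/-- The map `b_α` as a continuous map of the circle. -/
def blaschkeCircle {α : Circle} (hα : (α : ℂ) ≠ -1) : C(Circle, Circle) where
  toFun ξ := ⟨blaschkeFactor α ξ, by
    change blaschkeFactor α ξ ∈ Metric.sphere (0 : ℂ) 1
    rw [mem_sphere_zero_iff_norm, blaschkeFactor_eq hα (norm_circle_le ξ), norm_mul,
      RCLike.norm_conj, Circle.norm_coe, one_mul, norm_mobius_circle (norm_mobiusParam_lt hα)]⟩
  continuous_toFun := by
    refine Continuous.subtype_mk ?_ _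
    simp only [blaschkeFactor_eq hα (norm_circle_le _)]
    exact continuous_const.mul (Continuous.div (by fun_prop) (by fun_prop)
      fun ξ => one_add_conj_mul_ne_zero (norm_mobiusParam_lt hα) (norm_circle_le ξ))

lemma coe_blaschkeCircle {α : Circle} (hα : (α : ℂ) ≠ -1) (ξ : Circle) :
    (blaschkeCircle hα ξ : ℂ) = blaschkeFactor α ξ := rfl

/-- The density of the first marginal of the Clark measure. -/
def rationalDensity {c : ℂ} (hc : ‖c‖ < 1) : C(Circle, NNReal) where
  toFun ξ := Real.toNNReal ((1 + (ξ : ℂ).re) / Complex.normSq (1 + conj c * ξ))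
  continuous_toFun := by
    refine continuous_real_toNNReal.comp (Continuous.div ?_ ?_ fun ξ => ?_)
    · exact continuous_const.add (Complex.continuous_re.comp continuous_circle_coe)
    · exact Complex.continuous_normSq.comp (by fun_prop)
    · exact (Complex.normSq_pos.2 (one_add_conj_mul_ne_zero hc (norm_circle_le ξ))).ne'

/-- On the circle 1 + Re ξ = (ξ + 1)² / (2ξ) and |1 + conj c ξ|² = (1 + conj c ξ)(ξ + c) / ξ. This
exhibits the only pole inside the disc, at -c. -/
lemma rationalDensity_eq {c : ℂ} (hc : ‖c‖ < 1) (ξ : Circle) :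
    (((rationalDensity hc ξ : NNReal) : ℝ) : ℂ) =
      ((ξ : ℂ) + 1) ^ 2 / (2 * (1 + conj c * ξ) * (ξ + c)) := by
  have hre : -1 ≤ (ξ : ℂ).re := by
    have h := Complex.abs_re_le_norm (ξ : ℂ)
    rw [Circle.norm_coe] at h
    exact (abs_le.1 h).1
  have h0 : 0 ≤ (1 + (ξ : ℂ).re) / Complex.normSq (1 + conj c * ξ) :=
    div_nonneg (by linarith) (Complex.normSq_nonneg _)
  have h1 := one_add_conj_mul_ne_zero hc (norm_circle_le ξ)
  have h2 := circle_add_ne_zero hc ξ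
  have h3 : conj (1 + conj c * (ξ : ℂ)) ≠ 0 := (map_ne_zero _).2 h1
  have hξ := circle_mul_conj ξ
  change ((Real.toNNReal _ : ℝ) : ℂ) = _
  rw [Real.coe_toNNReal _ h0, Complex.ofReal_div, Complex.ofReal_add, Complex.ofReal_one,
    ← Complex.mul_conj, Complex.re_eq_add_conj, div_eq_div_iff (mul_ne_zero h1 h3)
    (mul_ne_zero (mul_ne_zero two_ne_zero h1) h2)]
  simp only [map_add, map_one, map_mul, Complex.conj_conj]
  linear_combination (1 + conj c * ξ) * (1 + c * conj (ξ : ℂ) - 2 * c * (1 + (ξ + conj (ξ : ℂ)) / 2)) * hξ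

/-- For c = (1 - α)/2 the quotient is (α + I(ξ,0)) / (α - I(ξ,0)), so the density is the one that
the Clark identity on the slice z₂ = 0 dictates for the first marginal. -/
lemma rationalDensity_eq_re {c : ℂ} (hc : ‖c‖ < 1) (hrel : c + conj c = 2 * c * conj c)
    (ξ : Circle) :
    (((rationalDensity hc ξ : NNReal) : ℝ) : ℂ) =
      ((1 + (1 - conj c) * ξ) / (1 + conj c * ξ) +
        conj ((1 + (1 - conj c) * ξ) / (1 + conj c * ξ))) / 2 := by
  have h1 := one_add_conj_mul_ne_zero hc (norm_circle_le ξ)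
  have h2 := circle_add_ne_zero hc ξ
  have hξ0 := Circle.coe_ne_zero ξ
  have h3 : conj ((1 + (1 - conj c) * (ξ : ℂ)) / (1 + conj c * ξ)) = (ξ + 1 - c) / (ξ + c) := by
    have h4 : 1 + c * (ξ : ℂ)⁻¹ ≠ 0 := by
      have : 1 + c * (ξ : ℂ)⁻¹ = (ξ + c) / ξ := by field_simp
      rw [this]; exact div_ne_zero h2 hξ0
    simp only [map_add, map_one, map_mul, map_sub, map_div₀, Complex.conj_conj, star_eq_inv]
    rw [div_eq_div_iff h4 h2]
    field_simp
    ring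
  rw [rationalDensity_eq, h3, div_add_div _ _ h1 h2, div_div, div_eq_div_iff
    (mul_ne_zero (mul_ne_zero two_ne_zero h1) h2) (mul_ne_zero (mul_ne_zero h1 h2) two_ne_zero)]
  linear_combination (-2 * ξ * (1 + conj c * ξ) * (ξ + c)) * hrel

/-- The Clark measure of the rational inner function at `α ≠ -1`. -/
def graphClark {α : Circle} (hα : (α : ℂ) ≠ -1) : Measure (Torus 2) :=
  Measure.map (fun ξ : Circle => ![ξ, (blaschkeCircle hα ξ)⁻¹])
    (circleMeasure.withDensity fun ξ => (rationalDensity (norm_mobiusParam_lt hα) ξ : ℝ≥0∞))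

lemma continuous_graphClark_map {α : Circle} (hα : (α : ℂ) ≠ -1) :
    Continuous fun ξ : Circle => (![ξ, (blaschkeCircle hα ξ)⁻¹] : Torus 2) :=
  continuous_vec2 continuous_id (blaschkeCircle hα).continuous.inv

instance instIsFiniteMeasureGraphClark {α : Circle} (hα : (α : ℂ) ≠ -1) :
    IsFiniteMeasure (graphClark hα) := by
  have hi : Integrable (fun ξ => (rationalDensity (norm_mobiusParam_lt hα) ξ : ℝ)) circleMeasure :=
    integrable_of_continuous (NNReal.continuous_coe.comp (ContinuousMap.continuous _))
  have : IsFiniteMeasure (circleMeasure.withDensity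
      fun ξ => (rationalDensity (norm_mobiusParam_lt hα) ξ : ℝ≥0∞)) := by
    refine isFiniteMeasure_withDensity ?_
    have h := hi.2
    simp only [HasFiniteIntegral, NNReal.enorm_eq] at h
    exact h.ne
  unfold graphClark
  infer_instance

lemma integral_graphClark {α : Circle} (hα : (α : ℂ) ≠ -1) {g : Torus 2 → ℂ}
    (hg : Continuous g) :
    ∫ ξ, g ξ ∂graphClark hα = ∫ ξ : Circle,
      ((rationalDensity (norm_mobiusParam_lt hα) ξ : ℝ) : ℂ) * g ![ξ, (blaschkeCircle hα ξ)⁻¹]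
        ∂circleMeasure := by
  rw [graphClark, integral_map (continuous_graphClark_map hα).aemeasurable hg.aestronglyMeasurable,
    integral_withDensity_eq_integral_smul (ContinuousMap.continuous _).measurable]
  rfl

lemma conj_inv_blaschkeCircle {α : Circle} (hα : (α : ℂ) ≠ -1) (ξ : Circle) :
    conj (((blaschkeCircle hα ξ)⁻¹ : Circle) : ℂ) =
      conj (α : ℂ) * ((ξ + mobiusParam α) / (1 + conj (mobiusParam α) * ξ)) := by
  rw [← blaschkeFactor_eq hα (norm_circle_le ξ), ← coe_blaschkeCircle hα, star_eq_inv,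
    Circle.coe_inv, inv_inv]

/-- The zero of the Möbius factor at -c cancels the pole of the density, so the product extends
holomorphically past the closed disc. -/
lemma rationalDensity_mul_blaschke {c β : ℂ} (hc : ‖c‖ < 1) (ξ : Circle) :
    (((rationalDensity hc ξ : NNReal) : ℝ) : ℂ) * (β * (((ξ : ℂ) + c) / (1 + conj c * ξ))) =
      β * ((ξ : ℂ) + 1) ^ 2 / (2 * (1 + conj c * ξ) ^ 2) := by
  have h1 := one_add_conj_mul_ne_zero hc (norm_circle_le ξ)
  have h2 := circle_add_ne_zero hc ξ
  rw [rationalDensity_eq]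
  field_simp

/-- The algebraic identity behind the Cauchy transform of the Clark measure. -/
lemma rational_cauchy_identity {c d x y : ℂ} (hrel : c + d = 2 * c * d) (hD : 1 + d * x ≠ 0)
    (hE : 1 - y * ((1 - 2 * d) * ((x + c) / (1 + d * x))) ≠ 0) (hS : x + y + 2 ≠ 0) :
    (1 - (1 - 2 * d) * ((x + y + 2 * x * y) / (x + y + 2))) *
      (((1 + (1 - d) * x) / (1 + d * x) + 1) / 2 + y * ((1 - 2 * d) * (x + 1) ^ 2 /
        (2 * (1 + d * x) ^ 2)) / (1 - y * ((1 - 2 * d) * ((x + c) / (1 + d * x))))) = 1 := by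
  have e : 1 - y * ((1 - 2 * d) * ((x + c) / (1 + d * x))) =
      (1 + d * x - y * (1 - 2 * d) * (x + c)) / (1 + d * x) := by
    field_simp
  have hK : 1 + d * x - y * (1 - 2 * d) * (x + c) ≠ 0 := fun h => hE (by rw [e, h, zero_div])
  -- With K = 1 + dx - y(1 - 2d)(x + c), the first factor is 2K / (x + y + 2) and the second is its
  -- reciprocal.
  have e1 : 1 - (1 - 2 * d) * ((x + y + 2 * x * y) / (x + y + 2)) =
      2 * (1 + d * x - y * (1 - 2 * d) * (x + c)) / (x + y + 2) := by
    field_simp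
    linear_combination (2 * y) * hrel
  have e2 : ((1 + (1 - d) * x) / (1 + d * x) + 1) / 2 + y * ((1 - 2 * d) * (x + 1) ^ 2 /
      (2 * (1 + d * x) ^ 2)) / ((1 + d * x - y * (1 - 2 * d) * (x + c)) / (1 + d * x)) =
      (x + y + 2) / (2 * (1 + d * x - y * (1 - 2 * d) * (x + c))) := by
    generalize hKdef : 1 + d * x - y * (1 - 2 * d) * (x + c) = K at hK ⊢
    field_simp
    rw [← hKdef]
    linear_combination (-(y * (x + 2))) * hrel
  rw [e, e1, e2]
  field_simp

lemma one_sub_mul_mobius_ne_zero {c v ξ : ℂ} (hc : ‖c‖ < 1) (α : Circle) (hv : ‖v‖ < 1)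
    (hξ : ‖ξ‖ ≤ 1) : 1 - v * (conj (α : ℂ) * ((ξ + c) / (1 + conj c * ξ))) ≠ 0 := by
  refine one_sub_ne_zero hv ?_
  rw [norm_mul, RCLike.norm_conj, Circle.norm_coe, one_mul]
  exact norm_mobius_le hc hξ

lemma differentiableAt_mobius_quotient {c v ξ : ℂ} (hc : ‖c‖ < 1) (α : Circle) (hv : ‖v‖ < 1)
    (hξ : ‖ξ‖ ≤ 1) : DifferentiableAt ℂ (fun ξ : ℂ =>
      v * (conj (α : ℂ) * (ξ + 1) ^ 2 / (2 * (1 + conj c * ξ) ^ 2)) /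
        (1 - v * (conj (α : ℂ) * ((ξ + c) / (1 + conj c * ξ))))) ξ := by
  have h1 := one_add_conj_mul_ne_zero hc hξ
  have h2 := one_sub_mul_mobius_ne_zero hc α hv hξ
  have h3 : 2 * (1 + conj c * ξ) ^ 2 ≠ 0 := mul_ne_zero two_ne_zero (pow_ne_zero 2 h1)
  fun_prop (disch := assumption)

/-- The expansion 1 / (1 - vB) = 1 + vB / (1 - vB) confines the real-part form of the density to the
constant term; elsewhere it appears multiplied by B. -/
lemma half_add_mul_inv {q r B v a : ℂ} (hE : 1 - v * B ≠ 0) :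
    (q + r) / 2 * (a * (1 / (1 - v * B))) =
      2⁻¹ * (q * a) + 2⁻¹ * (r * a) + v * ((q + r) / 2 * B) / (1 - v * B) * a := by
  field_simp
  ring

/-- The three terms are suited to integration: the first and third are holomorphic functions times a
Cauchy kernel, and the second is the conjugate of a holomorphic function. -/
lemma rationalDensity_mul_cauchyKernel {α : Circle} (hα : (α : ℂ) ≠ -1) {z : Fin 2 → ℂ}
    (hz : z ∈ polydisc 2) (ξ : Circle) :
    ((rationalDensity (norm_mobiusParam_lt hα) ξ : ℝ) : ℂ) *
      cauchyKernel z (Torus.toComplex ![ξ, (blaschkeCircle hα ξ)⁻¹]) =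
        2⁻¹ * ((1 + (1 - conj (mobiusParam α)) * ξ) / (1 + conj (mobiusParam α) * ξ) *
          (1 / (1 - z 0 * conj (ξ : ℂ)))) +
        2⁻¹ * conj ((1 + (1 - conj (mobiusParam α)) * (ξ : ℂ)) / (1 + conj (mobiusParam α) * ξ) *
          (1 / (1 - ξ * conj (z 0)))) +
        z 1 * (conj (α : ℂ) * ((ξ : ℂ) + 1) ^ 2 / (2 * (1 + conj (mobiusParam α) * ξ) ^ 2)) /
          (1 - z 1 * (conj (α : ℂ) *
            (((ξ : ℂ) + mobiusParam α) / (1 + conj (mobiusParam α) * ξ)))) *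
          (1 / (1 - z 0 * conj (ξ : ℂ))) := by
  have hc := norm_mobiusParam_lt hα
  have hE := one_sub_mul_mobius_ne_zero hc α (hz 1) (norm_circle_le ξ)
  rw [← rationalDensity_mul_blaschke (β := conj (α : ℂ)) hc ξ,
    rationalDensity_eq_re hc (mobiusParam_add_conj α) ξ]
  have hK : cauchyKernel z (Torus.toComplex ![ξ, (blaschkeCircle hα ξ)⁻¹]) =
      1 / (1 - z 0 * conj (ξ : ℂ)) * (1 / (1 - z 1 * (conj (α : ℂ) *
        (((ξ : ℂ) + mobiusParam α) / (1 + conj (mobiusParam α) * ξ))))) := by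
    rw [← conj_inv_blaschkeCircle hα ξ, cauchyKernel, Fin.prod_univ_two]
    rfl
  have hC : conj (1 / (1 - (ξ : ℂ) * conj (z 0))) = 1 / (1 - z 0 * conj (ξ : ℂ)) := by
    rw [map_div₀, map_sub, map_mul, map_one, Complex.conj_conj, mul_comm]
  rw [hK, map_mul, hC]
  exact half_add_mul_inv hE

lemma mul_one_div_sub_one {D B v a : ℂ} (hE : 1 - v * B ≠ 0) :
    D * (a * (1 / (1 - v * B) - 1)) = a * (v * (D * B) / (1 - v * B)) := by
  field_simp
  ring

/-- For the transform, the Cauchy formula evaluates two terms at z₁ and the mean value formula the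
conjugate one; `rational_cauchy_identity` sums them. In the mixed moments each term contains the
density times b_α, so the integrand is holomorphic. -/
lemma isPolarizedClarkMeasure_graphClark {α : Circle} (hα : (α : ℂ) ≠ -1) :
    IsPolarizedClarkMeasure rationalInner α (graphClark hα) := by
  have hc := norm_mobiusParam_lt hα
  have hrel := mobiusParam_add_conj α
  refine isPolarizedClarkMeasure_of_bidisc (by simp [rationalInner]) (fun z hz => ?_)
    fun u v hu hv => ?_
  · rw [integral_graphClark hα (continuous_cauchyKernel_right hz)]
    simp only [rationalDensity_mul_cauchyKernel hα hz]
    generalize hcdef : mobiusParam α = c at hc hrel ⊢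
    have hqd : ∀ {ξ : ℂ}, ‖ξ‖ ≤ 1 → DifferentiableAt ℂ (fun ξ : ℂ =>
        (1 + (1 - conj c) * ξ) / (1 + conj c * ξ)) ξ := by
      intro ξ hξ
      have h1 := one_add_conj_mul_ne_zero hc hξ
      fun_prop (disch := assumption)
    have i1 := integral_cauchy_circle (diffContOnCl_of_differentiableAt fun ξ hξ => hqd hξ) (hz 0)
    have i3 := integral_cauchy_circle
      (diffContOnCl_of_differentiableAt fun ξ hξ => differentiableAt_mobius_quotient hc α (hz 1) hξ) (hz 0)
    have hd2 : DiffContOnCl ℂ (fun ξ : ℂ => (1 + (1 - conj c) * ξ) / (1 + conj c * ξ) *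
        (1 / (1 - ξ * conj (z 0)))) (Metric.ball 0 1) := by
      refine diffContOnCl_of_differentiableAt fun ξ hξ => ?_
      have h1 := one_add_conj_mul_ne_zero hc hξ
      have h2 := one_sub_mul_conj_ne_zero' hξ (hz 0)
      fun_prop (disch := assumption)
    -- The holomorphic function has value one at the origin, so the conjugate term contributes
    -- exactly 1/2.
    have i2 := congrArg conj (integral_circle_eq hd2)
    rw [← integral_conj] at i2
    simp only [mul_zero, add_zero, zero_mul, sub_zero, div_one, mul_one, map_one] at i2
    have hcont : ∀ {F : ℂ → ℂ}, DiffContOnCl ℂ F (Metric.ball 0 1) →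
        Continuous fun ξ : Circle => F ξ := fun hF =>
      hF.continuousOn.comp_continuous continuous_circle_coe fun ξ => by
        rw [closure_ball _ one_ne_zero, mem_closedBall_zero_iff]
        exact norm_circle_le ξ
    have c1 : Integrable (fun ξ : Circle => 2⁻¹ * ((1 + (1 - conj c) * (ξ : ℂ)) /
        (1 + conj c * ξ) * (1 / (1 - z 0 * conj (ξ : ℂ))))) circleMeasure :=
      (integrable_of_continuous ((hcont (diffContOnCl_of_differentiableAt fun ξ hξ => hqd hξ)).mul
        (continuous_one_div_right (hz 0)))).const_mul _
    have c2 : Integrable (fun ξ : Circle => 2⁻¹ * conj ((1 + (1 - conj c) * (ξ : ℂ)) /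
        (1 + conj c * ξ) * (1 / (1 - ξ * conj (z 0))))) circleMeasure :=
      (integrable_of_continuous (Complex.continuous_conj.comp (hcont hd2))).const_mul _
    have c3 : Integrable (fun ξ : Circle =>
        z 1 * (conj (α : ℂ) * ((ξ : ℂ) + 1) ^ 2 / (2 * (1 + conj c * ξ) ^ 2)) /
          (1 - z 1 * (conj (α : ℂ) * (((ξ : ℂ) + c) / (1 + conj c * ξ)))) *
          (1 / (1 - z 0 * conj (ξ : ℂ)))) circleMeasure :=
      integrable_of_continuous ((hcont (diffContOnCl_of_differentiableAt
        fun ξ hξ => differentiableAt_mobius_quotient hc α (hz 1) hξ)).mul (continuous_one_div_right (hz 0)))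
    have c12 : Integrable (fun ξ : Circle => 2⁻¹ * ((1 + (1 - conj c) * (ξ : ℂ)) /
        (1 + conj c * ξ) * (1 / (1 - z 0 * conj (ξ : ℂ)))) +
        2⁻¹ * conj ((1 + (1 - conj c) * (ξ : ℂ)) / (1 + conj c * ξ) *
          (1 / (1 - ξ * conj (z 0))))) circleMeasure := c1.add c2
    rw [integral_add c12 c3, integral_add c1 c2, integral_const_mul, integral_const_mul, i1, i2, i3]
    have hD := one_add_conj_mul_ne_zero hc (hz 0).le
    have hE := one_sub_mul_mobius_ne_zero hc α (hz 1) (hz 0).le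
    have hS := add_add_two_ne_zero (hz 0) (hz 1)
    rw [conj_eq_mobiusParam, hcdef] at hE ⊢
    rw [rationalInner, mul_one, ← mul_add_one, inv_mul_eq_div]
    exact rational_cauchy_identity hrel hD hE hS
  · rw [integral_graphClark hα (continuous_mixed hu hv)]
    have hd : DiffContOnCl ℂ (fun ξ : ℂ => (1 / (1 - ξ * conj u) - 1) *
        (v * (conj (α : ℂ) * (ξ + 1) ^ 2 / (2 * (1 + conj (mobiusParam α) * ξ) ^ 2)) /
        (1 - v * (conj (α : ℂ) * ((ξ + mobiusParam α) / (1 + conj (mobiusParam α) * ξ)))))) (Metric.ball 0 1) := by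
      refine diffContOnCl_of_differentiableAt fun ξ hξ => DifferentiableAt.mul ?_ (differentiableAt_mobius_quotient hc α hv hξ)
      have h1 := one_sub_mul_conj_ne_zero' hξ hu
      fun_prop (disch := assumption)
    -- The factor 1 / (1 - ξ conj u) - 1 vanishes at the origin.
    have h := integral_circle_eq hd
    simp only [zero_mul, sub_zero, div_one, sub_self] at h
    rw [← h]
    refine integral_congr_ae (Eventually.of_forall fun ξ => ?_)
    have hE := one_sub_mul_mobius_ne_zero hc α hv (norm_circle_le ξ)
    simp only [Matrix.cons_val_zero, Matrix.cons_val_one, conj_inv_blaschkeCircle]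
    rw [← rationalDensity_mul_blaschke (β := conj (α : ℂ)) hc ξ]
    exact mul_one_div_sub_one hE

/-- Solving the graph equation for the first coordinate expresses its conjugate through the second
one. -/
lemma mobius_inverse {a c d y : ℂ} (ha : a ≠ 0) (h3 : 1 + c * y ≠ 0) (h4 : 1 - c * d ≠ 0) :
    y = (a * ((y + d) / (1 + c * y)) - a * d) / (a - c * (a * ((y + d) / (1 + c * y)))) := by
  have h5 : a - c * (a * ((y + d) / (1 + c * y))) = a * (1 - c * d) / (1 + c * y) := by
    field_simp
    ring
  rw [eq_div_iff (h5 ▸ div_ne_zero (mul_ne_zero ha h4) h3)]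
  linear_combination (-a) * div_mul_cancel₀ (y + d) h3

/-- On the graph conj ξ₂ = b_α(ξ₁), and inverting this Möbius map gives conj ξ₁ as a Möbius function
of ξ₂. Since |c| < 1, both maps are holomorphic on a disc of some radius R > 1 with |c| R < 1. -/
lemma total_graphClark {α : Circle} (hα : (α : ℂ) ≠ -1) (f : Lp ℂ 2 (graphClark hα))
    (hf : ∀ w ∈ polydisc 2,
      ∫ ξ, cauchyKernel ξ.toComplex w * conj (f ξ) ∂graphClark hα = 0) : f = 0 := by
  have hc := norm_mobiusParam_lt hα
  set c := mobiusParam α with hcdef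
  obtain ⟨R, hR, hcR⟩ : ∃ R : ℝ, 1 < R ∧ ‖c‖ * R < 1 := by
    obtain ⟨R, hR, h⟩ := polydisc_exists_radius (n := 1) (w := fun _ => c) fun _ => hc
    exact ⟨R, hR, h 0⟩
  have hlt : ∀ z ∈ Metric.ball (0 : ℂ) R, ‖c * z‖ < 1 := by
    intro z hz
    rw [mem_ball_zero_iff] at hz
    rw [norm_mul]
    nlinarith [norm_nonneg c]
  have hp : ∀ z ∈ Metric.ball (0 : ℂ) R, (α : ℂ) - c * z ≠ 0 := by
    intro z hz h
    have h1 := hlt z hz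
    rw [← sub_eq_zero.1 h, Circle.norm_coe] at h1
    exact lt_irrefl _ h1
  have hq : ∀ z ∈ Metric.ball (0 : ℂ) R, 1 + conj c * z ≠ 0 := by
    intro z hz
    refine one_add_ne_zero ?_
    have h1 := hlt z hz
    rwa [norm_mul, ← RCLike.norm_conj c, ← norm_mul] at h1
  have hm : ∀ {p : Torus 2 → Prop}, MeasurableSet {ξ | p ξ} →
      (∀ ξ : Circle, p ![ξ, (blaschkeCircle hα ξ)⁻¹]) → ∀ᵐ ξ ∂graphClark hα, p ξ := fun hp h =>
    (ae_map_iff (continuous_graphClark_map hα).aemeasurable hp).2 (Eventually.of_forall h)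
  have hα0 := Circle.coe_ne_zero α
  refine total_of_conj_eq hR (p := fun z => (z - α * conj c) / (α - c * z))
    (q := fun z => conj (α : ℂ) * ((z + c) / (1 + conj c * z))) ?_ ?_ (hm ?_ ?_) (hm ?_ ?_) f hf
  · intro z hz
    have := hp z hz
    exact DifferentiableAt.differentiableWithinAt (by fun_prop (disch := assumption))
  · intro z hz
    have := hq z hz
    exact DifferentiableAt.differentiableWithinAt (by fun_prop (disch := assumption))
  · exact measurableSet_eq_fun (by fun_prop) (by fun_prop)
  · intro ξ
    simp only [Matrix.cons_val_zero, Matrix.cons_val_one]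
    have h1 := one_add_conj_mul_ne_zero hc (norm_circle_le ξ)
    have h3 : 1 + c * conj (ξ : ℂ) ≠ 0 := by
      have := (map_ne_zero (starRingEnd ℂ)).2 h1
      simpa using this
    have h2 : (((blaschkeCircle hα ξ)⁻¹ : Circle) : ℂ) =
        α * ((conj (ξ : ℂ) + conj c) / (1 + c * conj (ξ : ℂ))) := by
      have := congrArg conj (conj_inv_blaschkeCircle hα ξ)
      simpa using this
    have h4 : 1 - c * conj c ≠ 0 := one_sub_mul_conj_ne_zero hc hc.le
    rw [h2]
    exact mobius_inverse hα0 h3 h4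
  · exact measurableSet_eq_fun (by fun_prop) (by fun_prop)
  · intro ξ
    simp only [Matrix.cons_val_zero, Matrix.cons_val_one]
    exact conj_inv_blaschkeCircle hα ξ

lemma rationalDensity_eq_zero {c : ℂ} (hc : ‖c‖ < 1) {ξ : Circle} (hξ : (ξ : ℂ) = -1) :
    rationalDensity hc ξ = 0 := by
  change Real.toNNReal _ = 0
  simp [hξ]

lemma isPolarizedClarkMeasure_rationalInner (α : Circle) :
    ∃ σ, IsPolarizedClarkMeasure rationalInner α σ := by
  by_cases hα : (α : ℂ) = -1
  · exact ⟨_, isPolarizedClarkMeasure_crossClark hα⟩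
  · exact ⟨_, isPolarizedClarkMeasure_graphClark hα⟩

end ClarkTorus

end

open ClarkTorus in
theorem mainTheorem7 :
    (∀ (n : ℕ) (hn : 2 ≤ n),
      ClarkTorus.HasClarkTheory (ClarkTorus.coordinateInner n hn) ∧
      ∀ α : Circle,
        ClarkTorus.clarkMeasure (ClarkTorus.coordinateInner n hn) α =
          Measure.pi (Function.update (fun _ : Fin n => ClarkTorus.circleMeasure)
            ⟨0, by omega⟩ (Measure.dirac α)) ∧
        ¬ ClarkTorus.IsUnitaryOperator
          (ClarkTorus.clarkOperator (ClarkTorus.coordinateInner n hn) α)) ∧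
    (ClarkTorus.HasClarkTheory ClarkTorus.productInner ∧
      ∀ α : Circle,
        ClarkTorus.clarkMeasure ClarkTorus.productInner α =
          Measure.map (fun ξ : Circle => ![ξ, α * ξ⁻¹]) ClarkTorus.circleMeasure ∧
        ClarkTorus.IsUnitaryOperator
          (ClarkTorus.clarkOperator ClarkTorus.productInner α)) ∧
    (ClarkTorus.HasClarkTheory ClarkTorus.rationalInner ∧
      (∀ α : Circle, (α : ℂ) ≠ -1 →
        (∃ (b : C(Circle, Circle)) (h : C(Circle, NNReal)),
          (∀ ξ : Circle, (b ξ : ℂ) = ClarkTorus.blaschkeFactor α ξ) ∧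
          (∀ ξ : Circle, (ξ : ℂ) = -1 → h ξ = 0) ∧
          ClarkTorus.clarkMeasure ClarkTorus.rationalInner α =
            Measure.map (fun ξ : Circle => ![ξ, (b ξ)⁻¹])
              (ClarkTorus.circleMeasure.withDensity fun ξ => (h ξ : ℝ≥0∞))) ∧
        ClarkTorus.IsUnitaryOperator
          (ClarkTorus.clarkOperator ClarkTorus.rationalInner α)) ∧
      ∀ α : Circle, (α : ℂ) = -1 →
        ClarkTorus.clarkMeasure ClarkTorus.rationalInner α =
          (2⁻¹ : ℝ≥0∞) •
            (Measure.pi ![Measure.dirac α, ClarkTorus.circleMeasure] +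
              Measure.pi ![ClarkTorus.circleMeasure, Measure.dirac α]) ∧
        ¬ ClarkTorus.IsUnitaryOperator
          (ClarkTorus.clarkOperator ClarkTorus.rationalInner α)) := by
  refine ⟨fun n hn => ⟨?_, fun α => ⟨?_, ?_⟩⟩, ⟨?_, fun α => ⟨?_, ?_⟩⟩, ?_, fun α hα => ⟨?_, ?_⟩,
    fun α hα => ⟨?_, ?_⟩⟩
  · exact hasClarkTheory (isInner_coordinateInner n hn)
      fun α => ⟨_, isPolarizedClarkMeasure_coordinateInner n hn α⟩
  · exact clarkMeasure_eq (isInner_coordinateInner n hn)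
      (isPolarizedClarkMeasure_coordinateInner n hn α)
  · exact not_isUnitaryOperator_clarkOperator (isInner_coordinateInner n hn)
      (isPolarizedClarkMeasure_coordinateInner n hn α)
      -- The second coordinate exists because n ≥ 2; for n = 1 there would be no Lebesgue variable
      -- left.
      (g := fun ξ => (ξ ⟨1, by omega⟩ : ℂ)) (by fun_prop) (fun ξ => Circle.coe_ne_zero _)
      fun w hw => integral_coordinateClark n hn α hw
  · exact hasClarkTheory isInner_productInner
      fun α => ⟨_, isPolarizedClarkMeasure_productInner α⟩
  · exact clarkMeasure_eq isInner_productInner (isPolarizedClarkMeasure_productInner α)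
  · exact isUnitaryOperator_clarkOperator isInner_productInner
      (isPolarizedClarkMeasure_productInner α) (total_productClark α)
  · exact hasClarkTheory isInner_rationalInner isPolarizedClarkMeasure_rationalInner
  · exact ⟨blaschkeCircle hα, rationalDensity (norm_mobiusParam_lt hα), coe_blaschkeCircle hα,
      fun ξ hξ => rationalDensity_eq_zero _ hξ,
      clarkMeasure_eq isInner_rationalInner (isPolarizedClarkMeasure_graphClark hα)⟩
  · exact isUnitaryOperator_clarkOperator isInner_rationalInner
      (isPolarizedClarkMeasure_graphClark hα) (total_graphClark hα)
  · exact clarkMeasure_eq isInner_rationalInner (isPolarizedClarkMeasure_crossClark hα)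
  · exact not_isUnitaryOperator_clarkOperator isInner_rationalInner
      (isPolarizedClarkMeasure_crossClark hα)
      (g := fun ξ => (ξ 0 : ℂ) * ξ 1) (by fun_prop)
      (fun ξ => mul_ne_zero (Circle.coe_ne_zero _) (Circle.coe_ne_zero _))
      fun w hw => integral_mul_crossClark α hw
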